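/- Let $\overline\Omega$ be a compact connected $C^\infty$ Riemannian manifold of dimension $d\ge 1$ with (possibly empty) boundary $\partial\Omega$ and interior $\Omega$ (for instance the closure of a bounded connected smooth open subset of $\mathbb R^d$), and let $f:\overline\Omega\to\mathbb R$ be $C^\infty$. On $\partial\Omega$ let $n$ be the unit outward normal, $\partial_n f=\nabla f\cdot n$ and $\nabla_T f=\nabla f-(\partial_n f)\,n$. Assume * [H1] $f$ is a Morse function on $\Omega$, $f|_{\partial\Omega}$ is a Morse function, and $f$ has no critical point on $\partial\Omega$; * [H3] $\partial_n f>0$ on $\partial\Omega$. Put $g=|\nabla f|$ on $\Omega$ and $g=|\nabla_T f|$ on $\partial\Omega$. For a Lipschitz curve $\gamma:I\to\overline\Omega$ on an interval $I$ let $L(\gamma,I)=\int_I g(\gamma(t))\,|\gamma'(t)|\,dt\in[0,\infty]$. The Agmon distance is $d_a(x,y)=\inf_\gamma L(\gamma,(0,1))$ over the Lipschitz curves $\gamma:[0,1]\to\overline\Omega$ with $\gamma(0)=x$, $\gamma(1)=y$; for $x,y\in\partial\Omega$, $d_a^{\partial\Omega}(x,y)$ is the infimum of $\int_0^1|\nabla_Tf(\gamma)|\,|\gamma'|\,dt$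 over the Lipschitz curves $\gamma:[0,1]\to\partial\Omega$ with $\gamma(0)=x$, $\gamma(1)=y$. Let $A(x,y)$ be the set of Lipschitz curves $\gamma:[0,1]\to\overline\Omega$ with $\gamma(0)=x$, $\gamma(1)=y$ such that the boundary (in $\mathbb R$) of $\{t\in[0,1]:\gamma(t)\in\partial\Omega\}$ is finite. A local eikonal solution at a zero $p$ of $g$ is a $C^\infty$ function $\Phi:V\to\mathbb R$ on an open neighbourhood $V$ of $p$ in $\overline\Omega$ such that: * if $p\in\Omega$: $V\subset\Omega$, $|\nabla\Phi|^2=|\nabla f|^2$ on $V$, and $\Phi=\frac12\sum_i|\mu_i|y_i^2+O(|y|^3)$ at $p$, where $\mu_1,\dots,\mu_d$ are the eigenvalues of the Hessian of $f$ at $p$ and the $y_i$ are local coordinates centred at $p$ whose coordinate vectors at $p$ form an orthonormal basis of eigenvectors; * if $p\in\partial\Omega$: $|\nabla\Phi|^2=|\nabla f|^2$ on $V\cap\Omega$, and $\Phi=d_a^{\partial\Omega}(p,\cdot)$ (which is finite there) and $\partial_n\Phi<0$ on $V\cap\partial\Omega$. A curve $\sigma:[0,\infty)\to\overline\Omega$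 is called an eikonal ray if there are a zero $p$ of $g$ and a local eikonal solution $\Phi:V\to\mathbb R$ at $p$ such that $\sigma$ takes its values in $V$, $\lim_{t\to\infty}\sigma(t)=p$, $L(\sigma,[0,\infty))=d_a(\sigma(0),p)$, and: if $p\in\Omega$, then $\sigma'=-\nabla\Phi(\sigma)$ on $[0,\infty)$; if $p\in\partial\Omega$, then at every $t\ge0$ the right derivative of $\sigma$ is $-\nabla\Phi(\sigma(t))$ when $\sigma(t)\in\Omega$ and $-\nabla_T\Phi(\sigma(t))$ when $\sigma(t)\in\partial\Omega$, and the boundary of $\{t\ge0:\sigma(t)\in\partial\Omega\}$ is empty or a single point. Theorem. For all $x,y\in\overline\Omega$ there are finitely many (at least one) Lipschitz curves $\gamma_1,\dots,\gamma_N$ with values in $\overline\Omega$, $\gamma_j$ being defined on an interval $I_j\in\{[0,1],\,[0,\infty),\,(-\infty,0]\}$, such that for every $j$ the boundary of $\{t\in I_j:\gamma_j(t)\in\partial\Omega\}$ is finite, and $$d_a(x,y)=\sum_{j=1}^N L(\gamma_j,I_j)<\infty .$$ If $I_j=[0,1]$, then $\gamma_j\in A(\gamma_j(0),\gamma_j(1))$.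 If $I_j=[0,\infty)$ or $I_j=(-\infty,0]$, then $\gamma_j$ is continuous and piecewise $C^\infty$; in the first case $\gamma_j$ is an eikonal ray, in the second case $t\mapsto\gamma_j(-t)$ is one. Finally, the curves are concatenated from $x$ to $y$: all the limits below exist and $$\lim_{t\to(\inf I_1)^+}\gamma_1(t)=x,\qquad \lim_{t\to(\sup I_N)^-}\gamma_N(t)=y,\qquad \lim_{t\to(\sup I_k)^-}\gamma_k(t)=\lim_{t\to(\inf I_{k+1})^+}\gamma_{k+1}(t)\quad(1\le k\le N-1).$$ -/

import Mathlib

open scoped Manifold ContDiff ENNReal Topology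
open Bundle Set Filter MeasureTheory

namespace Agmon

noncomputable section

/-! ### Gradients, the outward normal and tangential gradients on a manifold with boundary -/

section Weight

variable {d : ℕ} [NeZero d] {M : Type*} [EMetricSpace M] [ChartedSpace (EuclideanHalfSpace d) M]
  [RiemannianBundle (fun x : M => TangentSpace (𝓡∂ d) x)]

/-- The tangent vector at `x` that represents the linear form `l` on `T_x M` through the Riemannian
scalar product: `⟪dualVector l, v⟫ = l v` for all `v`. -/
def dualVector {x : M} (l : TangentSpace (𝓡∂ d) x →L[ℝ] ℝ) : TangentSpace (𝓡∂ d) x :=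
  haveI : FiniteDimensional ℝ (TangentSpace (𝓡∂ d) x) :=
    inferInstanceAs (FiniteDimensional ℝ (EuclideanSpace ℝ (Fin d)))
  haveI : CompleteSpace (TangentSpace (𝓡∂ d) x) :=
    FiniteDimensional.complete ℝ (TangentSpace (𝓡∂ d) x)
  (InnerProductSpace.toDual ℝ (TangentSpace (𝓡∂ d) x)).symm l

/-- The Riemannian gradient `∇ h (x)`. -/
def grad (h : M → ℝ) (x : M) : TangentSpace (𝓡∂ d) x :=
  dualVector (mfderiv (𝓡∂ d) 𝓘(ℝ, ℝ) h x)

/-- A tangent vector at `x`, read in the preferred chart at `x` (in Mathlib `T_x M` is the model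
space, identified through that chart). -/
def toModel {d : ℕ} [NeZero d] {M : Type*} [EMetricSpace M] [ChartedSpace (EuclideanHalfSpace d) M]
    {x : M} (v : TangentSpace (𝓡∂ d) x) : EuclideanSpace ℝ (Fin d) :=
  v

/-- The differential at `x` of the zeroth coordinate of the preferred chart at `x`, which is
`v ↦ (toModel v) 0`. At a boundary point `x`, where the chart maps
`M` to `{y | 0 ≤ y 0}` and `∂M` to `{y | y 0 = 0}`, its kernel is the tangent space `T_x ∂M`, and
the vectors on which it is negative are those that point out of `M`. -/
def normalForm (x : M) : TangentSpace (𝓡∂ d) x →L[ℝ] ℝ :=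
  (EuclideanSpace.proj (0 : Fin d) : EuclideanSpace ℝ (Fin d) →L[ℝ] ℝ)

/-- The unit outward normal to the boundary at a boundary point `x`. -/
def outwardNormal (x : M) : TangentSpace (𝓡∂ d) x :=
  -((‖dualVector (normalForm (d := d) x)‖)⁻¹ • dualVector (normalForm (d := d) x))

/-- The normal derivative `∂_n h (x) = ∇ h (x) · n`, for a boundary point `x`. -/
def normalDeriv (d : ℕ) [NeZero d] {M : Type*} [EMetricSpace M]
    [ChartedSpace (EuclideanHalfSpace d) M]
    [RiemannianBundle (fun x : M => TangentSpace (𝓡∂ d) x)] (h : M → ℝ) (x : M) : ℝ :=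
  inner ℝ (grad (d := d) h x) (outwardNormal x)

/-- The tangential gradient `∇_T h (x) = ∇ h (x) - (∇ h (x) · n) n`, for a boundary point `x`. -/
def tangGrad (h : M → ℝ) (x : M) : TangentSpace (𝓡∂ d) x :=
  grad h x - normalDeriv d h x • outwardNormal x

end Weight

section Distance

variable (d : ℕ) [NeZero d] {M : Type*} [EMetricSpace M] [ChartedSpace (EuclideanHalfSpace d) M]
  [RiemannianBundle (fun x : M => TangentSpace (𝓡∂ d) x)]

open Classical in
/-- The weight `g`: `|∇ f|` in the interior and `|∇_T f|` on the boundary. -/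
def weight (f : M → ℝ) (x : M) : ℝ :=
  if x ∈ (𝓡∂ d).boundary M then ‖tangGrad (d := d) f x‖ else ‖grad (d := d) f x‖

/-- The length `L(γ, S) = ∫_S g(γ(t)) |γ'(t)| dt ∈ [0, ∞]` of a curve on an interval `S`. -/
def length (f : M → ℝ) (γ : ℝ → M) (S : Set ℝ) : ℝ≥0∞ :=
  ∫⁻ t in S, ENNReal.ofReal (weight d f (γ t) * ‖mfderiv 𝓘(ℝ, ℝ) (𝓡∂ d) γ t 1‖)

/-- `γ` is a Lipschitz curve on `S`, for the Riemannian distance (only the values of `γ` on `S`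
matter). -/
def IsLipschitzCurve {M : Type*} [EMetricSpace M] (γ : ℝ → M) (S : Set ℝ) : Prop :=
  ∃ K : NNReal, LipschitzOnWith K γ S

/-- The set `{t ∈ S | γ(t) ∈ ∂M}`. -/
def boundaryTimes (γ : ℝ → M) (S : Set ℝ) : Set ℝ :=
  {t | t ∈ S ∧ γ t ∈ (𝓡∂ d).boundary M}

/-- The Agmon distance `d_a(x, y)`: the infimum of `L(γ, (0,1))` over all Lipschitz curves
`γ : [0,1] → M` from `x` to `y`. -/
def agmonDist (f : M → ℝ) (x y : M) : ℝ≥0∞ :=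
  ⨅ γ ∈ {γ : ℝ → M | IsLipschitzCurve γ (Icc 0 1) ∧ γ 0 = x ∧ γ 1 = y},
    length d f γ (Ioo 0 1)

/-- The Agmon distance in the boundary: the infimum of `∫₀¹ |∇_T f(γ)| |γ'| dt` over all Lipschitz
curves `γ : [0,1] → ∂M` from `x` to `y`. It is infinite when there is no such curve. -/
def boundaryAgmonDist (f : M → ℝ) (x y : M) : ℝ≥0∞ :=
  ⨅ γ ∈ {γ : ℝ → M | IsLipschitzCurve γ (Icc 0 1) ∧
      (∀ t ∈ Icc (0 : ℝ) 1, γ t ∈ (𝓡∂ d).boundary M) ∧ γ 0 = x ∧ γ 1 = y},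
    ∫⁻ t in Ioo (0 : ℝ) 1,
      ENNReal.ofReal (‖tangGrad (d := d) f (γ t)‖ * ‖mfderiv 𝓘(ℝ, ℝ) (𝓡∂ d) γ t 1‖)

/-- The set `A(x, y)` of Lipschitz curves `γ : [0,1] → M` from `x` to `y` for which the boundary of
`{t ∈ [0,1] | γ(t) ∈ ∂M}` is finite. -/
def curvesA (x y : M) : Set (ℝ → M) :=
  {γ | IsLipschitzCurve γ (Icc 0 1) ∧ γ 0 = x ∧ γ 1 = y ∧
    (frontier (boundaryTimes d γ (Icc 0 1))).Finite}

/-! ### The hypotheses on `f` -/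

/-- The second derivative of `f` at `p`, read in the preferred chart at `p`, as a bilinear form on
`T_p M`. It is the Hessian of `f` at `p` if `p` is a critical point of `f`. Since that chart maps
`∂M` into a hyperplane, its restriction to `T_p ∂M` is the Hessian of `f|_{∂M}` at `p` if `p` is a
boundary point that is critical for `f|_{∂M}`. -/
def chartHessian (f : M → ℝ) (p : M) (v w : TangentSpace (𝓡∂ d) p) : ℝ :=
  let F : EuclideanSpace ℝ (Fin d) → ℝ := f ∘ (extChartAt (𝓡∂ d) p).symm
  fderivWithin ℝ (fderivWithin ℝ F (range (𝓡∂ d))) (range (𝓡∂ d)) (extChartAt (𝓡∂ d) p p) v w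

/-- Hypothesis [H1]: `f` is a Morse function in the interior, its restriction to the boundary is a
Morse function, and `f` has no critical point on the boundary. -/
structure H1 (f : M → ℝ) : Prop where
  morse_interior : ∀ p ∈ (𝓡∂ d).interior M, grad (d := d) f p = 0 →
    ∀ v : TangentSpace (𝓡∂ d) p, (∀ w, chartHessian d f p v w = 0) → v = 0
  morse_boundary : ∀ p ∈ (𝓡∂ d).boundary M, tangGrad (d := d) f p = 0 →
    ∀ v : TangentSpace (𝓡∂ d) p, normalForm p v = 0 →
      (∀ w, normalForm p w = 0 → chartHessian d f p v w = 0) → v = 0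
  no_critical_boundary : ∀ p ∈ (𝓡∂ d).boundary M, grad (d := d) f p ≠ 0

/-- Hypothesis [H3]: `∂_n f > 0` on the boundary. -/
def H3 (f : M → ℝ) : Prop :=
  ∀ p ∈ (𝓡∂ d).boundary M, 0 < normalDeriv d f p

/-! ### Local solutions of the eikonal equation and their gradient flows -/

/-- `Φ` is a smooth solution of `|∇Φ|² = |∇f|²` in the open neighbourhood `V ⊆ int M` of the
critical point `p` of `f`, and `Φ = ½ ∑ |μ_i| y_i² + O(|y|³)` at `p`, where the `μ_i` are the
eigenvalues of the Hessian of `f` at `p` and the `y_i` are coordinates along an orthonormal basis of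
eigenvectors. -/
structure IsInteriorEikonal (f : M → ℝ) (p : M) (V : Set M) (Φ : M → ℝ) : Prop where
  critical : grad (d := d) f p = 0
  isOpen : IsOpen V
  mem : p ∈ V
  subset : V ⊆ (𝓡∂ d).interior M
  smooth : ContMDiffOn (𝓡∂ d) 𝓘(ℝ, ℝ) ∞ Φ V
  eikonal : ∀ x ∈ V, ‖grad (d := d) Φ x‖ ^ 2 = ‖grad (d := d) f x‖ ^ 2
  expansion : ∃ (e : OrthonormalBasis (Fin d) ℝ (TangentSpace (𝓡∂ d) p)) (μ : Fin d → ℝ),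
    (∀ i j, chartHessian d f p (e i) (e j) = if i = j then μ i else 0) ∧
    (fun y : EuclideanSpace ℝ (Fin d) =>
        Φ ((extChartAt (𝓡∂ d) p).symm
            (extChartAt (𝓡∂ d) p p +
              toModel (∑ i, y i • e i : TangentSpace (𝓡∂ d) p)))
          - 1 / 2 * ∑ i, |μ i| * y i ^ 2)
      =O[𝓝 0] fun y => ‖y‖ ^ 3

/-- `Φ` is a smooth solution, in the open neighbourhood `V` of the critical point `p ∈ ∂M` of
`f|_{∂M}`, of `|∇Φ|² = |∇f|²` in `V ∩ int M`, `Φ = d_a^{∂M}(p, ·)` and `∂_n Φ < 0` on `V ∩ ∂M`. -/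
structure IsBoundaryEikonal (f : M → ℝ) (p : M) (V : Set M) (Φ : M → ℝ) : Prop where
  boundary : p ∈ (𝓡∂ d).boundary M
  critical : tangGrad (d := d) f p = 0
  isOpen : IsOpen V
  mem : p ∈ V
  smooth : ContMDiffOn (𝓡∂ d) 𝓘(ℝ, ℝ) ∞ Φ V
  eikonal : ∀ x ∈ V ∩ (𝓡∂ d).interior M, ‖grad (d := d) Φ x‖ ^ 2 = ‖grad (d := d) f x‖ ^ 2
  boundary_value : ∀ x ∈ V ∩ (𝓡∂ d).boundary M,
    boundaryAgmonDist d f p x ≠ ⊤ ∧ Φ x = (boundaryAgmonDist d f p x).toReal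
  normal_neg : ∀ x ∈ V ∩ (𝓡∂ d).boundary M, normalDeriv d Φ x < 0

open Classical in
/-- The vector field equal to `-∇Φ` in the interior and to `-∇_T Φ` on the boundary. -/
def descentField (Φ : M → ℝ) (x : M) : TangentSpace (𝓡∂ d) x :=
  if x ∈ (𝓡∂ d).boundary M then -tangGrad Φ x else -grad Φ x

/-- `σ`, on `[0, ∞)`, is a gradient descent curve of a local eikonal solution `Φ` near a zero `p` of
the weight: it stays in the domain of `Φ`, converges to `p` and realizes the Agmon distance from
`σ(0)` to `p`. Near an interior zero it stays in the interior and `σ' = -∇Φ(σ)`. Near a boundary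
zero, `σ'` equals `-∇Φ(σ)` in the interior and `-∇_T Φ(σ)` on the boundary (a right derivative,
because of the instant at which `σ` hits the boundary), and the boundary of the set of times at
which `σ` lies on `∂M` has at most one point. -/
def IsEikonalRay (f : M → ℝ) (σ : ℝ → M) : Prop :=
  ∃ (p : M) (V : Set M) (Φ : M → ℝ),
    MapsTo σ (Ici 0) V ∧ Tendsto σ atTop (𝓝 p) ∧
    agmonDist d f (σ 0) p = length d f σ (Ici 0) ∧
    ((IsInteriorEikonal d f p V Φ ∧
        IsMIntegralCurveOn (I := 𝓡∂ d) σ (fun x => -grad Φ x) (Ici 0)) ∨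
      (IsBoundaryEikonal d f p V Φ ∧
        (∀ t ∈ Ici (0 : ℝ), HasMFDerivWithinAt 𝓘(ℝ, ℝ) (𝓡∂ d) σ (Ici t) t
          ((1 : ℝ →L[ℝ] ℝ).smulRight (descentField d Φ (σ t)))) ∧
        (frontier (boundaryTimes d σ (Ici 0))).Subsingleton))

end Distance

/-- `γ` is continuous and piecewise `C^∞` on the interval `S`: there are finitely many break points
such that `γ` is smooth on each subinterval of `S` whose interior contains no break point. -/
def IsPiecewiseSmooth (d : ℕ) [NeZero d] {M : Type*} [EMetricSpace M]
    [ChartedSpace (EuclideanHalfSpace d) M] (γ : ℝ → M) (S : Set ℝ) : Prop :=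
  ContinuousOn γ S ∧ ∃ T : Finset ℝ, ∀ J ⊆ S, J.OrdConnected → (∀ t ∈ T, t ∉ interior J) →
    ContMDiffOn 𝓘(ℝ, ℝ) (𝓡∂ d) ∞ γ J

/-! ### The three kinds of parameter intervals -/

/-- The kinds of parameter intervals: `[0,1]`, `[0,∞)` and `(-∞,0]`. -/
inductive IntervalKind
  | unit
  | forward
  | backward

/-- The interval `I`. -/
def IntervalKind.toSet : IntervalKind → Set ℝ
  | .unit => Icc 0 1
  | .forward => Ici 0
  | .backward => Iic 0

/-- The filter of `t → (inf I)⁺`. -/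
def IntervalKind.atStart : IntervalKind → Filter ℝ
  | .unit => 𝓝[>] 0
  | .forward => 𝓝[>] 0
  | .backward => atBot

/-- The filter of `t → (sup I)⁻`. -/
def IntervalKind.atEnd : IntervalKind → Filter ℝ
  | .unit => 𝓝[<] 1
  | .forward => atTop
  | .backward => 𝓝[<] 0

end

end Agmon

/-!
The infimum that defines the Agmon distance is attained, by a single Lipschitz curve `[0, 1] → M`
which moreover belongs to `A(x, y)`. This is stronger than a decomposition into several curves with
eikonal rays near the zeros of the weight `g`: such a ray converges to a zero in infinite time, but
its Riemannian length is finite, so that the limit point can be reached at a finite time after a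
reparametrization.

*Existence.* The weight `g` is not continuous at the boundary, but it is lower semicontinuous: it
is the norm of the differential of `f` on the vectors tangent to the stratum (the interior or the
boundary), and strata only become larger nearby. For such a weight the length of a Lipschitz curve
is a supremum of sums over subdivisions (`WeightedLength.wlen_eq_lintegral`), hence it is lower
semicontinuous under uniform convergence, and by Arzelà–Ascoli it has a minimizer among the curves
with a given Lipschitz constant (`WeightedLength.exists_wlen_le_wdist`). It remains to bound the
Riemannian length of almost minimizing curves. Where `g` is bounded below this is clear. Near a zero
`p` of `g`, nondegeneracy ([H1]) says that on the stratum of `p` the weight is comparable with the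
distance to `p`, while off the stratum it is bounded below because `f` has no critical point on the
boundary (`WeightedLength.TameAt`, `Agmon.tameAt`). An almost minimizing curve cannot use more
weighted length, between two points of the stratum at distance at most `r` from `p`, than the
`O(r²)` of a direct path; since `g ≥ c r` in the annulus `r/2 ≤ d(·, p) ≤ r`, its Riemannian length
in the annulus is `O(r)`, and the sum over dyadic radii converges
(`WeightedLength.TameAt.exists_lengthBoundedIn`). To make this uniform, `g` is replaced by `g + ε`,
which prevents wandering at no cost around `p`; the bound does not depend on `ε`.

*Visits to the boundary.* By [H3], `|∇_T f| < |∇ f|` on the boundary. An excursion of a minimizing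
curve into the interior, with end points on the boundary close to each other, would therefore be
longer than the path along the boundary between the same end points
(`Agmon.exists_wdist_le_boundary`). So excursions cannot accumulate, and the set of times spent on
the boundary has finitely many boundary points (`WeightedLength.finite_frontier_of_minimizer`).
-/

namespace WeightedLength

open scoped NNReal

variable {X : Type*} [EMetricSpace X]

/-! ### The weighted length of a curve in a metric space -/

/-- The curve `γ` has metric speed `v` at time `t`, in the strong sense that
`d(γ s, γ s') / (s' - s) → v` when `s ≤ t ≤ s'` both tend to `t`. -/
def HasSpeedAt (γ : ℝ → X) (t : ℝ) (v : ℝ≥0∞) : Prop :=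
  Tendsto (fun p : ℝ × ℝ => edist (γ p.1) (γ p.2) / ENNReal.ofReal (p.2 - p.1))
    (𝓝 (t, t) ⊓ 𝓟 {p | p.1 ≤ t ∧ t ≤ p.2 ∧ p.1 < p.2}) (𝓝 v)

/-- The function `v` is the metric speed of `γ` at almost every time of the interval `(a, b)`. -/
def HasSpeedOn (γ : ℝ → X) (v : ℝ → ℝ≥0∞) (a b : ℝ) : Prop :=
  ∀ᵐ t ∂(volume.restrict (Ioo a b)), HasSpeedAt γ t (v t)

/-- The length of `γ` on `[a, b]` for the weight `g`, defined without derivatives, in the manner of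
the variation of a function: the supremum over the subdivisions `u` of `[a, b]` of the sums of
`(inf g(γ) on [uᵢ, uᵢ₊₁]) * d(γ uᵢ, γ uᵢ₊₁)`. -/
noncomputable def wlen (g : X → ℝ≥0∞) (γ : ℝ → X) (a b : ℝ) : ℝ≥0∞ :=
  ⨆ p : ℕ × {u : ℕ → ℝ // Monotone u ∧ ∀ i, u i ∈ Icc a b},
    ∑ i ∈ Finset.range p.1, (⨅ t ∈ Icc (p.2.1 i) (p.2.1 (i + 1)), g (γ t)) *
      edist (γ (p.2.1 i)) (γ (p.2.1 (i + 1)))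

lemma sum_le_wlen (g : X → ℝ≥0∞) (γ : ℝ → X) {a b : ℝ} (n : ℕ) {u : ℕ → ℝ} (hu : Monotone u)
    (hu' : ∀ i, u i ∈ Icc a b) :
    ∑ i ∈ Finset.range n, (⨅ t ∈ Icc (u i) (u (i + 1)), g (γ t)) *
      edist (γ (u i)) (γ (u (i + 1))) ≤ wlen g γ a b :=
  le_iSup (fun p : ℕ × {u : ℕ → ℝ // Monotone u ∧ ∀ i, u i ∈ Icc a b} =>
    ∑ i ∈ Finset.range p.1, (⨅ t ∈ Icc (p.2.1 i) (p.2.1 (i + 1)), g (γ t)) *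
      edist (γ (p.2.1 i)) (γ (p.2.1 (i + 1)))) (n, ⟨u, hu, hu'⟩)

/-- Reparametrization by a continuous monotone map does not increase the weighted length. -/
lemma wlen_comp_le (g : X → ℝ≥0∞) (γ : ℝ → X) {a b c d : ℝ} {τ : ℝ → ℝ}
    (hc : ContinuousOn τ (Icc a b)) (hm : MonotoneOn τ (Icc a b))
    (hmaps : MapsTo τ (Icc a b) (Icc c d)) :
    wlen g (γ ∘ τ) a b ≤ wlen g γ c d := by
  refine iSup_le fun ⟨n, u, hu, hu'⟩ => ?_
  have hmono : Monotone fun i => τ (u i) := fun i j hij => hm (hu' i) (hu' j) (hu hij)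
  refine le_trans ?_ (sum_le_wlen g γ n hmono fun i => hmaps (hu' i))
  refine Finset.sum_le_sum fun i _ => mul_le_mul_left ?_ _
  refine le_iInf₂ fun t ht => ?_
  have hsub : Icc (u i) (u (i + 1)) ⊆ Icc a b := Icc_subset_Icc (hu' i).1 (hu' (i + 1)).2
  obtain ⟨s, hs, rfl⟩ := intermediate_value_Icc (hu i.le_succ) (hc.mono hsub) ht
  exact iInf₂_le s hs

lemma wlen_congr (g : X → ℝ≥0∞) {γ γ' : ℝ → X} {a b : ℝ} (h : EqOn γ γ' (Icc a b)) :
    wlen g γ a b = wlen g γ' a b := by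
  have key : ∀ {γ γ' : ℝ → X}, EqOn γ γ' (Icc a b) → wlen g γ a b ≤ wlen g γ' a b := by
    intro γ γ' h
    refine iSup_le fun ⟨n, u, hu, hu'⟩ => ?_
    refine le_trans (Finset.sum_le_sum fun i _ => ?_) (sum_le_wlen g γ' n hu hu')
    have hsub : Icc (u i) (u (i + 1)) ⊆ Icc a b := Icc_subset_Icc (hu' i).1 (hu' (i + 1)).2
    rw [h (hu' i), h (hu' (i + 1))]
    gcongr with t ht
    exact (congrArg g (h (hsub ht))).le
  exact le_antisymm (key h) (key h.symm)

/-! ### Uniform subdivisions -/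

lemma setLIntegral_floor (F : ℤ → ℝ≥0∞) (a : ℝ) {h : ℝ} (hh : 0 < h) (n : ℕ) :
    ∫⁻ t in Ico a (a + h * n), F ⌊(t - a) / h⌋ =
      ∑ i ∈ Finset.range n, F i * ENNReal.ofReal h := by
  induction n with
  | zero => simp
  | succ n ih =>
    have hle : a + h * n ≤ a + h * (n + 1 : ℕ) := by push_cast; nlinarith
    have hle0 : a ≤ a + h * n := by have : 0 ≤ h * n := by positivity
                                    linarith
    rw [← Ico_union_Ico_eq_Ico hle0 hle, lintegral_union measurableSet_Ico
      (Set.disjoint_left.2 fun t h1 h2 => absurd h1.2 (not_lt.2 h2.1)), ih, Finset.sum_range_succ]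
    congr 1
    rw [setLIntegral_congr_fun (g := fun _ => F n) measurableSet_Ico]
    · rw [setLIntegral_const, Real.volume_Ico]
      congr 2; push_cast; ring
    · intro t ht
      have : ⌊(t - a) / h⌋ = (n : ℤ) := by
        rw [Int.floor_eq_iff]
        push_cast at ht ⊢
        constructor
        · rw [le_div_iff₀ hh]; linarith [ht.1]
        · rw [div_lt_iff₀ hh]; linarith [ht.2]
      simp only [this]

/-- The lower end of the interval of the subdivision of `[a, b]` into `n + 1` equal parts in which
`t` lies. -/
noncomputable def gridLow (a b : ℝ) (n : ℕ) (t : ℝ) : ℝ :=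
  a + (b - a) / (n + 1) * ⌊(t - a) / ((b - a) / (n + 1))⌋

/-- The upper end of the interval of the subdivision of `[a, b]` into `n + 1` equal parts in which
`t` lies. -/
noncomputable def gridHigh (a b : ℝ) (n : ℕ) (t : ℝ) : ℝ :=
  a + (b - a) / (n + 1) * (⌊(t - a) / ((b - a) / (n + 1))⌋ + 1)

lemma gridHigh_sub_gridLow (a b : ℝ) (n : ℕ) (t : ℝ) :
    gridHigh a b n t - gridLow a b n t = (b - a) / (n + 1) := by
  simp only [gridHigh, gridLow]; ring

lemma gridLow_le {a b : ℝ} (hab : a < b) (n : ℕ) (t : ℝ) : gridLow a b n t ≤ t := by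
  have hh : 0 < (b - a) / (n + 1) := div_pos (by linarith) (by positivity)
  have := Int.floor_le ((t - a) / ((b - a) / (n + 1)))
  rw [le_div_iff₀ hh] at this
  simp only [gridLow]; linarith

lemma lt_gridHigh {a b : ℝ} (hab : a < b) (n : ℕ) (t : ℝ) : t < gridHigh a b n t := by
  have hh : 0 < (b - a) / (n + 1) := div_pos (by linarith) (by positivity)
  have := Int.lt_floor_add_one ((t - a) / ((b - a) / (n + 1)))
  rw [div_lt_iff₀ hh] at this
  simp only [gridHigh]; linarith

lemma grid_mem {a b : ℝ} (hab : a < b) (n : ℕ) {t : ℝ} (ht : t ∈ Ioo a b) :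
    gridLow a b n t ∈ Icc a b ∧ gridHigh a b n t ∈ Icc a b := by
  have hh : 0 < (b - a) / (n + 1) := div_pos (by linarith) (by positivity)
  have h0 : 0 ≤ ⌊(t - a) / ((b - a) / (n + 1))⌋ :=
    Int.floor_nonneg.2 (div_nonneg (by linarith [ht.1]) hh.le)
  have h0' : (0 : ℝ) ≤ ⌊(t - a) / ((b - a) / (n + 1))⌋ := by exact_mod_cast h0
  have h1 : ⌊(t - a) / ((b - a) / (n + 1))⌋ + 1 ≤ (n + 1 : ℤ) := by
    rw [Int.add_one_le_iff, Int.floor_lt, div_lt_iff₀ hh]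
    push_cast
    rw [mul_div_cancel₀ _ (by positivity)]
    linarith [ht.2]
  have h1' : (⌊(t - a) / ((b - a) / (n + 1))⌋ : ℝ) + 1 ≤ n + 1 := by exact_mod_cast h1
  have hb : gridHigh a b n t ≤ b := by
    have := mul_le_mul_of_nonneg_left h1' hh.le
    rw [div_mul_cancel₀ _ (by positivity)] at this
    simp only [gridHigh]; linarith
  have ha : a ≤ gridLow a b n t := by
    simp only [gridLow]; nlinarith
  have := gridLow_le hab n t
  have := lt_gridHigh hab n t
  exact ⟨⟨ha, by linarith [ht.2]⟩, ⟨by linarith [ht.1], hb⟩⟩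

lemma tendsto_grid {a b : ℝ} (hab : a < b) (t : ℝ) :
    Tendsto (fun n => (gridLow a b n t, gridHigh a b n t)) atTop
      (𝓝 (t, t) ⊓ 𝓟 {p | p.1 ≤ t ∧ t ≤ p.2 ∧ p.1 < p.2}) := by
  have hlim : Tendsto (fun n : ℕ => (b - a) / (n + 1)) atTop (𝓝 0) :=
    tendsto_const_nhds.div_atTop
      (tendsto_atTop_add_const_right _ _ tendsto_natCast_atTop_atTop)
  refine tendsto_inf.2 ⟨?_, tendsto_principal.2 (Eventually.of_forall fun n =>
    ⟨gridLow_le hab n t, (lt_gridHigh hab n t).le, (gridLow_le hab n t).trans_lt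
      (lt_gridHigh hab n t)⟩)⟩
  refine Tendsto.prodMk_nhds ?_ ?_
  · refine tendsto_of_tendsto_of_tendsto_of_le_of_le (g := fun n : ℕ => t - (b - a) / (n + 1))
      (by simpa using hlim.const_sub t) tendsto_const_nhds (fun n => ?_)
      fun n => gridLow_le hab n t
    linarith [gridHigh_sub_gridLow a b n t, (lt_gridHigh hab n t)]
  · refine tendsto_of_tendsto_of_tendsto_of_le_of_le (h := fun n : ℕ => t + (b - a) / (n + 1))
      tendsto_const_nhds (by simpa using hlim.const_add t)
      (fun n => (lt_gridHigh hab n t).le) (fun n => ?_)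
    linarith [gridHigh_sub_gridLow a b n t, (gridLow_le hab n t)]

/-- The integral of a function of the interval of the uniform subdivision that contains `t`. -/
lemma setLIntegral_grid (F : ℝ → ℝ → ℝ≥0∞) {a b : ℝ} (hab : a < b) (n : ℕ) :
    ∫⁻ t in Ioo a b, F (gridLow a b n t) (gridHigh a b n t) /
        ENNReal.ofReal (gridHigh a b n t - gridLow a b n t) =
      ∑ i ∈ Finset.range (n + 1),
        F (a + (b - a) / (n + 1) * i) (a + (b - a) / (n + 1) * (i + 1)) := by
  have hh : 0 < (b - a) / (n + 1) := div_pos (by linarith) (by positivity)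
  have hb : b = a + (b - a) / (n + 1) * (n + 1 : ℕ) := by
    push_cast; rw [div_mul_cancel₀ _ (by positivity)]; ring
  simp only [gridHigh_sub_gridLow]
  have := setLIntegral_floor (fun k => F (a + (b - a) / (n + 1) * k)
    (a + (b - a) / (n + 1) * (k + 1)) / ENNReal.ofReal ((b - a) / (n + 1))) a hh (n + 1)
  rw [← hb] at this
  rw [restrict_Ioo_eq_restrict_Ico]
  simp only [gridLow, gridHigh]
  rw [this]
  refine Finset.sum_congr rfl fun i _ => ?_
  rw [ENNReal.div_mul_cancel (by simpa using hh) ENNReal.ofReal_ne_top]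
  simp

lemma measurable_grid (F : ℝ → ℝ → ℝ≥0∞) (a b : ℝ) (n : ℕ) :
    Measurable fun t => F (gridLow a b n t) (gridHigh a b n t) /
        ENNReal.ofReal (gridHigh a b n t - gridLow a b n t) := by
  have : (fun t => F (gridLow a b n t) (gridHigh a b n t) /
        ENNReal.ofReal (gridHigh a b n t - gridLow a b n t)) =
      (fun k : ℤ => F (a + (b - a) / (n + 1) * k) (a + (b - a) / (n + 1) * (k + 1)) /
        ENNReal.ofReal ((b - a) / (n + 1))) ∘ fun t => ⌊(t - a) / ((b - a) / (n + 1))⌋ := by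
    funext t
    simp only [gridHigh_sub_gridLow, Function.comp_apply]
    simp only [gridLow, gridHigh]
  rw [this]
  exact measurable_from_top.comp (by fun_prop)

/-! ### The weighted length as the integral of the weight times the metric speed -/

section Speed

variable {γ : ℝ → X} {v : ℝ → ℝ≥0∞} {a b : ℝ} {K : ℝ≥0}

lemma HasSpeedOn.mono (hv : HasSpeedOn γ v a b) {c d : ℝ} (hc : a ≤ c) (hd : d ≤ b) :
    HasSpeedOn γ v c d :=
  ae_restrict_of_ae_restrict_of_subset (Ioo_subset_Ioo hc hd) hv

lemma HasSpeedOn.aemeasurable (hv : HasSpeedOn γ v a b) :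
    AEMeasurable v (volume.restrict (Ioo a b)) := by
  rcases le_or_gt b a with hab | hab
  · simp [Ioo_eq_empty (not_lt.2 hab)]
  refine aemeasurable_of_tendsto_metrizable_ae atTop
    (fun n => (measurable_grid (fun s s' => edist (γ s) (γ s')) a b n).aemeasurable) ?_
  filter_upwards [hv] with t ht using ht.comp (tendsto_grid hab t)

lemma edist_div_le (hγ : LipschitzOnWith K γ (Icc a b)) {s s' : ℝ} (hs : s ∈ Icc a b)
    (hs' : s' ∈ Icc a b) (hlt : s < s') :
    edist (γ s) (γ s') / ENNReal.ofReal (s' - s) ≤ K := by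
  refine ENNReal.div_le_of_le_mul ?_
  have := hγ hs hs'
  rwa [edist_comm s, edist_dist, Real.dist_eq, abs_of_pos (sub_pos.2 hlt)] at this

lemma HasSpeedOn.le_lipschitz (hv : HasSpeedOn γ v a b) (hγ : LipschitzOnWith K γ (Icc a b)) :
    ∀ᵐ t ∂(volume.restrict (Ioo a b)), v t ≤ K := by
  rcases le_or_gt b a with hab | hab
  · simp [Ioo_eq_empty (not_lt.2 hab)]
  filter_upwards [hv, ae_restrict_mem measurableSet_Ioo] with t ht hmem
  refine le_of_tendsto (ht.comp (tendsto_grid hab t)) (Eventually.of_forall fun n => ?_)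
  exact edist_div_le hγ (grid_mem hab n hmem).1 (grid_mem hab n hmem).2
    ((gridLow_le hab n t).trans_lt (lt_gridHigh hab n t))

/-- The distance between the ends of a Lipschitz curve is at most the integral of its speed. -/
lemma edist_le_lintegral (hγ : LipschitzOnWith K γ (Icc a b)) (hv : HasSpeedOn γ v a b)
    (hab : a ≤ b) : edist (γ a) (γ b) ≤ ∫⁻ t in Ioo a b, v t := by
  rcases hab.eq_or_lt with rfl | hab
  · simp
  have hlim := tendsto_lintegral_of_dominated_convergence' (μ := volume.restrict (Ioo a b))
    (F := fun n t => edist (γ (gridLow a b n t)) (γ (gridHigh a b n t)) /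
      ENNReal.ofReal (gridHigh a b n t - gridLow a b n t)) (f := v) (fun _ => (K : ℝ≥0∞))
    (fun n => (measurable_grid (fun s s' => edist (γ s) (γ s')) a b n).aemeasurable)
    (fun n => ?_) (by simp [ENNReal.mul_eq_top]) ?_
  · refine ge_of_tendsto hlim (Eventually.of_forall fun n => ?_)
    rw [setLIntegral_grid (fun s s' => edist (γ s) (γ s')) hab n]
    have := edist_le_range_sum_edist (fun i : ℕ => γ (a + (b - a) / (n + 1) * i)) (n + 1)
    push_cast at this
    simpa [div_mul_cancel₀ (b - a) (show (n + 1 : ℝ) ≠ 0 by positivity)] using this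
  · filter_upwards [ae_restrict_mem measurableSet_Ioo] with t hmem
    exact edist_div_le hγ (grid_mem hab n hmem).1 (grid_mem hab n hmem).2
      ((gridLow_le hab n t).trans_lt (lt_gridHigh hab n t))
  · filter_upwards [hv] with t ht using ht.comp (tendsto_grid hab t)

lemma sum_setLIntegral_le (f : ℝ → ℝ≥0∞) {u : ℕ → ℝ} (hu : Monotone u) (n : ℕ) :
    ∑ i ∈ Finset.range n, ∫⁻ t in Ioo (u i) (u (i + 1)), f t ≤ ∫⁻ t in Ioo (u 0) (u n), f t := by
  induction n with
  | zero => simp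
  | succ n ih =>
    rw [Finset.sum_range_succ]
    refine (add_le_add_left ih _).trans ?_
    rw [← lintegral_union measurableSet_Ioo
      (Set.disjoint_left.2 fun t h1 h2 => absurd h1.2 (not_lt.2 h2.1.le))]
    exact lintegral_mono_set (union_subset (Ioo_subset_Ioo le_rfl (hu n.le_succ))
      (Ioo_subset_Ioo (hu n.zero_le) le_rfl))

/-- The weighted length by subdivisions is the integral of the weight times the speed. That it is
not smaller follows from Fatou's lemma along the uniform subdivisions, on which the infimum of the
weight has a lower limit at least `g (γ t)` by lower semicontinuity. -/
theorem wlen_eq_lintegral {g : X → ℝ≥0∞} (hg : LowerSemicontinuous g)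
    (hγ : LipschitzOnWith K γ (Icc a b)) (hv : HasSpeedOn γ v a b) (hab : a ≤ b) :
    wlen g γ a b = ∫⁻ t in Ioo a b, g (γ t) * v t := by
  apply le_antisymm
  · refine iSup_le fun ⟨n, u, hu, hu'⟩ => ?_
    have h1 : ∑ i ∈ Finset.range n, ∫⁻ t in Ioo (u i) (u (i + 1)), g (γ t) * v t ≤
        ∫⁻ t in Ioo a b, g (γ t) * v t :=
      (sum_setLIntegral_le _ hu n).trans
        (lintegral_mono_set (Ioo_subset_Ioo (hu' 0).1 (hu' n).2))
    refine le_trans (Finset.sum_le_sum fun i _ => ?_) h1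
    have hv' : HasSpeedOn γ v (u i) (u (i + 1)) := hv.mono (hu' i).1 (hu' (i + 1)).2
    calc _ ≤ (⨅ t ∈ Icc (u i) (u (i + 1)), g (γ t)) * ∫⁻ t in Ioo (u i) (u (i + 1)), v t := by
          gcongr
          exact edist_le_lintegral
            (hγ.mono (Icc_subset_Icc (hu' i).1 (hu' (i + 1)).2)) hv' (hu i.le_succ)
      _ = ∫⁻ t in Ioo (u i) (u (i + 1)), (⨅ t ∈ Icc (u i) (u (i + 1)), g (γ t)) * v t :=
          (lintegral_const_mul'' _ hv'.aemeasurable).symm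
      _ ≤ _ := by
          refine setLIntegral_mono' measurableSet_Ioo fun t ht => ?_
          gcongr
          exact iInf₂_le t ⟨ht.1.le, ht.2.le⟩
  · rcases hab.eq_or_lt with rfl | hab
    · simp
    set F : ℝ → ℝ → ℝ≥0∞ := fun s s' => (⨅ t ∈ Icc s s', g (γ t)) * edist (γ s) (γ s') with hF
    have hn : ∀ n : ℕ, ∫⁻ t in Ioo a b, F (gridLow a b n t) (gridHigh a b n t) /
        ENNReal.ofReal (gridHigh a b n t - gridLow a b n t) ≤ wlen g γ a b := by
      intro n
      rw [setLIntegral_grid F hab n]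
      have hh : 0 < (b - a) / (n + 1) := div_pos (by linarith) (by positivity)
      -- the subdivision has to be stopped at `b` after `n + 1` steps
      set u : ℕ → ℝ := fun i => a + (b - a) / (n + 1) * (min i (n + 1) : ℕ) with hu
      have hmono : Monotone u := by
        intro i j hij
        simp only [hu]
        gcongr
      have hmem : ∀ i, u i ∈ Icc a b := by
        intro i
        have h2 : ((min i (n + 1) : ℕ) : ℝ) ≤ n + 1 := by exact_mod_cast min_le_right _ _
        have := mul_le_mul_of_nonneg_left h2 hh.le
        rw [div_mul_cancel₀ _ (by positivity)] at this
        have h3 : 0 ≤ (b - a) / (n + 1) * (min i (n + 1) : ℕ) := by positivity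
        exact ⟨by simp only [hu]; linarith, by simp only [hu]; linarith⟩
      refine le_trans (le_of_eq (Finset.sum_congr rfl fun i hi => ?_))
        (sum_le_wlen g γ (n + 1) hmono hmem)
      rw [Finset.mem_range] at hi
      have e1 : u i = a + (b - a) / (n + 1) * i := by
        simp only [hu]; rw [min_eq_left hi.le]
      have e2 : u (i + 1) = a + (b - a) / (n + 1) * (i + 1) := by
        simp only [hu]; rw [min_eq_left (Nat.succ_le_of_lt hi)]; push_cast; rfl
      rw [e1, e2]
    refine le_trans ?_ (liminf_le_of_frequently_le'
      (Frequently.of_forall hn) : liminf _ atTop ≤ _)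
    refine le_trans ?_ (lintegral_liminf_le fun n => measurable_grid F a b n)
    refine lintegral_mono_ae ?_
    filter_upwards [hv, ae_restrict_mem measurableSet_Ioo] with t ht hmem
    have hlim := ht.comp (tendsto_grid hab t)
    refine ENNReal.mul_le_of_forall_lt fun m hm w hw => ?_
    refine le_liminf_of_le (by isBoundedDefault) ?_
    have hcont : ContinuousAt γ t := (hγ.continuousOn).continuousAt (Icc_mem_nhds hmem.1 hmem.2)
    have hnear : ∀ᶠ s in 𝓝 t, m < g (γ s) := hcont.eventually (hg (γ t) m hm)
    obtain ⟨δ, hδ, hball⟩ := Metric.eventually_nhds_iff.1 hnear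
    have hgrid := (tendsto_grid hab t).mono_right inf_le_left
    rw [nhds_prod_eq] at hgrid
    filter_upwards [hlim.eventually (lt_mem_nhds hw), (tendsto_fst.comp hgrid).eventually
      (Metric.ball_mem_nhds t hδ), (tendsto_snd.comp hgrid).eventually
      (Metric.ball_mem_nhds t hδ)] with n h1 h2 h3
    simp only [hF, mul_div_assoc]
    refine mul_le_mul' (le_iInf₂ fun s hs => (hball ?_).le) h1.le
    simp only [Function.comp_apply, Real.dist_eq, abs_lt] at h2 h3 ⊢
    exact ⟨by linarith [hs.1, h2.1], by linarith [hs.2, h3.2]⟩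

end Speed

/-! ### The distance defined by a weight -/

/-- In `X`, every Lipschitz curve has a metric speed at almost every time. -/
def HasSpeeds (X : Type*) [EMetricSpace X] : Prop :=
  ∀ (γ : ℝ → X) (a b : ℝ) (K : ℝ≥0), LipschitzOnWith K γ (Icc a b) → ∃ v, HasSpeedOn γ v a b

/-- The Lipschitz curves `[0, 1] → X` from `x` to `y`. -/
def lipCurves (x y : X) : Set (ℝ → X) :=
  {γ | (∃ K : ℝ≥0, LipschitzOnWith K γ (Icc 0 1)) ∧ γ 0 = x ∧ γ 1 = y}

/-- The distance for the weight `g`: the infimum of the weighted lengths of the Lipschitz curves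
from `x` to `y`. -/
noncomputable def wdist (g : X → ℝ≥0∞) (x y : X) : ℝ≥0∞ :=
  ⨅ γ ∈ lipCurves x y, wlen g γ 0 1

/-! ### Additivity, concatenation and subcurves -/

section Additivity

variable {γ : ℝ → X} {a b c : ℝ} {K : ℝ≥0} {g : X → ℝ≥0∞}

lemma wlen_mono_weight {g g' : X → ℝ≥0∞} (h : ∀ x, g x ≤ g' x) (γ : ℝ → X) (a b : ℝ) :
    wlen g γ a b ≤ wlen g' γ a b := by
  refine iSup_mono fun p => Finset.sum_le_sum fun i _ => ?_
  gcongr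
  exact h _

lemma lowerSemicontinuous_const_one : LowerSemicontinuous fun _ : X => (1 : ℝ≥0∞) :=
  continuous_const.lowerSemicontinuous

lemma wlen_add (hX : HasSpeeds X) (hg : LowerSemicontinuous g)
    (hγ : LipschitzOnWith K γ (Icc a c)) (hab : a ≤ b) (hbc : b ≤ c) :
    wlen g γ a b + wlen g γ b c = wlen g γ a c := by
  obtain ⟨v, hv⟩ := hX γ a c K hγ
  rw [wlen_eq_lintegral hg hγ hv (hab.trans hbc),
    wlen_eq_lintegral hg (hγ.mono (Icc_subset_Icc le_rfl hbc)) (hv.mono le_rfl hbc) hab,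
    wlen_eq_lintegral hg (hγ.mono (Icc_subset_Icc hab le_rfl)) (hv.mono hab le_rfl) hbc]
  rw [restrict_Ioo_eq_restrict_Ico, restrict_Ioo_eq_restrict_Ico, restrict_Ioo_eq_restrict_Ico,
    ← lintegral_union measurableSet_Ico
      (Set.disjoint_left.2 fun t h1 h2 => absurd h1.2 (not_lt.2 h2.1)),
    Ico_union_Ico_eq_Ico hab hbc]

lemma wlen_add_const (hX : HasSpeeds X) (hg : LowerSemicontinuous g)
    (hγ : LipschitzOnWith K γ (Icc a b)) (hab : a ≤ b) (ε : ℝ≥0∞) :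
    wlen (fun x => g x + ε) γ a b = wlen g γ a b + ε * wlen (fun _ => 1) γ a b := by
  obtain ⟨v, hv⟩ := hX γ a b K hγ
  rw [wlen_eq_lintegral (hg.add continuous_const.lowerSemicontinuous) hγ hv hab,
    wlen_eq_lintegral hg hγ hv hab, wlen_eq_lintegral lowerSemicontinuous_const_one hγ hv hab,
    ← lintegral_const_mul'' _ (by simpa using hv.aemeasurable),
    ← lintegral_add_right' _ ((by simpa using hv.aemeasurable : AEMeasurable _ _).const_mul ε)]
  simp [add_mul]

lemma wlen_le_of_le (hX : HasSpeeds X) (hγ : LipschitzOnWith K γ (Icc a b)) (hab : a ≤ b)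
    {C : ℝ≥0∞} (hC : ∀ t ∈ Icc a b, g (γ t) ≤ C) :
    wlen g γ a b ≤ C * (K * ENNReal.ofReal (b - a)) := by
  obtain ⟨v, hv⟩ := hX γ a b K hγ
  have h1 : wlen g γ a b ≤ wlen (fun _ => C) γ a b := by
    refine iSup_le fun ⟨n, u, hu, hu'⟩ => ?_
    refine le_trans (Finset.sum_le_sum fun i _ => ?_) (sum_le_wlen _ γ n hu hu')
    gcongr with t ht
    exact hC t ⟨(hu' i).1.trans ht.1, ht.2.trans (hu' (i + 1)).2⟩
  refine h1.trans ?_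
  rw [wlen_eq_lintegral continuous_const.lowerSemicontinuous hγ hv hab]
  calc ∫⁻ t in Ioo a b, C * v t ≤ ∫⁻ t in Ioo a b, C * K := by
        refine lintegral_mono_ae ?_
        filter_upwards [hv.le_lipschitz hγ] with t ht
        gcongr
    _ = _ := by rw [setLIntegral_const, Real.volume_Ioo, mul_assoc]

lemma edist_le_wlen (hX : HasSpeeds X) (hγ : LipschitzOnWith K γ (Icc a b)) (hab : a ≤ b) :
    edist (γ a) (γ b) ≤ wlen (fun _ => 1) γ a b := by
  obtain ⟨v, hv⟩ := hX γ a b K hγ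
  rw [wlen_eq_lintegral lowerSemicontinuous_const_one hγ hv hab]
  simpa using edist_le_lintegral hγ hv hab

lemma const_mul_wlen_le (hX : HasSpeeds X) (hg : LowerSemicontinuous g)
    (hγ : LipschitzOnWith K γ (Icc a b)) (hab : a ≤ b) {C : ℝ≥0∞}
    (hC : ∀ t ∈ Ioo a b, C ≤ g (γ t)) :
    C * wlen (fun _ => 1) γ a b ≤ wlen g γ a b := by
  obtain ⟨v, hv⟩ := hX γ a b K hγ
  rw [wlen_eq_lintegral lowerSemicontinuous_const_one hγ hv hab, wlen_eq_lintegral hg hγ hv hab,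
    ← lintegral_const_mul'' _ (by simpa using hv.aemeasurable)]
  refine setLIntegral_mono' measurableSet_Ioo fun t ht => ?_
  simp only [one_mul]
  gcongr
  exact hC t ht

lemma wdist_le_wlen (g : X → ℝ≥0∞) (hγ : LipschitzOnWith K γ (Icc a b)) (hab : a ≤ b) :
    wdist g (γ a) (γ b) ≤ wlen g γ a b := by
  set τ : ℝ → ℝ := fun t => a + (b - a) * t with hτ
  have hmaps : MapsTo τ (Icc 0 1) (Icc a b) := by
    intro t ht
    have : 0 ≤ b - a := sub_nonneg.2 hab
    constructor <;> simp only [hτ] <;> nlinarith [ht.1, ht.2]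
  have hm : Monotone τ := by
    intro s t hst
    have : 0 ≤ b - a := sub_nonneg.2 hab
    simp only [hτ]; nlinarith
  have hlip : LipschitzWith (Real.nnabs (b - a)) τ := by
    refine LipschitzWith.of_dist_le_mul fun s t => ?_
    simp only [hτ, Real.dist_eq, Real.coe_nnabs]
    rw [← abs_mul]; apply le_of_eq; congr 1; ring
  refine le_trans (iInf₂_le (γ ∘ τ) ⟨⟨_, hγ.comp hlip.lipschitzOnWith hmaps⟩, ?_, ?_⟩)
    (wlen_comp_le g γ (by fun_prop) (hm.monotoneOn _) hmaps)
  · simp [hτ]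
  · simp [hτ]

lemma lipschitzOnWith_Icc_union (h1 : LipschitzOnWith K γ (Icc a b))
    (h2 : LipschitzOnWith K γ (Icc b c)) : LipschitzOnWith K γ (Icc a c) := by
  have key : ∀ s ∈ Icc a c, ∀ t ∈ Icc a c, s ≤ t → edist (γ s) (γ t) ≤ K * edist s t := by
    intro s hs t ht hst
    rcases le_total t b with htb | htb
    · exact h1 ⟨hs.1, hst.trans htb⟩ ⟨ht.1, htb⟩
    rcases le_total s b with hsb | hsb
    · refine (edist_triangle _ (γ b) _).trans ((add_le_add
        (h1 (y := b) ⟨hs.1, hsb⟩ ⟨hs.1.trans hsb, le_rfl⟩)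
        (h2 (x := b) ⟨le_rfl, htb.trans ht.2⟩ ⟨htb, ht.2⟩)).trans ?_)
      rw [← mul_add]
      gcongr
      rw [edist_dist, edist_dist, edist_dist, ← ENNReal.ofReal_add dist_nonneg dist_nonneg]
      apply ENNReal.ofReal_le_ofReal
      rw [Real.dist_eq, Real.dist_eq, Real.dist_eq, abs_of_nonpos (by linarith),
        abs_of_nonpos (by linarith), abs_of_nonpos (by linarith)]
      linarith
    · exact h2 ⟨hsb, hs.2⟩ ⟨htb, ht.2⟩
  intro s hs t ht
  rcases le_total s t with h | h
  · exact key s hs t ht h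
  · rw [edist_comm, edist_comm s]; exact key t ht s hs h

lemma lipschitzOnWith_congr {γ γ' : ℝ → X} {s : Set ℝ} (h : EqOn γ γ' s) :
    LipschitzOnWith K γ s ↔ LipschitzOnWith K γ' s :=
  forall₂_congr fun _ hx => forall₂_congr fun _ hy => by rw [h hx, h hy]

lemma wdist_triangle (hX : HasSpeeds X) (hg : LowerSemicontinuous g) (x y z : X) :
    wdist g x z ≤ wdist g x y + wdist g y z := by
  refine le_of_forall_gt fun c hc => ?_
  obtain ⟨p, hp, q, hq, hpq⟩ := ENNReal.exists_add_lt_of_add_lt hc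
  simp only [wdist, iInf_lt_iff] at hp hq
  obtain ⟨γ₁, ⟨⟨K₁, hK₁⟩, rfl, rfl⟩, h1⟩ := hp
  obtain ⟨γ₂, ⟨⟨K₂, hK₂⟩, h0, rfl⟩, h2⟩ := hq
  set γ : ℝ → X := fun t => if t ≤ 1 then γ₁ t else γ₂ (t - 1) with hγ
  have e1 : EqOn γ γ₁ (Icc 0 1) := fun t ht => if_pos ht.2
  have e2 : EqOn γ (γ₂ ∘ fun t => t - 1) (Icc 1 2) := by
    intro t ht
    rcases ht.1.eq_or_lt with rfl | hlt
    · simp [hγ, h0]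
    · exact if_neg (not_le.2 hlt)
  have hmaps : MapsTo (fun t : ℝ => t - 1) (Icc 1 2) (Icc 0 1) := fun t ht =>
    ⟨by linarith [ht.1], by linarith [ht.2]⟩
  have l1 : LipschitzOnWith (max K₁ K₂) γ (Icc 0 1) :=
    (lipschitzOnWith_congr e1).2 (LipschitzOnWith.weaken hK₁ (le_max_left _ _))
  have l2 : LipschitzOnWith (max K₁ K₂) γ (Icc 1 2) := by
    refine (lipschitzOnWith_congr e2).2 ?_
    have hτ : LipschitzOnWith 1 (fun t : ℝ => t - 1) (Icc 1 2) :=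
      (LipschitzWith.of_dist_le_mul fun s t => by simp).lipschitzOnWith
    have := LipschitzOnWith.comp hK₂ hτ hmaps
    rw [mul_one] at this
    exact LipschitzOnWith.weaken this (le_max_right _ _)
  have l := lipschitzOnWith_Icc_union l1 l2
  have w := wdist_le_wlen g l (by norm_num)
  rw [← wlen_add hX hg l zero_le_one one_le_two, wlen_congr g e1, wlen_congr g e2] at w
  have w2 := wlen_comp_le g γ₂ (a := 1) (b := 2) (τ := fun t => t - 1) (by fun_prop)
    (fun s _ t _ hst => by simpa using hst) hmaps
  have e3 : γ 2 = γ₂ 1 := by rw [e2 (by norm_num : (2 : ℝ) ∈ Icc 1 2)]; norm_num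
  rw [e3, e1 (by norm_num : (0 : ℝ) ∈ Icc 0 1)] at w
  exact (w.trans (add_le_add h1.le (w2.trans h2.le))).trans_lt hpq

/-- Portions of an almost minimal curve are almost minimal. -/
lemma wlen_le_wdist_add (hX : HasSpeeds X) (hg : LowerSemicontinuous g) {γ : ℝ → X}
    (hγ : LipschitzOnWith K γ (Icc 0 1)) {η : ℝ≥0∞}
    (hmin : wlen g γ 0 1 ≤ wdist g (γ 0) (γ 1) + η) (hfin : wlen g γ 0 1 ≠ ⊤) {s t : ℝ}
    (hs : 0 ≤ s) (hst : s ≤ t) (ht : t ≤ 1) :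
    wlen g γ s t ≤ wdist g (γ s) (γ t) + η := by
  have a1 := wlen_add hX hg hγ hs (hst.trans ht)
  have a2 := wlen_add hX hg (hγ.mono (Icc_subset_Icc hs le_rfl)) hst ht
  have d1 := wdist_le_wlen g (hγ.mono (Icc_subset_Icc le_rfl (hst.trans ht))) hs
  have d2 := wdist_le_wlen g (hγ.mono (Icc_subset_Icc (hs.trans hst) le_rfl)) ht
  have f1 : wlen g γ 0 s ≠ ⊤ := ne_top_of_le_ne_top hfin (a1 ▸ le_self_add)
  have f2 : wlen g γ t 1 ≠ ⊤ := by
    refine ne_top_of_le_ne_top hfin ?_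
    rw [← a1, ← a2, ← add_assoc]; exact le_add_self
  have tri := (wdist_triangle hX hg (γ 0) (γ s) (γ 1)).trans
    (add_le_add le_rfl (wdist_triangle hX hg (γ s) (γ t) (γ 1)))
  have h := hmin.trans (add_le_add (tri.trans (add_le_add d1 (add_le_add le_rfl d2))) le_rfl)
  rw [← a1, ← a2, add_assoc, ENNReal.add_le_add_iff_left f1, add_right_comm,
    ENNReal.add_le_add_iff_right f2] at h
  exact h

end Additivity

/-! ### Reparametrization -/

/-- A Lipschitz curve of length at most `Λ` can be reparametrized into a `(Λ + 1)`-Lipschitz one,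
without increasing the weighted lengths. -/
lemma exists_reparam (hX : HasSpeeds X) {γ : ℝ → X} {K Λ : ℝ≥0}
    (hγ : LipschitzOnWith K γ (Icc 0 1)) (hΛ : wlen (fun _ => 1) γ 0 1 ≤ Λ) :
    ∃ γ' : ℝ → X, LipschitzOnWith (Λ + 1) γ' (Icc 0 1) ∧ γ' 0 = γ 0 ∧ γ' 1 = γ 1 ∧
      ∀ g : X → ℝ≥0∞, wlen g γ' 0 1 ≤ wlen g γ 0 1 := by
  set ℓ : ℝ → ℝ → ℝ := fun s t => (wlen (fun _ => 1) γ s t).toReal with hℓ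
  have hsub : ∀ {s t}, s ∈ Icc (0 : ℝ) 1 → t ∈ Icc (0 : ℝ) 1 → Icc s t ⊆ Icc 0 1 :=
    fun hs ht => Icc_subset_Icc hs.1 ht.2
  have hbound : ∀ {s t}, s ∈ Icc (0 : ℝ) 1 → t ∈ Icc (0 : ℝ) 1 → s ≤ t →
      wlen (fun _ => 1) γ s t ≤ K * ENNReal.ofReal (t - s) := fun hs ht hst => by
    simpa using wlen_le_of_le hX (hγ.mono (hsub hs ht)) hst (g := fun _ => 1) (C := 1)
      (fun _ _ => le_rfl)
  have hfin : ∀ {s t}, s ∈ Icc (0 : ℝ) 1 → t ∈ Icc (0 : ℝ) 1 → s ≤ t →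
      wlen (fun _ => 1) γ s t ≠ ⊤ := fun hs ht hst =>
    ne_top_of_le_ne_top (by finiteness) (hbound hs ht hst)
  have h0 : (0 : ℝ) ∈ Icc (0 : ℝ) 1 := by simp
  have h1 : (1 : ℝ) ∈ Icc (0 : ℝ) 1 := by simp
  have hadd : ∀ {s t}, s ∈ Icc (0 : ℝ) 1 → t ∈ Icc (0 : ℝ) 1 → s ≤ t →
      ℓ 0 t = ℓ 0 s + ℓ s t := fun {s t} hs ht hst => by
    simp only [hℓ]
    rw [← wlen_add hX lowerSemicontinuous_const_one (hγ.mono (hsub h0 ht)) hs.1 hst,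
      ENNReal.toReal_add (hfin h0 hs hs.1) (hfin hs ht hst)]
  have hℓ0 : ∀ s t, 0 ≤ ℓ s t := fun s t => ENNReal.toReal_nonneg
  -- adding `t` to the arc length makes it strictly increasing, even where `γ` is constant
  set σ : ℝ → ℝ := fun t => (ℓ 0 t + t) / (ℓ 0 1 + 1) with hσ
  have hpos : 0 < ℓ 0 1 + 1 := by linarith [hℓ0 0 1]
  have hσsub : ∀ {s t}, s ∈ Icc (0 : ℝ) 1 → t ∈ Icc (0 : ℝ) 1 → s ≤ t →
      (ℓ 0 1 + 1) * (σ t - σ s) = ℓ s t + (t - s) := fun {s t} hs ht hst => by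
    simp only [hσ]
    rw [hadd hs ht hst]
    field_simp
    ring
  have hℓ00 : ℓ 0 0 = 0 := by linarith [hadd h0 h0 le_rfl]
  have hσ0 : σ 0 = 0 := by simp [hσ, hℓ00]
  have hσ1 : σ 1 = 1 := by simp only [hσ]; exact div_self hpos.ne'
  have hσc : ContinuousOn σ (Icc 0 1) := by
    have : LipschitzOnWith K (fun t => ℓ 0 t) (Icc 0 1) := by
      refine LipschitzOnWith.of_le_add_mul K fun t ht s hs => ?_
      rcases le_total s t with hst | hst
      · rw [hadd hs ht hst, Real.dist_eq, abs_of_nonneg (by linarith)]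
        have := ENNReal.toReal_mono (by finiteness) (hbound hs ht hst)
        rw [ENNReal.toReal_mul, ENNReal.toReal_ofReal (by linarith)] at this
        simpa using this
      · have : 0 ≤ (K : ℝ) * dist t s := by positivity
        linarith [hadd ht hs hst, hℓ0 t s]
    exact (this.continuousOn.add continuousOn_id).div_const _
  have hsurj : ∀ u ∈ Icc (0 : ℝ) 1, ∃ t ∈ Icc (0 : ℝ) 1, σ t = u := by
    intro u hu
    have := intermediate_value_Icc zero_le_one hσc
    rw [hσ0, hσ1] at this
    exact this hu
  choose! τ hτ hστ using hsurj
  have hτmono : MonotoneOn τ (Icc 0 1) := by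
    intro u hu w hw huw
    by_contra! hlt
    have := hσsub (hτ w hw) (hτ u hu) hlt.le
    rw [hστ u hu, hστ w hw] at this
    nlinarith [hℓ0 (τ w) (τ u)]
  have hτlip : LipschitzOnWith (Real.toNNReal (ℓ 0 1 + 1)) τ (Icc 0 1) := by
    refine LipschitzOnWith.of_le_add_mul _ fun u hu w hw => ?_
    rw [Real.coe_toNNReal _ hpos.le, Real.dist_eq]
    rcases le_total u w with h | h
    · have := hτmono hu hw h
      have : 0 ≤ (ℓ 0 1 + 1) * |u - w| := by positivity
      linarith
    · have := hσsub (hτ w hw) (hτ u hu) (hτmono hw hu h)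
      rw [hστ u hu, hστ w hw] at this
      rw [abs_of_nonneg (by linarith)]
      linarith [hℓ0 (τ w) (τ u)]
  have hend : ∀ u ∈ Icc (0 : ℝ) 1, ∀ t ∈ Icc (0 : ℝ) 1, σ t = u → τ u = t := by
    intro u hu t ht htu
    rcases le_total t (τ u) with h | h
    · have := hσsub ht (hτ u hu) h
      rw [hστ u hu, htu] at this
      linarith [hℓ0 t (τ u)]
    · have := hσsub (hτ u hu) ht h
      rw [hστ u hu, htu] at this
      linarith [hℓ0 (τ u) t]
  refine ⟨γ ∘ τ, ?_, ?_, ?_, fun g =>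
    wlen_comp_le g γ hτlip.continuousOn hτmono fun u hu => hτ u hu⟩
  · have key : ∀ u ∈ Icc (0 : ℝ) 1, ∀ w ∈ Icc (0 : ℝ) 1, u ≤ w →
        edist (γ (τ u)) (γ (τ w)) ≤ (Λ + 1 : ℝ≥0) * edist u w := by
      intro u hu w hw huw
      have hle := hτmono hu hw huw
      refine (edist_le_wlen hX (hγ.mono (hsub (hτ u hu) (hτ w hw))) hle).trans ?_
      rw [← ENNReal.ofReal_toReal (hfin (hτ u hu) (hτ w hw) hle), edist_dist, Real.dist_eq,
        abs_of_nonpos (by linarith), ← ENNReal.ofReal_coe_nnreal,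
        ← ENNReal.ofReal_mul (by positivity)]
      apply ENNReal.ofReal_le_ofReal
      have h2 := hσsub (hτ u hu) (hτ w hw) hle
      rw [hστ u hu, hστ w hw] at h2
      have h3 : ℓ 0 1 ≤ Λ := by
        have := ENNReal.toReal_mono (by finiteness) hΛ
        simpa using this
      have h4 : ℓ (τ u) (τ w) ≤ (ℓ 0 1 + 1) * (w - u) := by linarith
      refine h4.trans ?_
      push_cast
      nlinarith
    intro u hu w hw
    rcases le_total u w with h | h
    · exact key u hu w hw h
    · rw [edist_comm, edist_comm u]; exact key w hw u hu h
  · simp only [Function.comp_apply]; rw [hend 0 h0 0 h0 hσ0]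
  · simp only [Function.comp_apply]; rw [hend 1 h1 1 h1 hσ1]

/-! ### Existence of minimizers among curves with a given Lipschitz constant -/

/-- The infimum over a compact time interval of a lower semicontinuous weight along a curve depends
on the curve in a lower semicontinuous way. -/
lemma lowerSemicontinuous_iInf_comp {g : X → ℝ≥0∞} (hg : LowerSemicontinuous g) (s t : ℝ) :
    LowerSemicontinuous fun f : C(Icc (0 : ℝ) 1, X) =>
      ⨅ r ∈ Icc s t, g (IccExtend zero_le_one f r) := by
  intro f m hm
  obtain ⟨m', hm', hm''⟩ := exists_between hm
  have hK : IsCompact (projIcc (0 : ℝ) 1 zero_le_one '' Icc s t) :=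
    isCompact_Icc.image continuous_projIcc
  have hmaps : MapsTo f (projIcc (0 : ℝ) 1 zero_le_one '' Icc s t) {x | m' < g x} := by
    rintro _ ⟨r, hr, rfl⟩
    exact hm''.trans_le (iInf₂_le r hr)
  filter_upwards [ContinuousMap.eventually_mapsTo hK (hg.isOpen_preimage m') hmaps] with f' hf'
  exact hm'.trans_le (le_iInf₂ fun r hr => (hf' (mem_image_of_mem _ hr)).le)

lemma lowerSemicontinuous_mul {Y : Type*} [TopologicalSpace Y] {p q : Y → ℝ≥0∞}
    (hp : LowerSemicontinuous p) (hq : LowerSemicontinuous q) :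
    LowerSemicontinuous fun y => p y * q y := by
  intro y c hc
  by_contra hcon
  refine hc.not_ge (ENNReal.mul_le_of_forall_lt fun m hm w hw => ?_)
  by_contra! hlt
  apply hcon
  filter_upwards [hp y m hm, hq y w hw] with z h1 h2
  exact hlt.trans_le (mul_le_mul' h1.le h2.le)

lemma lowerSemicontinuous_wlen {g : X → ℝ≥0∞} (hg : LowerSemicontinuous g) :
    LowerSemicontinuous fun f : C(Icc (0 : ℝ) 1, X) => wlen g (IccExtend zero_le_one f) 0 1 := by
  refine lowerSemicontinuous_iSup fun p => lowerSemicontinuous_sum fun i _ =>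
    lowerSemicontinuous_mul (lowerSemicontinuous_iInf_comp hg _ _)
      (Continuous.lowerSemicontinuous ?_)
  simp only [IccExtend, Function.comp_apply]
  exact (ContinuousEvalConst.continuous_eval_const _).edist
    (ContinuousEvalConst.continuous_eval_const _)

lemma isCompact_lipschitz_curves [CompactSpace X] (K : ℝ≥0) (x y : X) :
    IsCompact {f : C(Icc (0 : ℝ) 1, X) | LipschitzWith K f ∧ f 0 = x ∧ f 1 = y} := by
  refine ArzelaAscoli.isCompact_of_equicontinuous _ ?_ ?_
  · refine IsClosed.isCompact ?_
    have : ContinuousMap.toFun '' {f : C(Icc (0 : ℝ) 1, X) | LipschitzWith K f ∧ f 0 = x ∧ f 1 = y}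
        = {f : Icc (0 : ℝ) 1 → X | LipschitzWith K f ∧ f 0 = x ∧ f 1 = y} := by
      ext f
      constructor
      · rintro ⟨f, hf, rfl⟩; exact hf
      · intro hf; exact ⟨⟨f, hf.1.continuous⟩, hf, rfl⟩
    rw [this]
    simp only [LipschitzWith, ofPred_and, ofPred_forall]
    refine IsClosed.inter (isClosed_iInter fun s => isClosed_iInter fun t => ?_)
      (IsClosed.inter ?_ ?_)
    · exact isClosed_le ((continuous_apply s).edist (continuous_apply t)) continuous_const
    · exact isClosed_eq (continuous_apply _) continuous_const
    · exact isClosed_eq (continuous_apply _) continuous_const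
  · exact (LipschitzWith.uniformEquicontinuous _ K fun f => f.2.1).equicontinuous

/-- If the weighted distance is approached by curves with a common Lipschitz constant, then it is
attained by such a curve. -/
theorem exists_wlen_le_wdist [CompactSpace X] {g : X → ℝ≥0∞} (hg : LowerSemicontinuous g) {K : ℝ≥0}
    {x y : X}
    (h : ∀ c, wdist g x y < c → ∃ γ : ℝ → X, LipschitzOnWith K γ (Icc 0 1) ∧ γ 0 = x ∧ γ 1 = y ∧
      wlen g γ 0 1 ≤ c) (hfin : wdist g x y ≠ ⊤) :
    ∃ γ : ℝ → X, LipschitzOnWith K γ (Icc 0 1) ∧ γ 0 = x ∧ γ 1 = y ∧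
      wlen g γ 0 1 ≤ wdist g x y := by
  set S := {f : C(Icc (0 : ℝ) 1, X) | LipschitzWith K f ∧ f 0 = x ∧ f 1 = y} with hS
  have hmem : ∀ γ : ℝ → X, LipschitzOnWith K γ (Icc 0 1) → γ 0 = x → γ 1 = y →
      ∃ f ∈ S, wlen g (IccExtend zero_le_one f) 0 1 = wlen g γ 0 1 := by
    intro γ hγ h0 h1
    have hlip : LipschitzWith K ((Icc (0 : ℝ) 1).domRestrict γ) := hγ.to_restrict
    refine ⟨⟨_, hlip.continuous⟩, ⟨hlip, h0, h1⟩, wlen_congr g fun t ht => ?_⟩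
    exact IccExtend_of_mem _ _ ht
  obtain ⟨γ₀, hγ₀, h00, h01, -⟩ := h ⊤ hfin.lt_top
  obtain ⟨f₀, hf₀, -⟩ := hmem γ₀ hγ₀ h00 h01
  obtain ⟨f, hf, hmin⟩ := ((lowerSemicontinuous_wlen hg).lowerSemicontinuousOn S).exists_isMinOn
    ⟨f₀, hf₀⟩ (isCompact_lipschitz_curves K x y)
  refine ⟨IccExtend zero_le_one f, ?_, ?_, ?_, ?_⟩
  · have := hf.1.comp (LipschitzWith.projIcc (zero_le_one (α := ℝ)))
    rw [mul_one] at this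
    exact this.lipschitzOnWith
  · rw [IccExtend_left]; exact hf.2.1
  · rw [IccExtend_right]; exact hf.2.2
  · refine le_of_forall_gt fun c hc => ?_
    obtain ⟨c', hc', hc''⟩ := exists_between hc
    obtain ⟨γ, hγ, h0, h1, hle⟩ := h c' hc'
    obtain ⟨f', hf', heq⟩ := hmem γ hγ h0 h1
    exact (isMinOn_iff.1 hmin f' hf').trans_lt ((heq.trans_le hle).trans_lt hc'')

/-! ### Tame weights -/

/-- Local structure of the weight `g` at `q`: off a closed set `S` it is bounded below, and on `S`
it is bounded below by the distance to `q`, while two points of `S` at distance at most `r` from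
`q` are joined by a curve of length `O(r)` on which `g = O(r)`. The set `S` is the stratum of `q`
when `q` is a nondegenerate zero of `g`, and it is empty when `g` does not vanish at `q`. -/
def TameAt (g : X → ℝ≥0∞) (q : X) : Prop :=
  ∃ (S : Set X) (c C r₀ : ℝ≥0), 0 < c ∧ 0 < r₀ ∧ IsClosed S ∧
    (∀ x, edist x q < r₀ → x ∉ S → c ≤ g x) ∧
    (∀ x ∈ S, edist x q < r₀ → c * edist x q ≤ g x) ∧
    ∀ r ≤ r₀, ∀ a ∈ S, ∀ b ∈ S, edist a q ≤ r → edist b q ≤ r →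
      ∃ β : ℝ → X, LipschitzOnWith (C * r) β (Icc 0 1) ∧ β 0 = a ∧ β 1 = b ∧
        ∀ t ∈ Icc (0 : ℝ) 1, g (β t) ≤ (C * r : ℝ≥0)

/-! ### A bound on the length of almost minimal curves -/

section LengthBound

variable {g : X → ℝ≥0∞} {γ : ℝ → X} {v : ℝ → ℝ≥0∞} {K : ℝ≥0}

lemma mul_setLIntegral_speed_le (hg : LowerSemicontinuous g)
    (hγ : LipschitzOnWith K γ (Icc 0 1)) (hv : HasSpeedOn γ v 0 1) {T : Set ℝ}
    (hT : MeasurableSet T) {s t : ℝ} (hs : 0 ≤ s) (hst : s ≤ t) (ht : t ≤ 1) (hsub : T ⊆ Icc s t)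
    {w : ℝ≥0∞} (hw : ∀ τ ∈ T, w ≤ g (γ τ)) :
    w * ∫⁻ τ in T, v τ ≤ wlen g γ s t := by
  have hm : AEMeasurable v (volume.restrict T) := by
    have : AEMeasurable v (volume.restrict (Icc 0 1)) := by
      rw [← restrict_Ioo_eq_restrict_Icc]; exact hv.aemeasurable
    exact this.mono_set (hsub.trans (Icc_subset_Icc hs ht))
  rw [wlen_eq_lintegral hg (hγ.mono (Icc_subset_Icc hs ht)) (hv.mono hs ht) hst,
    restrict_Ioo_eq_restrict_Icc, ← lintegral_const_mul'' _ hm]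
  refine le_trans (setLIntegral_mono' hT fun τ hτ => ?_) (lintegral_mono_set hsub)
  gcongr
  exact hw τ hτ

/-- If `w ≤ g` on `Z` and any portion of the curve with end points in `Z` costs at most `P`, the
part of the curve in `Z` has length at most `P / w`: compare with the portion between the first and
the last passages in `Z`. -/
lemma setLIntegral_speed_le_div (hg : LowerSemicontinuous g)
    (hγ : LipschitzOnWith K γ (Icc 0 1)) (hv : HasSpeedOn γ v 0 1) {Z : Set X} (hZ : IsClosed Z)
    {w P : ℝ≥0} (hw0 : 0 < w) (hw : ∀ x ∈ Z, w ≤ g x)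
    (hP : ∀ s t, 0 ≤ s → s ≤ t → t ≤ 1 → γ s ∈ Z → γ t ∈ Z → wlen g γ s t ≤ P) :
    ∫⁻ τ in {τ | τ ∈ Icc 0 1 ∧ γ τ ∈ Z}, v τ ≤ (P / w : ℝ≥0) := by
  set T := {τ | τ ∈ Icc (0 : ℝ) 1 ∧ γ τ ∈ Z} with hTdef
  have hcl : IsClosed T := hγ.continuousOn.preimage_isClosed_of_isClosed isClosed_Icc hZ
  have hcomp : IsCompact T := isCompact_Icc.of_isClosed_subset hcl fun τ hτ => hτ.1
  rcases T.eq_empty_or_nonempty with he | hne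
  · simp [he]
  obtain ⟨s, hs, hsmin⟩ := hcomp.exists_isLeast hne
  obtain ⟨t, ht, htmax⟩ := hcomp.exists_isGreatest hne
  have hst : s ≤ t := hsmin ht
  have := (mul_setLIntegral_speed_le hg hγ hv hcl.measurableSet hs.1.1 hst ht.1.2
    (fun τ hτ => ⟨hsmin hτ, htmax hτ⟩) (fun τ hτ => hw _ hτ.2)).trans
    (hP s t hs.1.1 hst ht.1.2 hs.2 ht.2)
  rw [ENNReal.coe_div hw0.ne', ENNReal.le_div_iff_mul_le (by simp [hw0.ne']) (by simp), mul_comm]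
  exact this

/-- The portion of an almost minimal curve that lies in the set `s` has a length bounded
independently of the curve and of the regularization `ε` of the weight. -/
def LengthBoundedIn (g : X → ℝ≥0∞) (A : ℝ≥0) (s : Set X) : Prop :=
  ∃ B : ℝ≥0, ∀ (γ : ℝ → X) (K : ℝ≥0) (v : ℝ → ℝ≥0∞) (ε : ℝ≥0), 0 < ε → ε ≤ 1 →
    LipschitzOnWith K γ (Icc 0 1) → HasSpeedOn γ v 0 1 →
    wlen (fun x => g x + ε) γ 0 1 ≤ wdist (fun x => g x + ε) (γ 0) (γ 1) + (ε ^ 2 : ℝ≥0) →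
    wlen (fun x => g x + ε) γ 0 1 ≤ A →
    ∫⁻ t in {t | t ∈ Icc 0 1 ∧ γ t ∈ s}, v t ≤ B

/-- Near a point where the weight is tame, the length of almost minimal curves is bounded. The
curve is cut according to dyadic distances `r` to `q`. Between its first and last passages in
`S ∩ closedBall q r` it costs at most `O(r²)`, the cost of a short cut, whereas the weight is at
least of order `r` in the annulus of radius `r`; so its length in this annulus is `O(r)`, which is
summable. The regularization `ε` is responsible for the ball of radius `ε`. -/
lemma TameAt.exists_lengthBoundedIn (hX : HasSpeeds X) (hg : LowerSemicontinuous g) {q : X}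
    (hq : TameAt g q) (A : ℝ≥0) : ∃ U ∈ 𝓝 q, LengthBoundedIn g A U := by
  obtain ⟨S, c, C, r₀, hc, hr₀, hS, hoff, hon, hcut⟩ := hq
  set r₁ : ℝ≥0 := r₀ / 2 with hr₁
  have hr₁pos : 0 < r₁ := by positivity
  have hr₁lt : r₁ < r₀ := NNReal.half_lt_self hr₀.ne'
  -- a short cut at scale `ρ ≥ ε` costs at most `(C ρ + ε) C ρ`, and almost minimality loses `ε ^ 2`
  set D : ℝ≥0 := (C + 1) * C + 1 with hD
  refine ⟨Metric.closedEBall q r₁, Metric.closedEBall_mem_nhds q (by simpa using hr₁pos),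
    A / c + (D + 2 * (2 * D / c * r₁)), ?_⟩
  intro γ K v ε hε hε1 hγ hv hmin hA
  have hgε : LowerSemicontinuous fun x => g x + ε := hg.add continuous_const.lowerSemicontinuous
  -- the cost between two passages in `S ∩ closedBall q r`
  have hcost : ∀ r ≤ r₀, ∀ ρ, r ≤ ρ → ε ≤ ρ → ∀ s t, 0 ≤ s → s ≤ t → t ≤ 1 →
      γ s ∈ S → edist (γ s) q ≤ r → γ t ∈ S → edist (γ t) q ≤ r →
      wlen (fun x => g x + ε) γ s t ≤ (D * ρ ^ 2 : ℝ≥0) := by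
    intro r hr ρ hrρ hερ s t hs hst ht hsS hsr htS htr
    obtain ⟨β, hβ, hβ0, hβ1, hβg⟩ := hcut r hr _ hsS _ htS hsr htr
    have h1 : wdist (fun x => g x + ε) (γ s) (γ t) ≤ ((C * r + ε) * (C * r) : ℝ≥0) := by
      have h2 := wlen_le_of_le hX (g := fun x => g x + ε) hβ zero_le_one
        (C := ((C * r + ε : ℝ≥0) : ℝ≥0∞)) (fun τ hτ => by
          push_cast; gcongr; simpa using hβg τ hτ)
      rw [← hβ0, ← hβ1]
      refine (wdist_le_wlen _ hβ zero_le_one).trans (h2.trans (le_of_eq ?_))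
      simp
    refine (wlen_le_wdist_add hX hgε hγ hmin
      (ne_top_of_le_ne_top ENNReal.coe_ne_top hA) hs hst ht).trans ?_
    refine (add_le_add h1 le_rfl).trans ?_
    rw [← ENNReal.coe_add, ENNReal.coe_le_coe]
    calc (C * r + ε) * (C * r) + ε ^ 2 ≤ (C * ρ + ρ) * (C * ρ) + ρ ^ 2 := by gcongr
      _ = D * ρ ^ 2 := by rw [hD]; ring
  set rk : ℕ → ℝ≥0 := fun k => r₁ * (1 / 2) ^ k with hrk
  have hrk_le : ∀ k, rk k ≤ r₁ := fun k =>
    mul_le_of_le_one_right (zero_le) (pow_le_one₀ (zero_le) (by norm_num))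
  have hcont_edist : Continuous fun x : X => edist x q := by fun_prop
  set Z : ℕ → Set X := fun k => S ∩ {x | rk (k + 1) ≤ edist x q ∧ edist x q ≤ rk k ∧
    (ε : ℝ≥0∞) ≤ rk k} with hZ
  have hZclosed : ∀ k, IsClosed (Z k) := fun k =>
    hS.inter ((isClosed_le continuous_const hcont_edist).inter
      ((isClosed_le hcont_edist continuous_const).inter isClosed_const))
  have hann : ∀ k, ∫⁻ τ in {τ | τ ∈ Icc 0 1 ∧ γ τ ∈ Z k}, v τ ≤
      ((2 * D / c * r₁) * (1 / 2) ^ k : ℝ≥0) := by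
    intro k
    have hkpos : 0 < rk k := by positivity
    refine (setLIntegral_speed_le_div hgε hγ hv (hZclosed k) (w := c * rk (k + 1))
      (P := D * rk k ^ 2) (by positivity) (fun x hx => ?_)
      (fun s t hs hst ht h1 h2 => hcost (rk k) ((hrk_le k).trans hr₁lt.le)
        (rk k) le_rfl (by simpa using h1.2.2.2) s t hs hst ht h1.1 h1.2.2.1 h2.1 h2.2.2.1)).trans ?_
    · push_cast
      refine le_trans ?_ ((hon x hx.1 (hx.2.2.1.trans_lt ?_)).trans le_self_add)
      · gcongr; exact hx.2.1
      · exact_mod_cast (hrk_le k).trans_lt hr₁lt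
    · rw [ENNReal.coe_le_coe]
      apply le_of_eq
      simp only [hrk, pow_succ]
      field_simp
  set Z0 : Set X := S ∩ {x | edist x q ≤ (min ε r₁ : ℝ≥0)} with hZ0
  have hball : ∫⁻ τ in {τ | τ ∈ Icc 0 1 ∧ γ τ ∈ Z0}, v τ ≤ (D : ℝ≥0) := by
    have hcl : IsClosed Z0 := hS.inter (isClosed_le hcont_edist continuous_const)
    refine (setLIntegral_speed_le_div hgε hγ hv hcl (w := ε) (P := D * ε ^ 2) hε
      (fun x hx => le_add_self) (fun s t hs hst ht h1 h2 => hcost (min ε r₁)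
      ((min_le_right _ _).trans hr₁lt.le) ε (min_le_left _ _) le_rfl s t hs hst ht
      h1.1 h1.2 h2.1 h2.2)).trans ?_
    rw [ENNReal.coe_le_coe, pow_two, ← mul_assoc, mul_div_cancel_right₀ _ hε.ne']
    exact mul_le_of_le_one_right (zero_le) hε1
  have hout : ∫⁻ τ in {τ | τ ∈ Icc 0 1 ∧ γ τ ∈ (Sᶜ ∩ Metric.eball q r₀)}, v τ ≤ (A / c : ℝ≥0) := by
    set T := {τ | τ ∈ Icc (0 : ℝ) 1 ∧ γ τ ∈ (Sᶜ ∩ Metric.eball q r₀)} with hT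
    have hmeas : MeasurableSet T := by
      have hcl : IsClosed {τ | τ ∈ Icc (0 : ℝ) 1 ∧ γ τ ∈ (Sᶜ ∩ Metric.eball q r₀)ᶜ} :=
        hγ.continuousOn.preimage_isClosed_of_isClosed isClosed_Icc
          (hS.isOpen_compl.inter Metric.isOpen_eball).isClosed_compl
      have : T = Icc 0 1 \ {τ | τ ∈ Icc (0 : ℝ) 1 ∧ γ τ ∈ (Sᶜ ∩ Metric.eball q r₀)ᶜ} := by
        ext τ
        simp only [hT, Set.mem_sdiff, mem_ofPred_eq, mem_compl_iff]
        tauto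
      rw [this]
      exact measurableSet_Icc.diff hcl.measurableSet
    have := (mul_setLIntegral_speed_le hgε hγ hv hmeas le_rfl zero_le_one le_rfl
      (fun τ hτ => hτ.1) (fun τ hτ => (hoff _ hτ.2.2 hτ.2.1).trans le_self_add)).trans hA
    rw [ENNReal.coe_div hc.ne', ENNReal.le_div_iff_mul_le (by simp [hc.ne']) (by simp), mul_comm]
    exact this
  have hcover : {τ | τ ∈ Icc (0 : ℝ) 1 ∧ γ τ ∈ Metric.closedEBall q r₁} ⊆
      {τ | τ ∈ Icc (0 : ℝ) 1 ∧ γ τ ∈ (Sᶜ ∩ Metric.eball q r₀)} ∪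
        ({τ | τ ∈ Icc (0 : ℝ) 1 ∧ γ τ ∈ Z0} ∪ ⋃ k, {τ | τ ∈ Icc (0 : ℝ) 1 ∧ γ τ ∈ Z k}) := by
    rintro τ ⟨hτ, hτq⟩
    rw [Metric.mem_closedEBall] at hτq
    by_cases hτS : γ τ ∈ S
    · right
      obtain ⟨ρ, hρ⟩ : ∃ ρ : ℝ≥0, (ρ : ℝ≥0∞) = edist (γ τ) q :=
        ⟨_, ENNReal.coe_toNNReal (ne_top_of_le_ne_top ENNReal.coe_ne_top hτq)⟩
      rw [← hρ, ENNReal.coe_le_coe] at hτq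
      by_cases hsmall : ρ ≤ min ε r₁
      · exact Or.inl ⟨hτ, hτS, by simpa [← hρ] using hsmall⟩
      · right
        have hερ : ε < ρ := by
          by_contra! hle; exact hsmall (le_min hle hτq)
        have hρpos : 0 < ρ := hε.trans hερ
        obtain ⟨k, hk1, hk2⟩ := exists_nat_pow_near_of_lt_one (x := ρ / r₁) (y := (1 / 2 : ℝ≥0))
          (by positivity) (div_le_one_of_le₀ hτq (zero_le)) (by norm_num) (by norm_num)
        rw [lt_div_iff₀ hr₁pos] at hk1
        rw [div_le_iff₀ hr₁pos] at hk2
        refine mem_iUnion.2 ⟨k, hτ, hτS, ?_, ?_, ?_⟩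
        · rw [← hρ, ENNReal.coe_le_coe]; simp only [hrk]; rw [mul_comm]; exact hk1.le
        · rw [← hρ, ENNReal.coe_le_coe]; simp only [hrk]; rw [mul_comm]; exact hk2
        · rw [ENNReal.coe_le_coe]; simp only [hrk]; rw [mul_comm]; exact hερ.le.trans hk2
    · exact Or.inl ⟨hτ, hτS, hτq.trans_lt (by exact_mod_cast hr₁lt)⟩
  refine (lintegral_mono_set hcover).trans ((lintegral_union_le _ _ _).trans ?_)
  push_cast
  refine add_le_add (by simpa using hout) ((lintegral_union_le _ _ _).trans
    (add_le_add (by simpa using hball) ((lintegral_iUnion_le _ _).trans ?_)))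
  refine (ENNReal.tsum_le_tsum hann).trans (le_of_eq ?_)
  push_cast
  rw [ENNReal.tsum_mul_left, ENNReal.tsum_geometric]
  simp only [one_div, ENNReal.one_sub_inv_two,
    inv_inv]
  ring

lemma lengthBoundedIn_univ [CompactSpace X] (hX : HasSpeeds X) (hg : LowerSemicontinuous g)
    (hq : ∀ q, TameAt g q) (A : ℝ≥0) : LengthBoundedIn g A univ := by
  refine isCompact_univ.induction_on (p := LengthBoundedIn g A)
    ⟨0, fun γ K v ε _ _ _ _ _ _ => by simp⟩ ?_ ?_ ?_
  · rintro s t hst ⟨B, hB⟩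
    refine ⟨B, fun γ K v ε h1 h2 h3 h4 h5 h6 =>
      (lintegral_mono_set ?_).trans (hB γ K v ε h1 h2 h3 h4 h5 h6)⟩
    exact fun τ hτ => ⟨hτ.1, hst hτ.2⟩
  · rintro s t ⟨B, hB⟩ ⟨B', hB'⟩
    refine ⟨B + B', fun γ K v ε h1 h2 h3 h4 h5 h6 => ?_⟩
    push_cast
    refine le_trans ?_ (add_le_add (hB γ K v ε h1 h2 h3 h4 h5 h6) (hB' γ K v ε h1 h2 h3 h4 h5 h6))
    refine (lintegral_mono_set fun τ hτ => ?_).trans (lintegral_union_le _ _ _)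
    exact hτ.2.elim (fun h => Or.inl ⟨hτ.1, h⟩) fun h => Or.inr ⟨hτ.1, h⟩
  · intro q _
    obtain ⟨U, hU, hB⟩ := (hq q).exists_lengthBoundedIn hX hg A
    exact ⟨U, mem_nhdsWithin_of_mem_nhds hU, hB⟩

end LengthBound

/-- A bounded lower semicontinuous weight which is tame at every point of a compact space has
minimizing Lipschitz curves. -/
theorem exists_minimizer [CompactSpace X] (hX : HasSpeeds X) {g : X → ℝ≥0∞}
    (hg : LowerSemicontinuous g) {G : ℝ≥0} (hG : ∀ x, g x ≤ G) (hq : ∀ q, TameAt g q) {x y : X}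
    (hne : (lipCurves x y).Nonempty) :
    ∃ γ ∈ lipCurves x y, wlen g γ 0 1 = wdist g x y ∧ wlen g γ 0 1 ≠ ⊤ := by
  have hfin : ∀ γ ∈ lipCurves x y, ∀ G : ℝ≥0, ∀ g : X → ℝ≥0∞, (∀ x, g x ≤ G) →
      wlen g γ 0 1 ≠ ⊤ := by
    rintro γ ⟨⟨K, hK⟩, -, -⟩ G g hG
    exact ne_top_of_le_ne_top (by finiteness) (wlen_le_of_le hX hK zero_le_one fun t _ => hG (γ t))
  obtain ⟨γ₀, hγ₀⟩ := hne
  have hA0 := hfin γ₀ hγ₀ (G + 1) (fun x => g x + 1) fun x => by push_cast; gcongr; exact hG x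
  set A : ℝ≥0 := (wlen (fun x => g x + 1) γ₀ 0 1).toNNReal + 1 with hA
  obtain ⟨B, hB⟩ := lengthBoundedIn_univ hX hg hq A
  have hle : ∀ γ ∈ lipCurves x y, wdist g x y ≤ wlen g γ 0 1 := fun γ hγ => iInf₂_le γ hγ
  have hdfin : wdist g x y ≠ ⊤ := ne_top_of_le_ne_top (hfin γ₀ hγ₀ G g hG) (hle γ₀ hγ₀)
  suffices hseq : ∀ c, wdist g x y < c → ∃ γ : ℝ → X, LipschitzOnWith (B + 1) γ (Icc 0 1) ∧
      γ 0 = x ∧ γ 1 = y ∧ wlen g γ 0 1 ≤ c by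
    obtain ⟨γ, hγ, h0, h1, hmin⟩ := exists_wlen_le_wdist hg hseq hdfin
    exact ⟨γ, ⟨⟨_, hγ⟩, h0, h1⟩, le_antisymm hmin (hle γ ⟨⟨_, hγ⟩, h0, h1⟩),
      ne_top_of_le_ne_top hdfin hmin⟩
  intro c hc
  obtain ⟨γ', hγ', hlt⟩ : ∃ γ' ∈ lipCurves x y, wlen g γ' 0 1 < c := by
    simpa only [wdist, iInf_lt_iff, exists_prop] using hc
  have hℓ := hfin γ' hγ' 1 (fun _ => 1) fun _ => by simp
  obtain ⟨ε₀, hε₀, hε₀lt⟩ := ENNReal.exists_nnreal_pos_mul_lt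
    (ENNReal.add_ne_top.2 ⟨hℓ, ENNReal.one_ne_top⟩) (tsub_pos_of_lt hlt).ne'
  -- Almost minimizers for `g` could wander at no cost near the zeros of `g`. Those for `g + ε`
  -- cannot, and their lengths are bounded independently of `ε`.
  set ε := min ε₀ 1 with hε
  have hεpos : 0 < ε := lt_min hε₀ one_pos
  have hε1 : ε ≤ 1 := min_le_right _ _
  have hgε : ∀ γ ∈ lipCurves x y, wdist (fun x => g x + ε) x y ≤ wlen (fun x => g x + ε) γ 0 1 :=
    fun γ hγ => iInf₂_le γ hγ
  have hεA : wdist (fun x => g x + ε) x y ≤ wlen (fun x => g x + 1) γ₀ 0 1 :=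
    (hgε γ₀ hγ₀).trans (wlen_mono_weight (fun z => by gcongr; exact_mod_cast hε1) _ _ _)
  have hεfin := ne_top_of_le_ne_top hA0 hεA
  have hε2 : ((ε ^ 2 : ℝ≥0) : ℝ≥0∞) ≤ ε := by
    rw [ENNReal.coe_le_coe, pow_two]; exact mul_le_of_le_one_right (zero_le) hε1
  obtain ⟨β, hβ, hβlt⟩ : ∃ β ∈ lipCurves x y, wlen (fun x => g x + ε) β 0 1 <
      wdist (fun x => g x + ε) x y + (ε ^ 2 : ℝ≥0) := by
    have := ENNReal.lt_add_right hεfin (b := ((ε ^ 2 : ℝ≥0) : ℝ≥0∞))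
      (by simpa using hεpos.ne')
    simpa only [wdist, iInf_lt_iff, exists_prop] using this
  obtain ⟨⟨Kβ, hKβ⟩, hβ0, hβ1⟩ := hβ
  obtain ⟨v, hv⟩ := hX β 0 1 Kβ hKβ
  have hβA : wlen (fun x => g x + ε) β 0 1 ≤ A := by
    refine hβlt.le.trans ?_
    rw [hA, ENNReal.coe_add, ENNReal.coe_toNNReal hA0]
    refine add_le_add hεA (hε2.trans ?_)
    exact_mod_cast hε1
  have hβB := hB β Kβ v ε hεpos hε1 hKβ hv (by rw [hβ0, hβ1]; exact hβlt.le) hβA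
  have hβℓ : wlen (fun _ => 1) β 0 1 ≤ B := by
    rw [wlen_eq_lintegral lowerSemicontinuous_const_one hKβ hv zero_le_one,
      restrict_Ioo_eq_restrict_Icc]
    simpa only [one_mul, mem_univ, and_true, ofPred_mem_eq] using hβB
  obtain ⟨β', hβ', h0, h1, hβ'le⟩ := exists_reparam hX hKβ hβℓ
  refine ⟨β', hβ', h0.trans hβ0, h1.trans hβ1, (hβ'le g).trans ?_⟩
  calc wlen g β 0 1 ≤ wlen (fun x => g x + ε) β 0 1 :=
        wlen_mono_weight (fun _ => le_self_add) _ _ _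
    _ ≤ wlen (fun x => g x + ε) γ' 0 1 + ε :=
        hβlt.le.trans (add_le_add (hgε γ' hγ') hε2)
    _ = wlen g γ' 0 1 + ε * (wlen (fun _ => 1) γ' 0 1 + 1) := by
        rw [wlen_add_const hX hg hγ'.1.choose_spec zero_le_one, mul_add, mul_one, add_assoc]
    _ ≤ wlen g γ' 0 1 + ε₀ * (wlen (fun _ => 1) γ' 0 1 + 1) := by
        gcongr; exact min_le_left _ _
    _ ≤ wlen g γ' 0 1 + (c - wlen g γ' 0 1) := by gcongr
    _ = c := add_tsub_cancel_of_le hlt.le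

/-! ### The times spent in a closed set with a smaller weight -/

/-- Let `B` be a closed set such that, locally, two points of `B` are joined at a smaller cost than
the length of any curve through the complement of `B`. A minimizing curve makes no short excursion
out of `B`, so the times that it spends in `B` have a finite frontier. -/
theorem finite_frontier_of_minimizer [CompactSpace X] (hX : HasSpeeds X) {g : X → ℝ≥0∞}
    (hg : LowerSemicontinuous g) {B : Set X} (hB : IsClosed B)
    (hexc : ∀ p ∈ B, ∃ U, IsOpen U ∧ p ∈ U ∧ ∃ m₁ m₂ : ℝ≥0, m₁ < m₂ ∧
      (∀ a ∈ B ∩ U, ∀ b ∈ B ∩ U, wdist g a b ≤ m₁ * edist a b) ∧ ∀ x ∈ U, x ∉ B → m₂ ≤ g x)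
    {γ : ℝ → X} {K : ℝ≥0} (hγ : LipschitzOnWith K γ (Icc 0 1))
    (hmin : wlen g γ 0 1 ≤ wdist g (γ 0) (γ 1)) (hfin : wlen g γ 0 1 ≠ ⊤) :
    (frontier {t | t ∈ Icc (0 : ℝ) 1 ∧ γ t ∈ B}).Finite := by
  set C := {t | t ∈ Icc (0 : ℝ) 1 ∧ γ t ∈ B} with hC
  have hCcl : IsClosed C := hγ.continuousOn.preimage_isClosed_of_isClosed isClosed_Icc hB
  have hCcomp : IsCompact C := isCompact_Icc.of_isClosed_subset hCcl fun τ hτ => hτ.1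
  choose! U hUo hpU m₁ m₂ hm hcost hweight using hexc
  obtain ⟨δ, hδ, hδU⟩ := lebesgue_number_lemma_of_emetric (s := B) (c := fun p : B => U p)
    hB.isCompact (fun p => hUo p p.2) fun p hp => mem_iUnion.2 ⟨⟨p, hp⟩, hpU p hp⟩
  obtain ⟨δ', hδ', hδ'lt⟩ := ENNReal.exists_nnreal_pos_mul_lt (a := K) (b := δ) (by simp) hδ.ne'
  have hclose : ∀ s ∈ Icc (0 : ℝ) 1, ∀ t ∈ Icc (0 : ℝ) 1, s ≤ t → t - s ≤ δ' →
      edist (γ t) (γ s) < δ := by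
    intro s hs t ht hst hle
    refine (hγ ht hs).trans_lt (lt_of_le_of_lt ?_ hδ'lt)
    rw [mul_comm, edist_dist, Real.dist_eq, abs_of_nonneg (by linarith)]
    gcongr
    rw [← ENNReal.ofReal_coe_nnreal]
    exact ENNReal.ofReal_le_ofReal hle
  -- short excursions out of `B` are impossible
  have hconn : ∀ s ∈ C, ∀ t ∈ C, s ≤ t → t - s ≤ δ' → Icc s t ⊆ C := by
    intro s hs t ht hst hle u hu
    by_contra huC
    have hu01 : u ∈ Icc (0 : ℝ) 1 := ⟨hs.1.1.trans hu.1, hu.2.trans ht.1.2⟩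
    -- the last time before `u` and the first time after `u` at which the curve is in `B`
    obtain ⟨a, ha, hamax⟩ := (hCcomp.inter_right isClosed_Icc).exists_isGreatest
      (⟨s, hs, le_rfl, hu.1⟩ : (C ∩ Icc s u).Nonempty)
    obtain ⟨b, hb, hbmin⟩ := (hCcomp.inter_right isClosed_Icc).exists_isLeast
      (⟨t, ht, hu.2, le_rfl⟩ : (C ∩ Icc u t).Nonempty)
    have hau : a ≤ u := ha.2.2
    have hub : u ≤ b := hb.2.1
    have hab : a ≤ b := hau.trans hub
    have hout : ∀ τ ∈ Ioo a b, γ τ ∉ B := by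
      intro τ hτ hτB
      have hτC : τ ∈ C := ⟨⟨ha.1.1.1.trans hτ.1.le, hτ.2.le.trans hb.1.1.2⟩, hτB⟩
      rcases le_total τ u with h | h
      · exact absurd (hamax ⟨hτC, ha.2.1.trans hτ.1.le, h⟩) (not_le.2 hτ.1)
      · exact absurd (hbmin ⟨hτC, h, hτ.2.le.trans hb.2.2⟩) (not_le.2 hτ.2)
    obtain ⟨p, hp⟩ := hδU (γ a) ha.1.2
    have hnear : ∀ τ ∈ Icc a b, γ τ ∈ U p := by
      intro τ hτ
      refine hp (Metric.mem_eball.2 (hclose a ha.1.1 τ ⟨ha.1.1.1.trans hτ.1,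
        hτ.2.trans hb.1.1.2⟩ hτ.1 ?_))
      linarith [hτ.2, hb.2.2, ha.2.1]
    have hsub : Icc a b ⊆ Icc 0 1 := Icc_subset_Icc ha.1.1.1 hb.1.1.2
    have hlow := const_mul_wlen_le hX hg (hγ.mono hsub) hab (C := m₂ p) fun τ hτ =>
      hweight p p.2 _ (hnear τ ⟨hτ.1.le, hτ.2.le⟩) (hout τ hτ)
    have hup := wlen_le_wdist_add hX hg hγ (η := 0) (by simpa using hmin) hfin ha.1.1.1 hab
      hb.1.1.2
    rw [add_zero] at hup
    have hbd := hcost p p.2 _ ⟨ha.1.2, hnear a ⟨le_rfl, hab⟩⟩ _ ⟨hb.1.2, hnear b ⟨hab, le_rfl⟩⟩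
    have hd := edist_le_wlen hX (hγ.mono hsub) hab
    set ℓ := wlen (fun _ => 1) γ a b with hℓ
    have hℓfin : ℓ ≠ ⊤ := ne_top_of_le_ne_top (by finiteness)
      (wlen_le_of_le hX (g := fun _ => 1) (C := 1) (hγ.mono hsub) hab fun _ _ => le_rfl)
    have hℓpos : ℓ ≠ 0 := by
      intro h0
      have h1 := edist_le_wlen hX (hγ.mono ((Icc_subset_Icc le_rfl hub).trans hsub)) hau
      have h2 := wlen_add hX lowerSemicontinuous_const_one (hγ.mono hsub) hau hub
      rw [← hℓ, h0, add_eq_zero] at h2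
      rw [h2.1, nonpos_iff_eq_zero, edist_eq_zero] at h1
      exact huC ⟨hu01, h1 ▸ ha.1.2⟩
    have hcontra : (m₂ p : ℝ≥0∞) * ℓ ≤ m₁ p * ℓ :=
      hlow.trans (hup.trans (hbd.trans (by gcongr)))
    rw [ENNReal.mul_le_mul_iff_left hℓpos hℓfin] at hcontra
    exact absurd (hm p p.2) (not_lt.2 (by exact_mod_cast hcontra))
  have hFcomp : IsCompact (frontier C) :=
    hCcomp.of_isClosed_subset isClosed_frontier hCcl.frontier_subset
  have hδ'r : (0 : ℝ) < δ' := by exact_mod_cast hδ'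
  -- in an interval of length `δ'`, only the first and the last times in `C` can be frontier points
  have key : (frontier C ∩ frontier C).Finite := by
    refine hFcomp.induction_on (p := fun s => (frontier C ∩ s).Finite) (by simp)
      (fun s t hst ht => ht.subset (inter_subset_inter_right _ hst))
      (fun s t hs ht => by rw [inter_union_distrib_left]; exact hs.union ht) fun x _ => ?_
    refine ⟨Icc (x - δ' / 2) (x + δ' / 2), mem_nhdsWithin_of_mem_nhds
      (Icc_mem_nhds (by linarith) (by linarith)), ?_⟩
    rcases (C ∩ Icc (x - δ' / 2) (x + δ' / 2)).eq_empty_or_nonempty with he | hne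
    · refine Set.Finite.subset finite_empty fun u hu => ?_
      rw [← he]
      exact ⟨hCcl.frontier_subset hu.1, hu.2⟩
    obtain ⟨s, hs, hsmin⟩ := (hCcomp.inter_right isClosed_Icc).exists_isLeast hne
    obtain ⟨t, ht, htmax⟩ := (hCcomp.inter_right isClosed_Icc).exists_isGreatest hne
    refine (toFinite {s, t}).subset fun u hu => ?_
    have huC := hCcl.frontier_subset hu.1
    have hsu := hsmin ⟨huC, hu.2⟩
    have hut := htmax ⟨huC, hu.2⟩
    rcases hsu.eq_or_lt with rfl | hsu
    · simp
    rcases hut.eq_or_lt with rfl | hut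
    · simp
    exfalso
    have hsubC := hconn s hs.1 t ht.1 (hsu.trans hut).le (by linarith [hs.2.1, ht.2.2])
    exact hu.1.2 (mem_interior_iff_mem_nhds.2 (mem_of_superset (Icc_mem_nhds hsu hut) hsubC))
  simpa using key

end WeightedLength

/-! ### Lengths and distances in a chart -/

namespace RiemannianChart

open scoped NNReal

section Distortion

variable {E : Type*} [NormedAddCommGroup E] [NormedSpace ℝ E] {H : Type*} [TopologicalSpace H]
  {I : ModelWithCorners ℝ E H} {M : Type*} [EMetricSpace M] [ChartedSpace H M]
  [IsManifold I 1 M]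

variable (I) in
/-- The differential at `x` of the chart at `p`. -/
noncomputable def fwd (p x : M) : TangentSpace I x →L[ℝ] E :=
  (trivializationAt E (TangentSpace I) p).continuousLinearMapAt ℝ x

variable (I) in
/-- The differential of the inverse of the chart at `p`, at the image of `x`. -/
noncomputable def bwd (p x : M) : E →L[ℝ] TangentSpace I x :=
  (trivializationAt E (TangentSpace I) p).symmL ℝ x

lemma fwd_bwd {p x : M} (hx : x ∈ (chartAt H p).source) (v : E) : fwd I p x (bwd I p x v) = v := by
  have hx' : x ∈ (trivializationAt E (TangentSpace I) p).baseSet := by simpa using hx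
  simpa [fwd, bwd] using
    (trivializationAt E (TangentSpace I) p).continuousLinearMapAt_symmL (R := ℝ) hx' v

lemma bwd_fwd {p x : M} (hx : x ∈ (chartAt H p).source) (v : TangentSpace I x) :
    bwd I p x (fwd I p x v) = v := by
  have hx' : x ∈ (trivializationAt E (TangentSpace I) p).baseSet := by simpa using hx
  simpa [fwd, bwd] using
    (trivializationAt E (TangentSpace I) p).symmL_continuousLinearMapAt (R := ℝ) hx' v

lemma hasMFDerivAt_extChartAt {p x : M} (hx : x ∈ (chartAt H p).source) :
    HasMFDerivAt I 𝓘(ℝ, E) (extChartAt I p) x (fwd I p x) := by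
  have := (mdifferentiableAt_extChartAt (I := I) hx).hasMFDerivAt
  rwa [← TangentBundle.continuousLinearMapAt_trivializationAt hx] at this

lemma hasMFDerivWithinAt_extChartAt_symm {p x : M} (hx : x ∈ (chartAt H p).source) :
    HasMFDerivWithinAt 𝓘(ℝ, E) I (extChartAt I p).symm (range I) (extChartAt I p x)
      (bwd I p x) := by
  have hx' : extChartAt I p x ∈ (extChartAt I p).target :=
    (extChartAt I p).map_source (by simpa using hx)
  have := (mdifferentiableWithinAt_extChartAt_symm (I := I) hx').hasMFDerivWithinAt
  rwa [← TangentBundle.symmL_trivializationAt hx] at this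

variable [RiemannianBundle (fun x : M => TangentSpace I x)]

/-- Near `p`, the scalar product read in the chart at `p` is close to the one at `p`. -/
lemma eventually_norm_bwd_le [IsContinuousRiemannianBundle E (fun x : M => TangentSpace I x)]
    (p : M) {r : ℝ} (hr : 1 < r) :
    ∀ᶠ x in 𝓝 p, (∀ v : E, ‖bwd I p x v‖ ≤ r * ‖bwd I p p v‖) ∧
      ∀ w : TangentSpace I x, ‖bwd I p p (fwd I p x w)‖ ≤ r * ‖w‖ := by
  filter_upwards [eventually_norm_symmL_trivializationAt_comp_self_lt E
      (fun x : M => TangentSpace I x) p hr,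
    eventually_norm_symmL_trivializationAt_self_comp_lt E
      (fun x : M => TangentSpace I x) p hr] with x h1 h2
  refine ⟨fun v => ?_, fun w => ?_⟩
  · have := (ContinuousLinearMap.le_opNorm _ (bwd I p p v)).trans
      (mul_le_mul_of_nonneg_right h1.le (norm_nonneg _))
    rw [ContinuousLinearMap.comp_apply] at this
    have e := fwd_bwd (I := I) (mem_chart_source H p) v
    rw [fwd] at e
    rw [e] at this
    exact this
  · exact (ContinuousLinearMap.le_opNorm _ w).trans
      (mul_le_mul_of_nonneg_right h2.le (norm_nonneg _))

lemma hasDerivAt_bwd_extChartAt {p : M} {γ : ℝ → M} {t : ℝ} (ht : γ t ∈ (chartAt H p).source)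
    (hγ : MDifferentiableAt 𝓘(ℝ, ℝ) I γ t) :
    HasDerivAt (fun t => bwd I p p (extChartAt I p (γ t)))
      (bwd I p p (fwd I p (γ t) (mfderiv 𝓘(ℝ, ℝ) I γ t 1))) t := by
  have h1 : HasMFDerivAt 𝓘(ℝ, ℝ) 𝓘(ℝ, E) (extChartAt I p ∘ γ) t
      ((fwd I p (γ t)).comp (mfderiv 𝓘(ℝ, ℝ) I γ t)) :=
    (hasMFDerivAt_extChartAt ht).comp t hγ.hasMFDerivAt
  have h2 : HasFDerivAt (extChartAt I p ∘ γ)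
      ((fwd I p (γ t)).comp (mfderiv 𝓘(ℝ, ℝ) I γ t) : ℝ →L[ℝ] E) t := h1.hasFDerivAt
  exact ((bwd I p p).hasFDerivAt.comp_hasDerivAt t h2.hasDerivAt)

variable [IsRiemannianManifold I M]

/-- The segment between `y` and `z` in the chart at `p` has a length at most `r` times the length
of the segment for the scalar product at `p`, when the chart distorts lengths by at most `r`. -/
lemma edist_symm_le {p : M} {r : ℝ≥0} {s : Set E} (hs : Convex ℝ s)
    (hst : s ⊆ (extChartAt I p).target)
    (hr : ∀ z ∈ s, ∀ v : E, ‖bwd I p ((extChartAt I p).symm z) v‖ ≤ r * ‖bwd I p p v‖)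
    {y z : E} (hy : y ∈ s) (hz : z ∈ s) :
    edist ((extChartAt I p).symm y) ((extChartAt I p).symm z) ≤ r * ‖bwd I p p (z - y)‖ₑ := by
  let η := ContinuousAffineMap.lineMap (R := ℝ) y z
  set γ := (extChartAt I p).symm ∘ η
  have hη : MapsTo η (Icc 0 1) s := by
    intro t ht
    refine hs.segment_subset hy hz ?_
    rw [segment_eq_image_lineMap]
    exact mem_image_of_mem _ ht
  have η_smooth : ContMDiffOn 𝓘(ℝ, ℝ) 𝓘(ℝ, E) 1 η (Icc 0 1) := by
    apply ContMDiff.contMDiffOn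
    rw [contMDiff_iff_contDiff]
    exact ContinuousAffineMap.contDiff _
  rw [IsRiemannianManifold.out (I := I) (M := M)]
  have h1 : Manifold.riemannianEDist I ((extChartAt I p).symm y) ((extChartAt I p).symm z) ≤
      Manifold.pathELength I γ 0 1 := by
    apply Manifold.riemannianEDist_le_pathELength _ _ _ zero_le_one
    · exact (contMDiffOn_extChartAt_symm p).comp η_smooth (hη.mono_right hst)
    · simp [γ, η, ContinuousAffineMap.coe_lineMap_eq]
    · simp [γ, η, ContinuousAffineMap.coe_lineMap_eq]
  refine h1.trans ?_
  rw [Manifold.pathELength_eq_lintegral_mfderiv_Ioo]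
  calc ∫⁻ t in Ioo (0 : ℝ) 1, ‖mfderiv 𝓘(ℝ, ℝ) I γ t 1‖ₑ
      ≤ ∫⁻ t in Ioo (0 : ℝ) 1, r * ‖bwd I p p (z - y)‖ₑ := by
        refine setLIntegral_mono' measurableSet_Ioo fun t ht => ?_
        have ht' : t ∈ Icc (0 : ℝ) 1 := ⟨ht.1.le, ht.2.le⟩
        have hmem := hst (hη ht')
        set x := (extChartAt I p).symm (η t) with hx
        have hxs : x ∈ (chartAt H p).source := by
          rw [← extChartAt_source I]; exact (extChartAt I p).map_target hmem
        have hηx : extChartAt I p x = η t := (extChartAt I p).right_inv hmem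
        have hd := hasMFDerivWithinAt_extChartAt_symm (I := I) hxs
        rw [hηx] at hd
        set L : ℝ →L[ℝ] E := (1 : ℝ →L[ℝ] ℝ).smulRight (z - y) with hL
        have hη0 : HasFDerivAt η L t := by
          refine (HasDerivAt.hasFDerivAt ?_ : HasFDerivAt η _ t)
          simp only [η, ContinuousAffineMap.coe_lineMap_eq]
          exact AffineMap.hasDerivAt_lineMap
        have hη1 : HasMFDerivAt 𝓘(ℝ, ℝ) 𝓘(ℝ, E) η t L := hη0.hasMFDerivAt
        have hγ1 : HasMFDerivAt 𝓘(ℝ, ℝ) I γ t ((bwd I p x).comp L) := by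
          refine HasMFDerivWithinAt.hasMFDerivAt (s := Icc 0 1) ?_ (Icc_mem_nhds ht.1 ht.2)
          exact HasMFDerivWithinAt.comp t hd hη1.hasMFDerivWithinAt
            fun τ hτ => extChartAt_target_subset_range p (hst (hη hτ))
        rw [hγ1.mfderiv]
        have hle := hr (η t) (hη ht') (z - y)
        have : ((bwd I p x).comp L) (1 : ℝ) = bwd I p x (z - y) := by simp [hL]
        refine (congrArg enorm this).trans_le ?_
        rw [← ofReal_norm, ← ofReal_norm, ← ENNReal.ofReal_coe_nnreal,
          ← ENNReal.ofReal_mul r.coe_nonneg]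
        exact ENNReal.ofReal_le_ofReal hle
    _ = r * ‖bwd I p p (z - y)‖ₑ := by simp

/-- A chart distorts distances at most as much as it distorts the lengths of tangent vectors on a
larger ball. -/
lemma enorm_extChartAt_sub_le {p : M} {r : ℝ≥0} (hr0 : 0 < r) {ρ : ℝ≥0∞}
    (hsource : Metric.eball p ρ ⊆ (chartAt H p).source)
    (hr : ∀ x ∈ Metric.eball p ρ, ∀ w : TangentSpace I x, ‖bwd I p p (fwd I p x w)‖ ≤ r * ‖w‖)
    {x y : M} (hx : x ∈ Metric.eball p (ρ / 4)) (hy : y ∈ Metric.eball p (ρ / 4)) :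
    ‖bwd I p p (extChartAt I p y - extChartAt I p x)‖ₑ ≤ r * edist x y := by
  have hx' : edist x p < ρ / 4 := hx
  have hy' : edist y p < ρ / 4 := hy
  have hquarter : ρ / 4 + ρ / 4 = ρ / 2 := by
    rw [← ENNReal.add_div, ENNReal.div_eq_div_iff (by simp) (by simp) (by simp) (by simp)]
    ring
  have hxy : edist x y < ρ / 2 := by
    rw [← hquarter]
    refine (edist_triangle x p y).trans_lt (ENNReal.add_lt_add hx' ?_)
    rwa [edist_comm]
  rw [mul_comm, ← ENNReal.div_le_iff_le_mul (by simp [hr0.ne']) (by simp)]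
  refine le_of_forall_gt_imp_ge_of_dense fun c hc => ?_
  rw [ENNReal.div_le_iff_le_mul (by simp [hr0.ne']) (by simp), mul_comm]
  have hlt : Manifold.riemannianEDist I x y < min c (ρ / 2) := by
    rw [← IsRiemannianManifold.out (I := I) (M := M)]
    exact lt_min hc hxy
  obtain ⟨γ, h0, h1, hγ, hlen, -, -⟩ :=
    Manifold.exists_lt_locally_constant_of_riemannianEDist_lt hlt zero_lt_one
  have hball : ∀ t ∈ Icc (0 : ℝ) 1, γ t ∈ Metric.eball p ρ := by
    intro t ht
    have h2 : edist x (γ t) < ρ / 2 := by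
      rw [IsRiemannianManifold.out (I := I) (M := M)]
      refine (Manifold.riemannianEDist_le_pathELength hγ.contMDiffOn h0 rfl ht.1).trans_lt ?_
      exact (Manifold.pathELength_mono le_rfl ht.2).trans_lt (hlen.trans_le (min_le_right _ _))
    rw [Metric.mem_eball]
    calc edist (γ t) p ≤ edist (γ t) x + edist x p := edist_triangle _ _ _
      _ < ρ / 2 + ρ / 2 := by
        refine ENNReal.add_lt_add (by rwa [edist_comm]) (hx'.trans_le ?_)
        rw [← hquarter]; exact le_self_add
      _ = ρ := ENNReal.add_halves ρ
  set c' : ℝ → TangentSpace I p := fun t => bwd I p p (extChartAt I p (γ t)) with hc'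
  have hsm : ContDiffOn ℝ 1 c' (Icc 0 1) := by
    have h3 : ContMDiffOn 𝓘(ℝ, ℝ) 𝓘(ℝ, E) 1 (extChartAt I p ∘ γ) (Icc 0 1) :=
      (contMDiffOn_extChartAt (I := I) (n := 1)).comp hγ.contMDiffOn
        fun t ht => hsource (hball t ht)
    exact (bwd I p p).contDiff.comp_contDiffOn h3.contDiffOn
  have key := enorm_sub_le_lintegral_derivWithin_Icc_of_contDiffOn_Icc hsm zero_le_one
  have e : c' 1 - c' 0 = bwd I p p (extChartAt I p y - extChartAt I p x) := by
    simp only [hc', h0, h1, map_sub]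
  rw [e, ← restrict_Ioo_eq_restrict_Icc] at key
  refine key.trans ?_
  calc ∫⁻ t in Ioo (0 : ℝ) 1, ‖derivWithin c' (Icc 0 1) t‖ₑ
      ≤ ∫⁻ t in Ioo (0 : ℝ) 1, r * ‖mfderiv 𝓘(ℝ, ℝ) I γ t 1‖ₑ := by
        refine setLIntegral_mono' measurableSet_Ioo fun t ht => ?_
        have hb := hball t ⟨ht.1.le, ht.2.le⟩
        have hd := hasDerivAt_bwd_extChartAt (I := I) (p := p) (hsource hb)
          (hγ.mdifferentiable one_ne_zero t)
        rw [derivWithin_of_mem_nhds (Icc_mem_nhds ht.1 ht.2), hd.deriv]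
        have hle := hr _ hb (mfderiv 𝓘(ℝ, ℝ) I γ t 1)
        rw [← ofReal_norm, ← ofReal_norm, ← ENNReal.ofReal_coe_nnreal,
          ← ENNReal.ofReal_mul r.coe_nonneg]
        exact ENNReal.ofReal_le_ofReal hle
    _ = r * Manifold.pathELength I γ 0 1 := by
        rw [lintegral_const_mul' _ _ ENNReal.coe_ne_top,
          Manifold.pathELength_eq_lintegral_mfderiv_Ioo]
    _ ≤ r * c := by gcongr; exact (hlen.trans_le (min_le_left _ _)).le

end Distortion

/-! ### Small convex charts -/

section ChartBall

open WeightedLength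

variable {E : Type*} [NormedAddCommGroup E] [NormedSpace ℝ E] {H : Type*} [TopologicalSpace H]
  {I : ModelWithCorners ℝ E H} {M : Type*} [EMetricSpace M] [ChartedSpace H M]
  [IsManifold I 1 M] [RiemannianBundle (fun x : M => TangentSpace I x)]

variable (I) in
/-- A chart domain `U` around `p` and a convex part `s` of the model space, such that the chart at
`p` distorts lengths and distances at most by the factor `r`. Lengths in the model space are those
of the scalar product at `p`. The set `N` is a neighbourhood in which everything takes place. -/
structure IsChartBall (p : M) (r : ℝ≥0) (N U : Set M) (s : Set E) : Prop where
  isOpen : IsOpen U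
  mem : p ∈ U
  subset : U ⊆ N
  source : U ⊆ (chartAt H p).source
  convex : Convex ℝ s
  target : s ⊆ (extChartAt I p).target
  mapsTo : MapsTo (extChartAt I p) U s
  mapsTo_symm : MapsTo (extChartAt I p).symm s N
  norm_bwd_le : ∀ x ∈ U, ∀ v : E, ‖bwd I p x v‖ ≤ r * ‖bwd I p p v‖
  norm_fwd_le : ∀ x ∈ U, ∀ w : TangentSpace I x, ‖bwd I p p (fwd I p x w)‖ ≤ r * ‖w‖
  edist_symm_le : ∀ y ∈ s, ∀ z ∈ s,
    edist ((extChartAt I p).symm y) ((extChartAt I p).symm z) ≤ r * ‖bwd I p p (z - y)‖ₑ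
  enorm_sub_le : ∀ x ∈ U, ∀ y ∈ U,
    ‖bwd I p p (extChartAt I p y - extChartAt I p x)‖ₑ ≤ r * edist x y

namespace IsChartBall

variable {p : M} {r : ℝ≥0} {N U : Set M} {s : Set E}

lemma symm_apply (h : IsChartBall I p r N U s) {x : M} (hx : x ∈ U) :
    (extChartAt I p).symm (extChartAt I p x) = x :=
  (extChartAt I p).left_inv (by rw [extChartAt_source]; exact h.source hx)

lemma edist_le (h : IsChartBall I p r N U s) {x y : M} (hx : x ∈ U) (hy : y ∈ U) :
    edist x y ≤ r * ‖bwd I p p (extChartAt I p y - extChartAt I p x)‖ₑ := by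
  have := h.edist_symm_le _ (h.mapsTo hx) _ (h.mapsTo hy)
  rwa [h.symm_apply hx, h.symm_apply hy] at this

/-- Segments in the model space are Lipschitz curves. -/
lemma lipschitzOnWith_segment (h : IsChartBall I p r N U s) {y z : E} (hy : y ∈ s) (hz : z ∈ s) :
    LipschitzOnWith (r * ‖bwd I p p (z - y)‖₊)
      (fun t : ℝ => (extChartAt I p).symm (AffineMap.lineMap y z t)) (Icc 0 1) := by
  have hmem : ∀ t ∈ Icc (0 : ℝ) 1, AffineMap.lineMap y z t ∈ s := by
    intro t ht
    refine h.convex.segment_subset hy hz ?_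
    rw [segment_eq_image_lineMap]
    exact mem_image_of_mem _ ht
  intro t ht t' ht'
  refine (h.edist_symm_le _ (hmem t ht) _ (hmem t' ht')).trans (le_of_eq ?_)
  have : (AffineMap.lineMap y z t' : E) - AffineMap.lineMap y z t = (t' - t) • (z - y) := by
    simp only [AffineMap.lineMap_apply, vsub_eq_sub, vadd_eq_add]
    module
  rw [this, map_smul, enorm_smul, edist_comm, edist_eq_enorm_sub, ENNReal.coe_mul, mul_assoc]
  congr 1
  rw [mul_comm]; rfl

end IsChartBall

lemma exists_isChartBall [IsContinuousRiemannianBundle E (fun x : M => TangentSpace I x)]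
    [IsRiemannianManifold I M] (p : M) {r : ℝ≥0} (hr : 1 < r) {N : Set M} (hN : N ∈ 𝓝 p) :
    ∃ U s, IsChartBall I p r N U s := by
  have hgood := (eventually_norm_bwd_le (I := I) p (r := r) (by exact_mod_cast hr))
  obtain ⟨ρ, hρ, hball⟩ := EMetric.mem_nhds_iff.1
    (inter_mem (chart_source_mem_nhds H p) (inter_mem hN hgood))
  obtain ⟨δ, hδ, hs⟩ : ∃ δ > 0, Metric.ball (extChartAt I p p) δ ∩ range I ⊆
      (extChartAt I p).target ∩ (extChartAt I p).symm ⁻¹' Metric.eball p ρ := by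
    refine Metric.mem_nhdsWithin_iff.1 (inter_mem (extChartAt_target_mem_nhdsWithin p) ?_)
    refine mem_nhdsWithin_of_mem_nhds ((continuousAt_extChartAt_symm p).preimage_mem_nhds ?_)
    rw [extChartAt_to_inv]
    exact Metric.eball_mem_nhds p hρ
  set s := Metric.ball (extChartAt I p p) δ ∩ range I with hsdef
  have hU : (chartAt H p).source ∩ extChartAt I p ⁻¹' Metric.ball (extChartAt I p p) δ ∩
      Metric.eball p (ρ / 4) ∈ 𝓝 p := by
    refine inter_mem (inter_mem (chart_source_mem_nhds H p)
      ((continuousAt_extChartAt p).preimage_mem_nhds (Metric.ball_mem_nhds _ hδ)))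
      (Metric.eball_mem_nhds p (ENNReal.div_pos hρ.ne' (by simp)))
  obtain ⟨U, hUsub, hUo, hpU⟩ := mem_nhds_iff.1 hU
  have hUball : U ⊆ Metric.eball p ρ := fun x hx =>
    Metric.eball_subset_eball (ENNReal.div_le_of_le_mul (by
      rw [mul_comm]; exact le_mul_of_one_le_left (zero_le) (by norm_num))) (hUsub hx).2
  have hconv : Convex ℝ s := (convex_ball _ _).inter I.convex_range
  refine ⟨U, s, hUo, hpU, fun x hx => (hball (hUball hx)).2.1, fun x hx => (hUsub hx).1.1, hconv,
    fun y hy => (hs hy).1, fun x hx => ⟨(hUsub hx).1.2, extChartAt_target_subset_range p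
      ((extChartAt I p).map_source (by rw [extChartAt_source]; exact (hUsub hx).1.1))⟩,
    fun y hy => (hball (hs hy).2).2.1, fun x hx => (hball (hUball hx)).2.2.1,
    fun x hx => (hball (hUball hx)).2.2.2, fun y hy z hz => ?_, fun x hx y hy => ?_⟩
  · exact edist_symm_le hconv (fun y hy => (hs hy).1)
      (fun z hz => (hball (hs hz).2).2.2.1) hy hz
  · exact enorm_extChartAt_sub_le (zero_lt_one.trans hr) (fun x hx => (hball hx).1)
      (fun x hx => (hball hx).2.2.2) (hUsub hx).2 (hUsub hy).2

/-! ### Metric speed and derivative -/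

/-- A curve which is differentiable at `t` has the norm of its derivative as metric speed. -/
lemma hasSpeedAt_of_mdifferentiableAt
    [IsContinuousRiemannianBundle E (fun x : M => TangentSpace I x)]
    [IsRiemannianManifold I M] {γ : ℝ → M} {t : ℝ} (hγ : MDifferentiableAt 𝓘(ℝ, ℝ) I γ t) :
    HasSpeedAt γ t ‖mfderiv 𝓘(ℝ, ℝ) I γ t 1‖ₑ := by
  set p := γ t with hp
  set w : TangentSpace I p := mfderiv 𝓘(ℝ, ℝ) I γ t 1 with hw
  set c : ℝ → TangentSpace I p := fun t => bwd I p p (extChartAt I p (γ t)) with hc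
  set l := 𝓝 (t, t) ⊓ 𝓟 {q : ℝ × ℝ | q.1 ≤ t ∧ t ≤ q.2 ∧ q.1 < q.2} with hl
  have hcd : HasDerivAt c w t := by
    have := hasDerivAt_bwd_extChartAt (I := I) (p := p) (mem_chart_source H p) hγ
    rwa [bwd_fwd (mem_chart_source H p)] at this
  have hl1 : ∀ {P : ℝ → Prop}, (∀ᶠ s in 𝓝 t, P s) → ∀ᶠ q : ℝ × ℝ in l, P q.1 ∧ P q.2 := by
    intro P hP
    refine Eventually.filter_mono inf_le_left ?_
    rw [nhds_prod_eq]
    exact (tendsto_fst.eventually hP).and (tendsto_snd.eventually hP)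
  have hl2 : ∀ᶠ q : ℝ × ℝ in l, q.1 ≤ t ∧ t ≤ q.2 ∧ q.1 < q.2 :=
    mem_inf_of_right (mem_principal_self _)
  have hQ : Tendsto (fun q : ℝ × ℝ => ‖c q.2 - c q.1‖ₑ / ENNReal.ofReal (q.2 - q.1)) l
      (𝓝 ‖w‖ₑ) := by
    have h1 : Tendsto (fun q : ℝ × ℝ => (q.2 - q.1)⁻¹ • (c q.2 - c q.1)) l (𝓝 w) := by
      rw [Metric.tendsto_nhds]
      intro ε hε
      have h2 := hl1 ((hasDerivAt_iff_isLittleO.1 hcd).def (half_pos hε))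
      filter_upwards [h2, hl2] with q hq hq'
      have hpos : 0 < q.2 - q.1 := by linarith [hq'.2.2]
      rw [dist_eq_norm]
      have e : (q.2 - q.1)⁻¹ • (c q.2 - c q.1) - w = (q.2 - q.1)⁻¹ •
          ((c q.2 - c t - (q.2 - t) • w) - (c q.1 - c t - (q.1 - t) • w)) := by
        have : w = (q.2 - q.1)⁻¹ • ((q.2 - q.1) • w) := by
          rw [smul_smul, inv_mul_cancel₀ hpos.ne', one_smul]
        nth_rewrite 1 [this]
        module
      rw [e, norm_smul, norm_inv, Real.norm_of_nonneg hpos.le, inv_mul_lt_iff₀ hpos]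
      refine (norm_sub_le _ _).trans_lt ?_
      have h3 := hq.1
      have h4 := hq.2
      rw [Real.norm_eq_abs, abs_of_nonpos (by linarith)] at h3
      rw [Real.norm_eq_abs, abs_of_nonneg (by linarith)] at h4
      nlinarith
    refine (h1.enorm).congr' ?_
    filter_upwards [hl2] with q hq
    have hpos : 0 < q.2 - q.1 := by linarith [hq.2.2]
    rw [enorm_smul, ENNReal.div_eq_inv_mul, enorm_inv hpos.ne', Real.enorm_of_nonneg hpos.le]
  have hcmp : ∀ r : ℝ≥0, 1 < r → ∀ᶠ q : ℝ × ℝ in l,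
      ‖c q.2 - c q.1‖ₑ / ENNReal.ofReal (q.2 - q.1) ≤
        r * (edist (γ q.1) (γ q.2) / ENNReal.ofReal (q.2 - q.1)) ∧
      edist (γ q.1) (γ q.2) / ENNReal.ofReal (q.2 - q.1) ≤
        r * (‖c q.2 - c q.1‖ₑ / ENNReal.ofReal (q.2 - q.1)) := by
    intro r hr
    obtain ⟨U, s, hUs⟩ := exists_isChartBall (I := I) p hr univ_mem
    filter_upwards [hl1 (hγ.continuousAt (hUs.isOpen.mem_nhds hUs.mem))] with q hq
    simp only [hc, ← map_sub, ← mul_div_assoc]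
    exact ⟨ENNReal.div_le_div_right (hUs.enorm_sub_le _ hq.1 _ hq.2) _,
      ENNReal.div_le_div_right (hUs.edist_le hq.1 hq.2) _⟩
  have hr_exists : ∀ {a b : ℝ≥0∞}, a < b → ∃ r : ℝ≥0, 1 < r ∧ r * a < b := by
    intro a b hab
    have ha : a ≠ ⊤ := hab.ne_top
    have h1 : Tendsto (fun r : ℝ≥0 => (r : ℝ≥0∞) * a) (𝓝[>] 1) (𝓝 (1 * a)) :=
      (ENNReal.Tendsto.mul_const (ENNReal.tendsto_coe.2 tendsto_id) (Or.inr ha)).mono_left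
        nhdsWithin_le_nhds
    rw [one_mul] at h1
    obtain ⟨r, h2, h3⟩ := ((h1.eventually (gt_mem_nhds hab)).and self_mem_nhdsWithin).exists
    exact ⟨r, h3, h2⟩
  refine tendsto_order.2 ⟨fun m hm => ?_, fun m hm => ?_⟩
  · obtain ⟨r, hr, hrm⟩ := hr_exists hm
    filter_upwards [hcmp r hr, hQ.eventually (lt_mem_nhds hrm)] with q h1 h2
    by_contra! hle
    exact absurd (h2.trans_le (h1.1.trans (by gcongr))) (lt_irrefl _)
  · obtain ⟨r, hr, hrm⟩ := hr_exists hm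
    have : ‖w‖ₑ < m / r := by
      rwa [ENNReal.lt_div_iff_mul_lt (by simp [(zero_lt_one.trans hr).ne']) (by simp), mul_comm]
    filter_upwards [hcmp r hr, hQ.eventually (gt_mem_nhds this)] with q h1 h2
    rw [ENNReal.lt_div_iff_mul_lt (by simp [(zero_lt_one.trans hr).ne']) (by simp), mul_comm] at h2
    exact h1.2.trans_lt h2

/-- Rademacher's theorem for curves in a Riemannian manifold. -/
lemma ae_mdifferentiableAt [FiniteDimensional ℝ E]
    [IsContinuousRiemannianBundle E (fun x : M => TangentSpace I x)]
    [IsRiemannianManifold I M] {γ : ℝ → M} {a b : ℝ} {K : ℝ≥0}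
    (hγ : LipschitzOnWith K γ (Icc a b)) :
    ∀ᵐ t ∂(volume.restrict (Ioo a b)), MDifferentiableAt 𝓘(ℝ, ℝ) I γ t := by
  rw [ae_restrict_iff' measurableSet_Ioo, ae_iff]
  refine measure_null_of_locally_null _ fun t ht => ?_
  simp only [Classical.not_imp, mem_ofPred_eq] at ht
  obtain ⟨ht, -⟩ := ht
  set p := γ t with hp
  obtain ⟨U, s, hUs⟩ := exists_isChartBall (I := I) p (r := 2) (by norm_num) univ_mem
  have hcont : ContinuousAt γ t := hγ.continuousOn.continuousAt (Icc_mem_nhds ht.1 ht.2)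
  obtain ⟨δ, hδ, hJ⟩ := Metric.mem_nhds_iff.1
    (inter_mem (hcont (hUs.isOpen.mem_nhds hUs.mem)) (Ioo_mem_nhds ht.1 ht.2))
  set J := Metric.ball t δ with hJdef
  have hlip : LipschitzOnWith (‖(fwd I p p)‖₊ * (2 * K)) (fun t => extChartAt I p (γ t)) J := by
    intro τ hτ τ' hτ'
    have h1 : ‖extChartAt I p (γ τ') - extChartAt I p (γ τ)‖ₑ ≤
        ‖fwd I p p‖ₑ * ‖bwd I p p (extChartAt I p (γ τ') - extChartAt I p (γ τ))‖ₑ := by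
      have := (fwd I p p).le_opENorm (bwd I p p (extChartAt I p (γ τ') - extChartAt I p (γ τ)))
      rwa [fwd_bwd (mem_chart_source H p)] at this
    have h2 := hUs.enorm_sub_le _ (hJ hτ).1 _ (hJ hτ').1
    have h3 := hγ (Ioo_subset_Icc_self (hJ hτ).2) (Ioo_subset_Icc_self (hJ hτ').2)
    rw [edist_comm, edist_eq_enorm_sub]
    refine h1.trans ?_
    push_cast
    rw [mul_assoc, mul_assoc]
    refine mul_le_mul' le_rfl (h2.trans ?_)
    push_cast
    gcongr
  have hae := hlip.ae_differentiableWithinAt_of_mem (μ := volume)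
  refine ⟨{τ | ¬ (τ ∈ J → DifferentiableWithinAt ℝ (fun t => extChartAt I p (γ t)) J τ)} ∪
    {τ | ¬ (τ ∈ Ioo a b → MDifferentiableAt 𝓘(ℝ, ℝ) I γ τ)} ∩ J, ?_, ?_⟩
  · exact mem_of_superset (inter_mem_nhdsWithin _ (Metric.ball_mem_nhds t hδ))
      fun τ hτ => Or.inr hτ
  · refine measure_mono_null (t := {τ | ¬ (τ ∈ J →
      DifferentiableWithinAt ℝ (fun t => extChartAt I p (γ t)) J τ)}) ?_ (ae_iff.1 hae)
    rintro τ (hτ | ⟨hτ, hτJ⟩)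
    · exact hτ
    · intro hdiff
      apply hτ
      intro hτab
      have hd := hdiff hτJ
      have hJn : J ∈ 𝓝 τ := Metric.isOpen_ball.mem_nhds hτJ
      have hsrc := hUs.source (hJ hτJ).1
      have h1 : MDifferentiableWithinAt 𝓘(ℝ, ℝ) 𝓘(ℝ, E) (extChartAt I p ∘ γ) J τ :=
        hd.mdifferentiableWithinAt
      have h2 : MDifferentiableWithinAt 𝓘(ℝ, E) I (extChartAt I p).symm (range I)
          ((extChartAt I p ∘ γ) τ) :=
        (hasMFDerivWithinAt_extChartAt_symm hsrc).mdifferentiableWithinAt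
      have h3 : MDifferentiableWithinAt 𝓘(ℝ, ℝ) I
          ((extChartAt I p).symm ∘ extChartAt I p ∘ γ) J τ :=
        h2.comp τ h1 fun τ' hτ' => extChartAt_target_subset_range p
          (hUs.target (hUs.mapsTo (hJ hτ').1))
      refine (h3.congr (fun τ' hτ' => ?_) ?_).mdifferentiableAt hJn
      · exact (hUs.symm_apply (hJ hτ').1).symm
      · exact (hUs.symm_apply (hJ hτJ).1).symm

lemma hasSpeedOn_mfderiv [FiniteDimensional ℝ E]
    [IsContinuousRiemannianBundle E (fun x : M => TangentSpace I x)]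
    [IsRiemannianManifold I M] {γ : ℝ → M} {a b : ℝ} {K : ℝ≥0}
    (hγ : LipschitzOnWith K γ (Icc a b)) :
    HasSpeedOn γ (fun t => ‖mfderiv 𝓘(ℝ, ℝ) I γ t 1‖ₑ) a b :=
  (ae_mdifferentiableAt hγ).mono fun _ ht => hasSpeedAt_of_mdifferentiableAt ht

end ChartBall

end RiemannianChart

namespace Agmon

open scoped NNReal
open WeightedLength RiemannianChart

section Chart

/-! ### The boundary and the differential of a function in a chart -/

variable {d : ℕ} [NeZero d] {M : Type*} [EMetricSpace M] [ChartedSpace (EuclideanHalfSpace d) M]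

/-- The differential of a real function at `x`, as a linear form. -/
noncomputable def diffForm (f : M → ℝ) (x : M) : TangentSpace (𝓡∂ d) x →L[ℝ] ℝ :=
  mfderiv (𝓡∂ d) 𝓘(ℝ, ℝ) f x

/-- The vectors tangent to the stratum of `x`: all vectors at an interior point, the vectors tangent
to the boundary at a boundary point. -/
def stratumVectors (x : M) : Set (TangentSpace (𝓡∂ d) x) :=
  {w | x ∈ (𝓡∂ d).boundary M → normalForm x w = 0}

variable [IsManifold (𝓡∂ d) ∞ M]

lemma mem_boundary_iff {p x : M} (hx : x ∈ (chartAt (EuclideanHalfSpace d) p).source) :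
    x ∈ (𝓡∂ d).boundary M ↔ (extChartAt (𝓡∂ d) p x) 0 = 0 := by
  have h := ModelWithCorners.isInteriorPoint_iff_of_mem_atlas (I := 𝓡∂ d) (n := ∞) (by simp)
    (chart_mem_atlas (EuclideanHalfSpace d) p) hx
  have hpos : 0 ≤ (extChartAt (𝓡∂ d) p x) 0 := by
    have : extChartAt (𝓡∂ d) p x ∈ range (𝓡∂ d) := mem_range_self _
    rwa [range_modelWithCornersEuclideanHalfSpace] at this
  have h2 : x ∈ (𝓡∂ d).interior M ↔ 0 < (extChartAt (𝓡∂ d) p x) 0 := by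
    rw [ModelWithCorners.interior, mem_ofPred_eq, h]
    constructor
    · intro h'
      have := OpenPartialHomeomorph.interior_extend_target_subset_interior_range _ h'
      rwa [interior_range_modelWithCornersEuclideanHalfSpace] at this
    · intro h'
      refine OpenPartialHomeomorph.mem_interior_extend_target _
        ((chartAt (EuclideanHalfSpace d) p).map_source hx) ?_
      rw [interior_range_modelWithCornersEuclideanHalfSpace]
      exact h'
  rw [← ModelWithCorners.compl_interior, mem_compl_iff, h2, not_lt]
  exact ⟨fun h => le_antisymm h hpos, fun h => h.le⟩

variable (M) in
lemma isClosed_boundary : IsClosed ((𝓡∂ d).boundary M) :=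
  ModelWithCorners.isClosed_boundary (n := ∞) (by simp)

/-- Changes of charts preserve the hyperplane of the vectors tangent to the boundary: along a line
in this hyperplane, the zeroth coordinate in the other chart is nonnegative, and it vanishes at the
boundary point, so its derivative is zero there. -/
lemma coordChange_apply_zero {p q x : M} (hp : x ∈ (chartAt (EuclideanHalfSpace d) p).source)
    (hq : x ∈ (chartAt (EuclideanHalfSpace d) q).source) (hx : x ∈ (𝓡∂ d).boundary M)
    {v : EuclideanSpace ℝ (Fin d)} (hv : v 0 = 0) : (tangentCoordChange (𝓡∂ d) p q x v) 0 = 0 := by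
  have hd := hasFDerivWithinAt_tangentCoordChange (I := 𝓡∂ d) (x := p) (y := q) (z := x)
    ⟨by rwa [extChartAt_source], by rwa [extChartAt_source]⟩
  have hx0 := (mem_boundary_iff hp).1 hx
  set z := extChartAt (𝓡∂ d) p x with hz
  have hline : HasDerivAt (fun t : ℝ => z + t • v) v 0 := by
    simpa using ((hasDerivAt_id (0 : ℝ)).smul_const v).const_add z
  have hmaps : MapsTo (fun t : ℝ => z + t • v) univ (range (𝓡∂ d)) := by
    intro t _
    rw [range_modelWithCornersEuclideanHalfSpace, mem_ofPred_eq]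
    simp [hx0, hv]
  have h1 : HasDerivWithinAt ((extChartAt (𝓡∂ d) q ∘ (extChartAt (𝓡∂ d) p).symm) ∘
      fun t : ℝ => z + t • v) (tangentCoordChange (𝓡∂ d) p q x v) univ 0 := by
    refine HasFDerivWithinAt.comp_hasDerivWithinAt (t := range (𝓡∂ d)) 0 ?_
      hline.hasDerivWithinAt hmaps
    simpa using hd
  have h2 := (EuclideanSpace.proj (0 : Fin d) :
    EuclideanSpace ℝ (Fin d) →L[ℝ] ℝ).hasFDerivAt.comp_hasDerivAt 0
      (hasDerivWithinAt_univ.1 h1)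
  refine IsLocalMin.hasDerivAt_eq_zero (Eventually.of_forall fun t => ?_) h2
  have h3 : extChartAt (𝓡∂ d) q ((extChartAt (𝓡∂ d) p).symm (z + (0 : ℝ) • v)) 0 = 0 := by
    rw [zero_smul, add_zero, hz, (extChartAt (𝓡∂ d) p).left_inv (by rwa [extChartAt_source])]
    exact (mem_boundary_iff hq).1 hx
  have h4 : 0 ≤ extChartAt (𝓡∂ d) q ((extChartAt (𝓡∂ d) p).symm (z + t • v)) 0 := by
    have : extChartAt (𝓡∂ d) q ((extChartAt (𝓡∂ d) p).symm (z + t • v)) ∈ range (𝓡∂ d) :=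
      mem_range_self _
    rwa [range_modelWithCornersEuclideanHalfSpace] at this
  exact h3.le.trans h4

lemma fwd_eq_coordChange {p x : M} (hx : x ∈ (chartAt (EuclideanHalfSpace d) p).source)
    (w : TangentSpace (𝓡∂ d) x) :
    fwd (𝓡∂ d) p x w = tangentCoordChange (𝓡∂ d) x p x (toModel w) := by
  rw [fwd, TangentBundle.continuousLinearMapAt_trivializationAt_eq_core hx]
  rfl

/-- Charts map the tangent space of the boundary to a fixed hyperplane. -/
lemma normalForm_eq_zero_iff {p x : M} (hp : x ∈ (chartAt (EuclideanHalfSpace d) p).source)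
    (hx : x ∈ (𝓡∂ d).boundary M) (w : TangentSpace (𝓡∂ d) x) :
    normalForm x w = 0 ↔ fwd (𝓡∂ d) p x w 0 = 0 := by
  rw [fwd_eq_coordChange hp]
  refine ⟨fun h => coordChange_apply_zero (mem_chart_source _ x) hp hx h, fun h => ?_⟩
  have h1 := coordChange_apply_zero hp (mem_chart_source _ x) hx h
  rw [tangentCoordChange_comp (by simpa [extChartAt_source] using hp),
    tangentCoordChange_self (by simp)] at h1
  exact h1

/-- The differential of a smooth function in the chart at `p`. -/
lemma hasFDerivWithinAt_comp_symm {f : M → ℝ} (hf : ContMDiff (𝓡∂ d) 𝓘(ℝ, ℝ) ∞ f) {p x : M}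
    (hx : x ∈ (chartAt (EuclideanHalfSpace d) p).source) :
    HasFDerivWithinAt (f ∘ (extChartAt (𝓡∂ d) p).symm) ((diffForm f x).comp (bwd (𝓡∂ d) p x))
      (range (𝓡∂ d)) (extChartAt (𝓡∂ d) p x) := by
  have h1 := hasMFDerivWithinAt_extChartAt_symm (I := 𝓡∂ d) hx
  have hz : (extChartAt (𝓡∂ d) p).symm (extChartAt (𝓡∂ d) p x) = x :=
    (extChartAt (𝓡∂ d) p).left_inv (by rwa [extChartAt_source])
  have h2 : HasMFDerivAt (𝓡∂ d) 𝓘(ℝ, ℝ) f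
      ((extChartAt (𝓡∂ d) p).symm (extChartAt (𝓡∂ d) p x)) (diffForm f x) := by
    rw [hz]
    exact ((hf x).mdifferentiableAt (by simp)).hasMFDerivAt
  exact (h2.comp_hasMFDerivWithinAt _ h1).hasFDerivWithinAt

/-- The chart representation of the differential of `f`. -/
noncomputable def chartForm (f : M → ℝ) (p : M) (z : EuclideanSpace ℝ (Fin d)) :
    EuclideanSpace ℝ (Fin d) →L[ℝ] ℝ :=
  fderivWithin ℝ (f ∘ (extChartAt (𝓡∂ d) p).symm) (range (𝓡∂ d)) z

lemma chartForm_apply {f : M → ℝ} (hf : ContMDiff (𝓡∂ d) 𝓘(ℝ, ℝ) ∞ f) {p x : M}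
    (hx : x ∈ (chartAt (EuclideanHalfSpace d) p).source) (v : EuclideanSpace ℝ (Fin d)) :
    chartForm f p (extChartAt (𝓡∂ d) p x) v = diffForm f x (bwd (𝓡∂ d) p x v) := by
  rw [chartForm, (hasFDerivWithinAt_comp_symm hf hx).fderivWithin
    ((𝓡∂ d).uniqueDiffOn _ (mem_range_self _))]
  rfl

lemma differentiableWithinAt_chartForm {f : M → ℝ} (hf : ContMDiff (𝓡∂ d) 𝓘(ℝ, ℝ) ∞ f) (p : M) :
    DifferentiableWithinAt ℝ (chartForm (d := d) f p) (range (𝓡∂ d)) (extChartAt (𝓡∂ d) p p) := by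
  have h1 : ContMDiffOn 𝓘(ℝ, EuclideanSpace ℝ (Fin d)) 𝓘(ℝ, ℝ) ∞
      (f ∘ (extChartAt (𝓡∂ d) p).symm) (extChartAt (𝓡∂ d) p).target :=
    hf.comp_contMDiffOn (contMDiffOn_extChartAt_symm p)
  have h2 : ContDiffWithinAt ℝ ∞ (f ∘ (extChartAt (𝓡∂ d) p).symm) (range (𝓡∂ d))
      (extChartAt (𝓡∂ d) p p) :=
    (h1.contDiffOn _ (mem_extChartAt_target p)).mono_of_mem_nhdsWithin
      (extChartAt_target_mem_nhdsWithin p)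
  exact (h2.fderivWithin_right (m := 1) (𝓡∂ d).uniqueDiffOn (WithTop.coe_le_coe.2 le_top)
    (mem_range_self _)).differentiableWithinAt one_ne_zero

end Chart

/-! ### The weight as a norm of the differential -/

section Weight

variable {d : ℕ} [NeZero d] {M : Type*} [EMetricSpace M] [ChartedSpace (EuclideanHalfSpace d) M]
  [RiemannianBundle (fun x : M => TangentSpace (𝓡∂ d) x)]

lemma inner_dualVector {x : M} (l : TangentSpace (𝓡∂ d) x →L[ℝ] ℝ) (w : TangentSpace (𝓡∂ d) x) :
    inner ℝ (dualVector l) w = l w := by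
  have : FiniteDimensional ℝ (TangentSpace (𝓡∂ d) x) :=
    inferInstanceAs (FiniteDimensional ℝ (EuclideanSpace ℝ (Fin d)))
  have : CompleteSpace (TangentSpace (𝓡∂ d) x) :=
    FiniteDimensional.complete ℝ (TangentSpace (𝓡∂ d) x)
  exact InnerProductSpace.toDual_symm_apply

lemma inner_grad (f : M → ℝ) (x : M) (w : TangentSpace (𝓡∂ d) x) :
    inner ℝ (grad f x) w = diffForm f x w :=
  inner_dualVector _ w

lemma dualVector_normalForm_ne_zero (x : M) : dualVector (normalForm (d := d) x) ≠ 0 := by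
  intro h
  obtain ⟨w, hw⟩ : ∃ w : TangentSpace (𝓡∂ d) x, normalForm x w = 1 :=
    ⟨(EuclideanSpace.single 0 1 : EuclideanSpace ℝ (Fin d)), by
      show (EuclideanSpace.single (0 : Fin d) (1 : ℝ) : EuclideanSpace ℝ (Fin d)) 0 = 1; simp⟩
  have h1 := inner_dualVector (normalForm (d := d) x) w
  rw [h, inner_zero_left, hw] at h1
  exact zero_ne_one h1

lemma inner_outwardNormal_self (x : M) :
    inner ℝ (outwardNormal (d := d) x) (outwardNormal x) = (1 : ℝ) := by
  have h : ‖dualVector (normalForm (d := d) x)‖ ≠ 0 :=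
    norm_ne_zero_iff.2 (dualVector_normalForm_ne_zero x)
  rw [real_inner_self_eq_norm_sq, outwardNormal, norm_neg, norm_smul, norm_inv, norm_norm,
    inv_mul_cancel₀ h, one_pow]

lemma inner_outwardNormal {x : M} {w : TangentSpace (𝓡∂ d) x} (hw : normalForm x w = 0) :
    inner ℝ (outwardNormal x) w = (0 : ℝ) := by
  have h := inner_dualVector (normalForm (d := d) x) w
  rw [hw] at h
  have h' : inner ℝ (outwardNormal x) w =
      -((‖dualVector (normalForm (d := d) x)‖)⁻¹ *
        inner ℝ (dualVector (normalForm (d := d) x)) w) :=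
    (inner_neg_left _ _).trans (congrArg Neg.neg (real_inner_smul_left _ _ _))
  rw [h', h, mul_zero, neg_zero]

lemma inner_tangGrad_outwardNormal (f : M → ℝ) (x : M) :
    inner ℝ (tangGrad (d := d) f x) (outwardNormal x) = (0 : ℝ) := by
  rw [tangGrad, inner_sub_left, inner_smul_left, inner_outwardNormal_self, normalDeriv]; simp

lemma normalForm_tangGrad (f : M → ℝ) (x : M) : normalForm x (tangGrad (d := d) f x) = 0 := by
  have h := inner_tangGrad_outwardNormal (d := d) f x
  rw [outwardNormal, inner_neg_right, inner_smul_right, real_inner_comm, inner_dualVector,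
    neg_eq_zero, mul_eq_zero] at h
  exact h.resolve_left (inv_ne_zero (norm_ne_zero_iff.2 (dualVector_normalForm_ne_zero x)))

lemma inner_tangGrad {f : M → ℝ} {x : M} {w : TangentSpace (𝓡∂ d) x} (hw : normalForm x w = 0) :
    inner ℝ (tangGrad f x) w = diffForm f x w := by
  rw [tangGrad, inner_sub_left, inner_smul_left, inner_outwardNormal hw, inner_grad]; simp

lemma norm_grad_sq (f : M → ℝ) (x : M) :
    ‖grad (d := d) f x‖ ^ 2 = ‖tangGrad (d := d) f x‖ ^ 2 + normalDeriv d f x ^ 2 := by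
  have h : grad (d := d) f x = tangGrad f x + normalDeriv d f x • outwardNormal x := by
    rw [tangGrad]; abel
  have h' : inner ℝ (tangGrad (d := d) f x) (normalDeriv d f x • outwardNormal x) = (0 : ℝ) := by
    rw [inner_smul_right, inner_tangGrad_outwardNormal, mul_zero]
  have h1 : ‖outwardNormal (d := d) x‖ ^ 2 = 1 := by
    rw [← real_inner_self_eq_norm_sq, inner_outwardNormal_self]
  rw [h, norm_add_sq_real, h', norm_smul, mul_pow, h1, Real.norm_eq_abs, sq_abs]
  ring

lemma abs_diffForm_le (f : M → ℝ) {x : M} {w : TangentSpace (𝓡∂ d) x}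
    (hw : w ∈ stratumVectors x) : |diffForm f x w| ≤ weight d f x * ‖w‖ := by
  rw [weight]
  split_ifs with hx
  · rw [← inner_tangGrad (hw hx)]; exact abs_real_inner_le_norm _ _
  · rw [← inner_grad]; exact abs_real_inner_le_norm _ _

/-- The weight is the norm of the differential on the stratum, and it is attained. -/
lemma exists_diffForm_eq (f : M → ℝ) (x : M) : ∃ w ∈ stratumVectors (d := d) x,
    ‖w‖ = weight d f x ∧ diffForm f x w = weight d f x * ‖w‖ := by
  by_cases hx : x ∈ (𝓡∂ d).boundary M
  · refine ⟨tangGrad f x, fun _ => normalForm_tangGrad f x, by rw [weight, if_pos hx], ?_⟩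
    rw [← inner_tangGrad (normalForm_tangGrad f x), weight, if_pos hx, real_inner_self_eq_norm_sq,
      sq]
  · refine ⟨grad f x, fun h => absurd h hx, by rw [weight, if_neg hx], ?_⟩
    rw [← inner_grad, weight, if_neg hx, real_inner_self_eq_norm_sq, sq]

lemma weight_nonneg (f : M → ℝ) (x : M) : 0 ≤ weight d f x := by
  rw [weight]; split_ifs <;> exact norm_nonneg _

lemma weight_le_of_forall {f : M → ℝ} {x : M} {C : ℝ} (hC : 0 ≤ C)
    (h : ∀ w ∈ stratumVectors (d := d) x, |diffForm f x w| ≤ C * ‖w‖) : weight d f x ≤ C := by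
  obtain ⟨w, hw, hn, he⟩ := exists_diffForm_eq (d := d) f x
  have := h w hw
  rw [he, abs_of_nonneg (mul_nonneg (weight_nonneg f x) (norm_nonneg _)), hn] at this
  by_contra! hlt
  nlinarith

lemma weight_lt_norm_grad {f : M → ℝ} (h3 : H3 d f) {p : M} (hp : p ∈ (𝓡∂ d).boundary M) :
    weight d f p < ‖grad (d := d) f p‖ := by
  rw [weight, if_pos hp]
  have := norm_grad_sq (d := d) f p
  have h := h3 p hp
  nlinarith [norm_nonneg (grad (d := d) f p), norm_nonneg (tangGrad (d := d) f p)]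

end Weight

/-! ### Estimates of the weight in a chart -/

lemma exists_norm_le_of_nondegenerate_comp {E F : Type*} [NormedAddCommGroup E] [NormedSpace ℝ E]
    [NormedAddCommGroup F] [NormedSpace ℝ F] [FiniteDimensional ℝ F] (H : E →L[ℝ] E →L[ℝ] ℝ)
    (ι : F →L[ℝ] E) (hH : ∀ v, (∀ w, H (ι v) (ι w) = 0) → v = 0) :
    ∃ K : ℝ, 0 < K ∧ ∀ v, ∀ C : ℝ, 0 ≤ C → (∀ w, |H (ι v) (ι w)| ≤ C * ‖w‖) → ‖v‖ ≤ K * C := by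
  let T : F →L[ℝ] (F →L[ℝ] ℝ) :=
    ((ContinuousLinearMap.compL ℝ F E ℝ).flip ι).comp (H.comp ι)
  have hT : ∀ v, T v = 0 → v = 0 := fun v hv => hH v fun w => by
    have : T v w = 0 := by rw [hv]; rfl
    exact this
  obtain ⟨K, hK, hTK⟩ := LinearMap.exists_antilipschitzWith (T : F →ₗ[ℝ] (F →L[ℝ] ℝ))
    (LinearMap.ker_eq_bot'.2 hT)
  refine ⟨K, hK, fun v C hC hvw => ?_⟩
  have h1 := hTK.le_mul_dist v 0
  rw [map_zero, dist_zero_right, dist_zero_right] at h1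
  refine h1.trans (mul_le_mul_of_nonneg_left ?_ K.coe_nonneg)
  exact ContinuousLinearMap.opNorm_le_bound (T v) hC hvw

/-- In finite dimension, a bilinear form that is nondegenerate on a subspace is bounded below there:
`v` is controlled by the norm of `w ↦ H v w`. -/
lemma exists_norm_le_of_nondegenerate {E : Type*} [NormedAddCommGroup E] [NormedSpace ℝ E]
    [FiniteDimensional ℝ E] (H : E →L[ℝ] E →L[ℝ] ℝ) (W : Submodule ℝ E)
    (hH : ∀ v ∈ W, (∀ w ∈ W, H v w = 0) → v = 0) :
    ∃ K : ℝ, 0 < K ∧ ∀ v ∈ W, ∀ C : ℝ, 0 ≤ C → (∀ w ∈ W, |H v w| ≤ C * ‖w‖) → ‖v‖ ≤ K * C := by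
  obtain ⟨K, hK, h⟩ := exists_norm_le_of_nondegenerate_comp H W.subtypeL fun v hv =>
    Subtype.ext (hH v v.2 fun w hw => hv ⟨w, hw⟩)
  exact ⟨K, hK, fun v hv C hC hvw => h ⟨v, hv⟩ C hC fun w => hvw w w.2⟩

section Estimates

variable {d : ℕ} [NeZero d] {M : Type*} [EMetricSpace M] [ChartedSpace (EuclideanHalfSpace d) M]

/-- The directions, in the chart at `p`, of the stratum of `p`: all of them at an interior point,
those of the hyperplane that contains the image of the boundary at a boundary point. -/
def stratumModel (p : M) : Submodule ℝ (EuclideanSpace ℝ (Fin d)) where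
  carrier := {v | p ∈ (𝓡∂ d).boundary M → v 0 = 0}
  add_mem' := fun hv hw hp => by simp [hv hp, hw hp]
  zero_mem' := fun _ => rfl
  smul_mem' := fun c v hv hp => by simp [hv hp]

/-- The stratum of `p`: the boundary if `p` is a boundary point, and otherwise the whole space,
which near `p` agrees with the interior. -/
def stratum (d : ℕ) [NeZero d] {M : Type*} [EMetricSpace M] [ChartedSpace (EuclideanHalfSpace d) M]
    (p : M) : Set M :=
  {x | p ∈ (𝓡∂ d).boundary M → x ∈ (𝓡∂ d).boundary M}

variable [IsManifold (𝓡∂ d) ∞ M]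

lemma isClosed_stratum (p : M) : IsClosed (stratum d p) := by
  by_cases hp : p ∈ (𝓡∂ d).boundary M
  · simpa [stratum, hp] using isClosed_boundary (d := d) M
  · simp [stratum, hp]

lemma eventually_mem_boundary (p : M) :
    ∀ᶠ x in 𝓝 p, x ∈ (𝓡∂ d).boundary M → p ∈ (𝓡∂ d).boundary M := by
  by_cases hp : p ∈ (𝓡∂ d).boundary M
  · exact Eventually.of_forall fun _ _ => hp
  · filter_upwards [(isClosed_boundary (d := d) M).isOpen_compl.mem_nhds hp] with x hx h
    exact absurd h hx

lemma bwd_mem_stratumVectors {p x : M} (hx : x ∈ (chartAt (EuclideanHalfSpace d) p).source)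
    (hp : x ∈ (𝓡∂ d).boundary M → p ∈ (𝓡∂ d).boundary M) {v : EuclideanSpace ℝ (Fin d)}
    (hv : v ∈ stratumModel p) : bwd (𝓡∂ d) p x v ∈ stratumVectors x := by
  intro hxb
  rw [normalForm_eq_zero_iff hx hxb, fwd_bwd hx]
  exact hv (hp hxb)

lemma fwd_mem_stratumModel {p x : M} (hx : x ∈ (chartAt (EuclideanHalfSpace d) p).source)
    (hp : x ∈ stratum d p) {w : TangentSpace (𝓡∂ d) x}
    (hw : w ∈ stratumVectors x) : fwd (𝓡∂ d) p x w ∈ stratumModel p :=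
  fun h => (normalForm_eq_zero_iff hx (hp h) w).1 (hw (hp h))

lemma sub_mem_stratumModel {p x y : M} (hx : x ∈ (chartAt (EuclideanHalfSpace d) p).source)
    (hy : y ∈ (chartAt (EuclideanHalfSpace d) p).source) (hxp : x ∈ stratum d p)
    (hyp : y ∈ stratum d p) :
    extChartAt (𝓡∂ d) p x - extChartAt (𝓡∂ d) p y ∈ stratumModel p := by
  intro h
  have h1 := (mem_boundary_iff hx).1 (hxp h)
  have h2 := (mem_boundary_iff hy).1 (hyp h)
  rw [PiLp.sub_apply, h1, h2, sub_zero]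

lemma tendsto_chartForm {f : M → ℝ} (hf : ContMDiff (𝓡∂ d) 𝓘(ℝ, ℝ) ∞ f) (p : M) :
    Tendsto (fun x => chartForm (d := d) f p (extChartAt (𝓡∂ d) p x)) (𝓝 p)
      (𝓝 (chartForm f p (extChartAt (𝓡∂ d) p p))) := by
  refine (differentiableWithinAt_chartForm hf p).continuousWithinAt.tendsto.comp ?_
  exact tendsto_nhdsWithin_iff.2 ⟨continuousAt_extChartAt p,
    Eventually.of_forall fun x => mem_range_self _⟩

variable [RiemannianBundle (fun x : M => TangentSpace (𝓡∂ d) x)] {f : M → ℝ}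

lemma abs_chartForm_le (hf : ContMDiff (𝓡∂ d) 𝓘(ℝ, ℝ) ∞ f) {p x : M} {r : ℝ}
    (hx : x ∈ (chartAt (EuclideanHalfSpace d) p).source) {v : EuclideanSpace ℝ (Fin d)}
    (hr : ‖bwd (𝓡∂ d) p x v‖ ≤ r * ‖bwd (𝓡∂ d) p p v‖)
    (hv : bwd (𝓡∂ d) p x v ∈ stratumVectors x) :
    |chartForm f p (extChartAt (𝓡∂ d) p x) v| ≤ weight d f x * (r * ‖bwd (𝓡∂ d) p p v‖) := by
  rw [chartForm_apply hf hx]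
  exact (abs_diffForm_le f hv).trans (mul_le_mul_of_nonneg_left hr (weight_nonneg f x))

lemma weight_le_of_chartForm_le (hf : ContMDiff (𝓡∂ d) 𝓘(ℝ, ℝ) ∞ f) {p x : M} {c r : ℝ}
    (hc : 0 ≤ c) (hr0 : 0 ≤ r)
    (hx : x ∈ (chartAt (EuclideanHalfSpace d) p).source)
    (hr : ∀ w : TangentSpace (𝓡∂ d) x, ‖bwd (𝓡∂ d) p p (fwd (𝓡∂ d) p x w)‖ ≤ r * ‖w‖)
    (h : ∀ w ∈ stratumVectors (d := d) x, |chartForm f p (extChartAt (𝓡∂ d) p x)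
      (fwd (𝓡∂ d) p x w)| ≤ c * ‖bwd (𝓡∂ d) p p (fwd (𝓡∂ d) p x w)‖) :
    weight d f x ≤ c * r := by
  refine weight_le_of_forall (mul_nonneg hc hr0) fun w hw => ?_
  have h1 := h w hw
  rw [chartForm_apply hf hx, bwd_fwd hx] at h1
  rw [mul_assoc]
  exact h1.trans (mul_le_mul_of_nonneg_left (hr w) hc)

/-- The scalar product at `p` is equivalent to the one of the model space. -/
lemma exists_norm_le_norm_bwd (p : M) : ∃ A : ℝ, 0 < A ∧ ∀ v : EuclideanSpace ℝ (Fin d),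
    ‖v‖ ≤ A * ‖bwd (𝓡∂ d) p p v‖ ∧ ‖bwd (𝓡∂ d) p p v‖ ≤ A * ‖v‖ := by
  refine ⟨max 1 (max ‖fwd (𝓡∂ d) p p‖ ‖bwd (𝓡∂ d) p p‖), zero_lt_one.trans_le (le_max_left _ _),
    fun v => ⟨?_, ?_⟩⟩
  · have h := (fwd (𝓡∂ d) p p).le_opNorm (bwd (𝓡∂ d) p p v)
    rw [fwd_bwd (mem_chart_source _ p)] at h
    refine h.trans (mul_le_mul_of_nonneg_right ?_ (norm_nonneg _))
    exact (le_max_left _ _).trans (le_max_right _ _)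
  · refine ((bwd (𝓡∂ d) p p).le_opNorm v).trans (mul_le_mul_of_nonneg_right ?_ (norm_nonneg _))
    exact (le_max_right _ _).trans (le_max_right _ _)

variable [IsContinuousRiemannianBundle (EuclideanSpace ℝ (Fin d))
      (fun x : M => TangentSpace (𝓡∂ d) x)]

/-- Near `p`, the weight is bounded below by what the differential at `p` gives on a vector `w`,
as long as the vector remains tangent to the strata. -/
lemma eventually_lt_weight_of_lt (hf : ContMDiff (𝓡∂ d) 𝓘(ℝ, ℝ) ∞ f) {p : M} {m : ℝ}
    {w : TangentSpace (𝓡∂ d) p} (hw : m * ‖w‖ < diffForm f p w) :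
    ∀ᶠ x in 𝓝 p, bwd (𝓡∂ d) p x (fwd (𝓡∂ d) p p w) ∈ stratumVectors x → m < weight d f x := by
  have hw0 : 0 < ‖w‖ := by
    rw [norm_pos_iff]
    rintro rfl
    simp at hw
  obtain ⟨r, hr1, hr⟩ : ∃ r : ℝ, 1 < r ∧ m * (r * ‖w‖) < diffForm f p w := by
    have h1 : Tendsto (fun r : ℝ => m * (r * ‖w‖)) (𝓝[>] 1) (𝓝 (m * (1 * ‖w‖))) :=
      ((continuous_id.mul continuous_const).const_mul m).continuousAt.tendsto.mono_left
        nhdsWithin_le_nhds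
    rw [one_mul] at h1
    obtain ⟨r, h2, h3⟩ := ((h1.eventually (gt_mem_nhds hw)).and self_mem_nhdsWithin).exists
    exact ⟨r, h3, h2⟩
  have hb : bwd (𝓡∂ d) p p (fwd (𝓡∂ d) p p w) = w := bwd_fwd (mem_chart_source _ p) w
  have ht : Tendsto (fun x => chartForm f p (extChartAt (𝓡∂ d) p x) (fwd (𝓡∂ d) p p w)) (𝓝 p)
      (𝓝 (diffForm f p w)) := by
    have h := ((ContinuousLinearMap.apply ℝ ℝ (fwd (𝓡∂ d) p p w)).continuous.tendsto _).comp
      (tendsto_chartForm hf p)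
    rw [ContinuousLinearMap.apply_apply, chartForm_apply hf (mem_chart_source _ p), hb] at h
    exact h
  filter_upwards [ht.eventually (lt_mem_nhds hr), chart_source_mem_nhds (EuclideanHalfSpace d) p,
    eventually_norm_bwd_le (I := 𝓡∂ d) p hr1] with x h1 hx h2 hv
  have h3 := abs_chartForm_le hf hx (h2.1 _) hv
  rw [hb] at h3
  have h4 := h1.trans_le ((le_abs_self _).trans h3)
  exact lt_of_mul_lt_mul_right h4 (by positivity)

/-- The weight is lower semicontinuous. -/
lemma eventually_lt_weight (hf : ContMDiff (𝓡∂ d) 𝓘(ℝ, ℝ) ∞ f) {p : M} {m : ℝ}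
    (hm : m < weight d f p) : ∀ᶠ x in 𝓝 p, m < weight d f x := by
  obtain hm0 | hm0 := lt_or_ge m 0
  · exact Eventually.of_forall fun x => hm0.trans_le (weight_nonneg f x)
  obtain ⟨w, hw, hn, he⟩ := exists_diffForm_eq (d := d) f p
  have hlt : m * ‖w‖ < diffForm f p w := by
    rw [he, hn]
    exact mul_lt_mul_of_pos_right hm (hm0.trans_lt hm)
  filter_upwards [eventually_lt_weight_of_lt hf hlt, eventually_mem_boundary (d := d) p,
    chart_source_mem_nhds (EuclideanHalfSpace d) p] with x h1 h2 hx
  exact h1 (bwd_mem_stratumVectors hx h2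
    (fwd_mem_stratumModel (mem_chart_source _ p) (fun h => h) hw))

/-- Near a boundary point `p`, the weight at interior points is bounded below by the norm of the
whole gradient at `p`. -/
lemma eventually_lt_weight_of_notMem_boundary (hf : ContMDiff (𝓡∂ d) 𝓘(ℝ, ℝ) ∞ f) {p : M} {m : ℝ}
    (hm0 : 0 ≤ m) (hm : m < ‖grad (d := d) f p‖) :
    ∀ᶠ x in 𝓝 p, x ∉ (𝓡∂ d).boundary M → m < weight d f x := by
  have hlt : m * ‖grad (d := d) f p‖ < diffForm f p (grad (d := d) f p) := by
    rw [← inner_grad, real_inner_self_eq_norm_sq, sq]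
    exact mul_lt_mul_of_pos_right hm (hm0.trans_lt hm)
  filter_upwards [eventually_lt_weight_of_lt hf hlt] with x h1 hx
  exact h1 fun h => absurd h hx

/-- On the stratum of `p`, the weight is upper semicontinuous at `p`. -/
lemma eventually_weight_lt (hf : ContMDiff (𝓡∂ d) 𝓘(ℝ, ℝ) ∞ f) {p : M} {m : ℝ}
    (hm : weight d f p < m) : ∀ᶠ x in 𝓝 p, x ∈ stratum d p → weight d f x < m := by
  obtain ⟨A, hA, hAv⟩ := exists_norm_le_norm_bwd (d := d) p
  obtain ⟨ε, hε, hεm⟩ : ∃ ε : ℝ, 0 < ε ∧ (weight d f p + ε * A) * (1 + ε) < m := by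
    have h1 : Tendsto (fun ε : ℝ => (weight d f p + ε * A) * (1 + ε)) (𝓝[>] 0)
        (𝓝 ((weight d f p + 0 * A) * (1 + 0))) :=
      (by fun_prop : Continuous fun ε : ℝ =>
        (weight d f p + ε * A) * (1 + ε)).continuousAt.tendsto.mono_left nhdsWithin_le_nhds
    rw [zero_mul, add_zero, add_zero, mul_one] at h1
    obtain ⟨ε, h2, h3⟩ := ((h1.eventually (gt_mem_nhds hm)).and self_mem_nhdsWithin).exists
    exact ⟨ε, h3, h2⟩
  filter_upwards [Metric.tendsto_nhds.1 (tendsto_chartForm hf p) ε hε,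
    chart_source_mem_nhds (EuclideanHalfSpace d) p,
    eventually_norm_bwd_le (I := 𝓡∂ d) p (lt_add_of_pos_right 1 hε)] with x h1 hx h2 hxp
  refine (weight_le_of_chartForm_le hf (c := weight d f p + ε * A) (r := 1 + ε)
    (by have := weight_nonneg (d := d) f p; positivity) (by positivity) hx h2.2
    fun w hw => ?_).trans_lt hεm
  set v := fwd (𝓡∂ d) p x w
  have hv : v ∈ stratumModel p := fwd_mem_stratumModel hx hxp hw
  have h3 := abs_chartForm_le hf (mem_chart_source _ p) (one_mul ‖bwd (𝓡∂ d) p p v‖).ge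
    (bwd_mem_stratumVectors (mem_chart_source _ p) (fun h => h) hv)
  have h4 := (chartForm f p (extChartAt (𝓡∂ d) p x) -
    chartForm f p (extChartAt (𝓡∂ d) p p)).le_opNorm v
  rw [dist_eq_norm] at h1
  have h5 : |chartForm f p (extChartAt (𝓡∂ d) p x) v| ≤
      |chartForm f p (extChartAt (𝓡∂ d) p p) v| +
        ‖(chartForm f p (extChartAt (𝓡∂ d) p x) - chartForm f p (extChartAt (𝓡∂ d) p p)) v‖ := by
    rw [sub_apply, Real.norm_eq_abs]
    have := abs_add_le (chartForm f p (extChartAt (𝓡∂ d) p p) v)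
      (chartForm f p (extChartAt (𝓡∂ d) p x) v - chartForm f p (extChartAt (𝓡∂ d) p p) v)
    rwa [add_sub_cancel] at this
  have h6 : ‖chartForm f p (extChartAt (𝓡∂ d) p x) - chartForm f p (extChartAt (𝓡∂ d) p p)‖ * ‖v‖ ≤
      ε * (A * ‖bwd (𝓡∂ d) p p v‖) :=
    mul_le_mul h1.le (hAv v).1 (norm_nonneg _) hε.le
  rw [one_mul] at h3
  linarith

lemma exists_eventually_weight_le (hf : ContMDiff (𝓡∂ d) 𝓘(ℝ, ℝ) ∞ f) (p : M) :
    ∃ C : ℝ, ∀ᶠ x in 𝓝 p, weight d f x ≤ C := by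
  obtain ⟨A, hA, hAv⟩ := exists_norm_le_norm_bwd (d := d) p
  refine ⟨(‖chartForm (d := d) f p (extChartAt (𝓡∂ d) p p)‖ + 1) * A * 2, ?_⟩
  filter_upwards [(tendsto_chartForm hf p).norm.eventually (gt_mem_nhds (lt_add_one _)),
    chart_source_mem_nhds (EuclideanHalfSpace d) p,
    eventually_norm_bwd_le (I := 𝓡∂ d) p one_lt_two] with x h1 hx h2
  refine weight_le_of_chartForm_le hf (by positivity) two_pos.le hx h2.2 fun w _ => ?_
  rw [← Real.norm_eq_abs]
  refine (ContinuousLinearMap.le_opNorm _ _).trans ?_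
  rw [mul_assoc]
  exact mul_le_mul h1.le (hAv _).1 (norm_nonneg _) (by positivity)

/-- Near a zero of the weight, the weight is comparable, on the stratum of this zero, with the
distance to the zero. This is where nondegeneracy is used. -/
lemma exists_eventually_weight_comparable (hf : ContMDiff (𝓡∂ d) 𝓘(ℝ, ℝ) ∞ f) (h1 : H1 d f) {p : M}
    (hp : weight d f p = 0) : ∃ c C : ℝ, 0 < c ∧ 0 < C ∧ ∀ᶠ x in 𝓝 p, x ∈ stratum d p →
      c * ‖extChartAt (𝓡∂ d) p x - extChartAt (𝓡∂ d) p p‖ ≤ weight d f x ∧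
      weight d f x ≤ C * ‖extChartAt (𝓡∂ d) p x - extChartAt (𝓡∂ d) p p‖ := by
  obtain ⟨A, hA, hAv⟩ := exists_norm_le_norm_bwd (d := d) p
  set φ := extChartAt (𝓡∂ d) p with hφ
  set G := chartForm (d := d) f p with hG
  set H := fderivWithin ℝ G (range (𝓡∂ d)) (φ p) with hH
  have hpp := mem_chart_source (EuclideanHalfSpace d) p
  -- the differential at `p` vanishes on the stratum, and its derivative is nondegenerate there
  have hG0 : ∀ v ∈ stratumModel (d := d) p, G (φ p) v = 0 := fun v hv => by
    have h := abs_chartForm_le hf hpp (one_mul ‖bwd (𝓡∂ d) p p v‖).ge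
      (bwd_mem_stratumVectors hpp (fun h => h) hv)
    rw [hp, zero_mul] at h
    exact abs_eq_zero.1 (le_antisymm h (abs_nonneg _))
  have hH0 : ∀ v ∈ stratumModel (d := d) p, (∀ w ∈ stratumModel (d := d) p, H v w = 0) → v = 0 := by
    intro v hv hvw
    rw [weight] at hp
    split_ifs at hp with hb
    · exact h1.morse_boundary p hb (norm_eq_zero.1 hp) v (hv hb) fun w hw => hvw w fun _ => hw
    · refine h1.morse_interior p ?_ (norm_eq_zero.1 hp) v fun w => hvw w fun h => absurd h hb
      rwa [← ModelWithCorners.compl_boundary]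
  obtain ⟨K, hK, hHK⟩ := exists_norm_le_of_nondegenerate H (stratumModel (d := d) p) hH0
  set ε : ℝ := (2 * K)⁻¹ with hε
  have hε0 : 0 < ε := by positivity
  have hder : ∀ᶠ x in 𝓝 p, ‖G (φ x) - G (φ p) - H (φ x - φ p)‖ ≤ ε * ‖φ x - φ p‖ := by
    have h := (differentiableWithinAt_chartForm hf p).hasFDerivWithinAt.isLittleO.def hε0
    have ht : Tendsto φ (𝓝 p) (𝓝[range (𝓡∂ d)] (φ p)) := tendsto_nhdsWithin_iff.2
      ⟨continuousAt_extChartAt p, Eventually.of_forall fun x => mem_range_self _⟩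
    exact ht.eventually h
  refine ⟨ε / (2 * A), (‖H‖ + ε) * A * 2, by positivity, by positivity, ?_⟩
  filter_upwards [hder, chart_source_mem_nhds (EuclideanHalfSpace d) p,
    eventually_norm_bwd_le (I := 𝓡∂ d) p one_lt_two, eventually_mem_boundary (d := d) p]
    with x hd hx hr hb hxp
  set y := φ x - φ p with hy
  have hyW : y ∈ stratumModel (d := d) p := sub_mem_stratumModel hx hpp hxp fun h => h
  have hlin : ∀ v ∈ stratumModel (d := d) p, |G (φ x) v - H y v| ≤ ε * ‖y‖ * ‖v‖ := by
    intro v hv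
    have h := (G (φ x) - G (φ p) - H y).le_of_opNorm_le hd v
    rwa [sub_apply, sub_apply, hG0 v hv, sub_zero, Real.norm_eq_abs] at h
  constructor
  · have h9 : ‖y‖ ≤ K * (ε * ‖y‖ + weight d f x * (2 * A)) := by
      refine hHK y hyW _
        (add_nonneg (by positivity) (mul_nonneg (weight_nonneg f x) (by positivity))) fun v hv => ?_
      have h3 := hlin v hv
      have h4 := abs_chartForm_le hf hx (hr.1 v) (bwd_mem_stratumVectors hx hb hv)
      have h5 : weight d f x * (2 * ‖bwd (𝓡∂ d) p p v‖) ≤ weight d f x * (2 * (A * ‖v‖)) :=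
        mul_le_mul_of_nonneg_left (mul_le_mul_of_nonneg_left (hAv v).2 two_pos.le)
          (weight_nonneg f x)
      have h6 : |H y v| ≤ |G (φ x) v - H y v| + |G (φ x) v| := by
        have := abs_sub_abs_le_abs_sub (H y v) (G (φ x) v)
        rw [abs_sub_comm] at this
        linarith
      linarith
    have h10 : (K : ℝ) * ε = 1 / 2 := by rw [hε]; field_simp
    have h11 : ‖y‖ ≤ 1 / 2 * ‖y‖ + K * (weight d f x * (2 * A)) := by
      calc ‖y‖ ≤ K * (ε * ‖y‖ + weight d f x * (2 * A)) := h9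
        _ = K * ε * ‖y‖ + K * (weight d f x * (2 * A)) := by ring
        _ = _ := by rw [h10]
    rw [div_mul_eq_mul_div, div_le_iff₀ (by positivity), hε, inv_mul_le_iff₀ (by positivity)]
    linarith
  · refine (weight_le_of_chartForm_le hf (c := (‖H‖ + ε) * A * ‖y‖) (by positivity) two_pos.le hx
      hr.2 fun w hw => ?_).trans_eq (by ring)
    set v := fwd (𝓡∂ d) p x w
    have hv : v ∈ stratumModel p := fwd_mem_stratumModel hx hxp hw
    have h2 := hlin v hv
    have h3 : |H y v| ≤ ‖H‖ * ‖y‖ * ‖v‖ := H.le_opNorm₂ y v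
    have h4 : |G (φ x) v| ≤ |G (φ x) v - H y v| + |H y v| := by
      have := abs_sub_abs_le_abs_sub (G (φ x) v) (H y v)
      linarith
    have h5 : (‖H‖ + ε) * ‖y‖ * ‖v‖ ≤ (‖H‖ + ε) * ‖y‖ * (A * ‖bwd (𝓡∂ d) p p v‖) :=
      mul_le_mul_of_nonneg_left (hAv v).1 (by positivity)
    calc |G (φ x) v| ≤ (‖H‖ + ε) * ‖y‖ * ‖v‖ := by linarith
      _ ≤ _ := h5
      _ = _ := by ring

end Estimates

/-! ### Existence of a minimizing curve and its visits to the boundary -/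

section Minimizer

variable {d : ℕ} [NeZero d] {M : Type*} [EMetricSpace M] [ChartedSpace (EuclideanHalfSpace d) M]
  [RiemannianBundle (fun x : M => TangentSpace (𝓡∂ d) x)]

/-- The weight, with values in `[0, ∞]`. -/
noncomputable def eweight (d : ℕ) [NeZero d] {M : Type*} [EMetricSpace M]
    [ChartedSpace (EuclideanHalfSpace d) M]
    [RiemannianBundle (fun x : M => TangentSpace (𝓡∂ d) x)] (f : M → ℝ) (x : M) : ℝ≥0∞ :=
  ENNReal.ofReal (weight d f x)

variable [IsManifold (𝓡∂ d) ∞ M]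

/-- Two points of the stratum of `p` that are close to `p` are joined, within this stratum, by the
curve that is a segment in the chart at `p`. -/
lemma exists_segment {p : M} {r : ℝ≥0} {N U : Set M} {s : Set (EuclideanSpace ℝ (Fin d))}
    (h : IsChartBall (𝓡∂ d) p r N U s) {a b : M} (ha : a ∈ U) (hb : b ∈ U)
    (has : a ∈ stratum d p) (hbs : b ∈ stratum d p) :
    ∃ (β : ℝ → M) (K : ℝ≥0), LipschitzOnWith K β (Icc 0 1) ∧ (K : ℝ≥0∞) ≤ r * (r * edist a b) ∧
      β 0 = a ∧ β 1 = b ∧ ∀ t ∈ Icc (0 : ℝ) 1, β t ∈ N ∧ β t ∈ stratum d p ∧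
        extChartAt (𝓡∂ d) p (β t) ∈ segment ℝ (extChartAt (𝓡∂ d) p a) (extChartAt (𝓡∂ d) p b) := by
  set φ := extChartAt (𝓡∂ d) p
  have hmem : ∀ t ∈ Icc (0 : ℝ) 1, AffineMap.lineMap (φ a) (φ b) t ∈ segment ℝ (φ a) (φ b) := by
    intro t ht
    rw [segment_eq_image_lineMap]
    exact mem_image_of_mem _ ht
  have hs : ∀ t ∈ Icc (0 : ℝ) 1, AffineMap.lineMap (φ a) (φ b) t ∈ s := fun t ht =>
    h.convex.segment_subset (h.mapsTo ha) (h.mapsTo hb) (hmem t ht)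
  refine ⟨_, _, h.lipschitzOnWith_segment (h.mapsTo ha) (h.mapsTo hb), ?_, ?_, ?_, fun t ht => ?_⟩
  · rw [ENNReal.coe_mul]
    exact mul_le_mul' le_rfl (h.enorm_sub_le a ha b hb)
  · simpa using h.symm_apply ha
  · simpa using h.symm_apply hb
  · have hφ : φ (φ.symm (AffineMap.lineMap (φ a) (φ b) t)) = AffineMap.lineMap (φ a) (φ b) t :=
      φ.right_inv (h.target (hs t ht))
    refine ⟨h.mapsTo_symm (hs t ht), fun hp => ?_, by rw [hφ]; exact hmem t ht⟩
    have hsrc := φ.map_target (h.target (hs t ht))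
    rw [extChartAt_source] at hsrc
    have ha0 := (mem_boundary_iff (h.source ha)).1 (has hp)
    have hb0 := (mem_boundary_iff (h.source hb)).1 (hbs hp)
    rw [mem_boundary_iff hsrc]
    change φ (φ.symm (AffineMap.lineMap (φ a) (φ b) t)) 0 = 0
    rw [hφ, AffineMap.lineMap_apply]
    simp only [vsub_eq_sub, vadd_eq_add, PiLp.add_apply, PiLp.smul_apply, PiLp.sub_apply]
    rw [ha0, hb0]
    simp

variable [IsContinuousRiemannianBundle (EuclideanSpace ℝ (Fin d))
    (fun x : M => TangentSpace (𝓡∂ d) x)]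
  {f : M → ℝ}

lemma lowerSemicontinuous_eweight (hf : ContMDiff (𝓡∂ d) 𝓘(ℝ, ℝ) ∞ f) :
    LowerSemicontinuous (eweight d f) := by
  intro p y (hy : y < eweight d f p)
  have hy' : y ≠ ⊤ := hy.ne_top
  rw [eweight, ENNReal.lt_ofReal_iff_toReal_lt hy'] at hy
  filter_upwards [eventually_lt_weight hf hy] with x hx
  change y < eweight d f x
  rwa [eweight, ENNReal.lt_ofReal_iff_toReal_lt hy']

lemma exists_eweight_le [CompactSpace M] (hf : ContMDiff (𝓡∂ d) 𝓘(ℝ, ℝ) ∞ f) :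
    ∃ G : ℝ≥0, ∀ x, eweight d f x ≤ G := by
  obtain ⟨C, hC⟩ : ∃ C : ℝ, ∀ x ∈ (univ : Set M), weight d f x ≤ C := by
    refine isCompact_univ.induction_on (p := fun s => ∃ C : ℝ, ∀ x ∈ s, weight d f x ≤ C)
      ⟨0, by simp⟩ (fun s t hst ⟨C, hC⟩ => ⟨C, fun x hx => hC x (hst hx)⟩) ?_ fun p _ => ?_
    · rintro s t ⟨C, hC⟩ ⟨C', hC'⟩
      refine ⟨max C C', ?_⟩
      rintro x (hx | hx)
      · exact (hC x hx).trans (le_max_left _ _)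
      · exact (hC' x hx).trans (le_max_right _ _)
    · obtain ⟨C, hC⟩ := exists_eventually_weight_le hf p
      exact ⟨_, mem_nhdsWithin_of_mem_nhds hC, C, fun x hx => hx⟩
  exact ⟨C.toNNReal, fun x => ENNReal.ofReal_le_ofReal (hC x (mem_univ x))⟩

/-- Away from the stratum of `p`, the weight is bounded below near `p`. -/
lemma exists_eventually_le_weight (hf : ContMDiff (𝓡∂ d) 𝓘(ℝ, ℝ) ∞ f) (h1 : H1 d f) (p : M) :
    ∃ m : ℝ, 0 < m ∧ ∀ᶠ x in 𝓝 p, x ∉ stratum d p → m ≤ weight d f x := by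
  by_cases hp : p ∈ (𝓡∂ d).boundary M
  · have hpos : 0 < ‖grad (d := d) f p‖ := norm_pos_iff.2 (h1.no_critical_boundary p hp)
    refine ⟨‖grad (d := d) f p‖ / 2, by positivity, ?_⟩
    filter_upwards [eventually_lt_weight_of_notMem_boundary hf (by positivity)
      (half_lt_self hpos)] with x hx hxs
    exact (hx fun h => hxs fun _ => h).le
  · exact ⟨1, one_pos, Eventually.of_forall fun x hx => absurd (fun h => absurd h hp) hx⟩

variable [IsRiemannianManifold (𝓡∂ d) M]

lemma hasSpeeds (d : ℕ) [NeZero d] (M : Type*) [EMetricSpace M]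
    [ChartedSpace (EuclideanHalfSpace d) M] [RiemannianBundle (fun x : M => TangentSpace (𝓡∂ d) x)]
    [IsManifold (𝓡∂ d) ∞ M] [IsContinuousRiemannianBundle (EuclideanSpace ℝ (Fin d))
      (fun x : M => TangentSpace (𝓡∂ d) x)] [IsRiemannianManifold (𝓡∂ d) M] : HasSpeeds M :=
  fun _ _ _ _ hγ => ⟨_, hasSpeedOn_mfderiv (I := 𝓡∂ d) hγ⟩

lemma length_eq_wlen (hf : ContMDiff (𝓡∂ d) 𝓘(ℝ, ℝ) ∞ f) {γ : ℝ → M} {K : ℝ≥0}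
    (hγ : LipschitzOnWith K γ (Icc 0 1)) :
    length d f γ (Ioo 0 1) = wlen (eweight d f) γ 0 1 := by
  rw [wlen_eq_lintegral (lowerSemicontinuous_eweight hf) hγ (hasSpeedOn_mfderiv (I := 𝓡∂ d) hγ)
    zero_le_one, length]
  refine lintegral_congr fun t => ?_
  rw [ENNReal.ofReal_mul (weight_nonneg f _), ofReal_norm, eweight]

lemma agmonDist_eq_wdist (hf : ContMDiff (𝓡∂ d) 𝓘(ℝ, ℝ) ∞ f) (x y : M) :
    agmonDist d f x y = wdist (eweight d f) x y := by
  refine iInf_congr fun γ => iInf_congr fun hγ => ?_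
  obtain ⟨K, hK⟩ := hγ.1
  exact length_eq_wlen hf hK

/-- The Agmon weight is tame. At a zero `p` of the weight the closed set is the stratum of `p`, and
points of the stratum are joined by segments in the chart. -/
lemma tameAt (hf : ContMDiff (𝓡∂ d) 𝓘(ℝ, ℝ) ∞ f) (h1 : H1 d f) (p : M) :
    TameAt (eweight d f) p := by
  obtain hp | hp := (weight_nonneg (d := d) f p).eq_or_lt'
  swap
  · obtain ⟨ρ, hρ, hball⟩ := EMetric.mem_nhds_iff.1 (eventually_lt_weight hf (half_lt_self hp))
    obtain ⟨r₀, hr₀, hr₀ρ⟩ := ENNReal.lt_iff_exists_nnreal_btwn.1 hρ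
    refine ⟨∅, (weight d f p / 2).toNNReal, 0, r₀, Real.toNNReal_pos.2 (half_pos hp),
      by exact_mod_cast hr₀, isClosed_empty, fun x hx _ => ?_, by simp, by simp⟩
    exact ENNReal.ofReal_le_ofReal (hball (hx.trans hr₀ρ)).le
  obtain ⟨c, C, hc, hC, hcC⟩ := exists_eventually_weight_comparable hf h1 hp
  obtain ⟨m, hm, hmx⟩ := exists_eventually_le_weight hf h1 p
  obtain ⟨A, hA, hAv⟩ := exists_norm_le_norm_bwd (d := d) p
  obtain ⟨U, s, hU⟩ := exists_isChartBall (I := 𝓡∂ d) p (r := 2) (by norm_num) (inter_mem hcC hmx)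
  obtain ⟨ρ, hρ, hball⟩ := EMetric.mem_nhds_iff.1 (hU.isOpen.mem_nhds hU.mem)
  obtain ⟨r₀, hr₀, hr₀ρ⟩ := ENNReal.lt_iff_exists_nnreal_btwn.1 hρ
  have hr₀' : 0 < r₀ := by exact_mod_cast hr₀
  set φ := extChartAt (𝓡∂ d) p with hφ
  have hdist : ∀ x ∈ U, edist x p ≤ ENNReal.ofReal (2 * A * ‖φ x - φ p‖) := by
    intro x hx
    rw [edist_comm]
    refine (hU.edist_le hU.mem hx).trans ?_
    rw [mul_assoc, ENNReal.ofReal_mul two_pos.le, ← ofReal_norm]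
    refine mul_le_mul' (by simp) (ENNReal.ofReal_le_ofReal (hAv _).2)
  have hdist' : ∀ x ∈ U, ∀ r : ℝ≥0, edist x p ≤ r → ‖φ x - φ p‖ ≤ A * (2 * r) := by
    intro x hx r hr
    refine (hAv _).1.trans (mul_le_mul_of_nonneg_left ?_ hA.le)
    have h2 := (hU.enorm_sub_le p hU.mem x hx).trans (mul_le_mul' le_rfl
      ((edist_comm p x).le.trans hr))
    rw [← ofReal_norm, ENNReal.ofReal_le_iff_le_toReal (by finiteness), ENNReal.toReal_mul] at h2
    exact h2
  refine ⟨stratum d p, (min m (c / (2 * A))).toNNReal, (8 + C * (A * 2)).toNNReal, r₀,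
    Real.toNNReal_pos.2 (by positivity), hr₀', isClosed_stratum p, fun x hx hxs => ?_,
    fun x hxs hx => ?_, fun r hr a ha b hb hap hbp => ?_⟩
  · refine ENNReal.ofReal_le_ofReal ((min_le_left _ _).trans ?_)
    exact (hU.subset (hball (hx.trans hr₀ρ))).2 hxs
  · have hxU := hball (hx.trans hr₀ρ)
    have h2 := ((hU.subset hxU).1 hxs).1
    calc ENNReal.ofReal (min m (c / (2 * A))) * edist x p
        ≤ ENNReal.ofReal (c / (2 * A)) * ENNReal.ofReal (2 * A * ‖φ x - φ p‖) :=
          mul_le_mul' (ENNReal.ofReal_le_ofReal (min_le_right _ _)) (hdist x hxU)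
      _ = ENNReal.ofReal (c * ‖φ x - φ p‖) := by
          rw [← ENNReal.ofReal_mul (by positivity)]
          congr 1
          field_simp
      _ ≤ eweight d f x := ENNReal.ofReal_le_ofReal h2
  · have hrρ : (r : ℝ≥0∞) < ρ := lt_of_le_of_lt (by exact_mod_cast hr) hr₀ρ
    have haU := hball (hap.trans_lt hrρ)
    have hbU := hball (hbp.trans_lt hrρ)
    obtain ⟨β, K, hβ, hK, hβ0, hβ1, hβt⟩ := exists_segment hU haU hbU ha hb
    refine ⟨β, hβ.weaken ?_, hβ0, hβ1, fun t ht => ?_⟩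
    · have h2 : edist a b ≤ r + r := (edist_triangle_right a b p).trans (add_le_add hap hbp)
      have h3 : (K : ℝ≥0∞) ≤ ((8 * r : ℝ≥0) : ℝ≥0∞) := by
        refine hK.trans ((mul_le_mul' le_rfl (mul_le_mul' le_rfl h2)).trans_eq ?_)
        push_cast
        ring
      refine (ENNReal.coe_le_coe.1 h3).trans (mul_le_mul' ?_ le_rfl)
      rw [← NNReal.coe_le_coe, Real.coe_toNNReal _ (by positivity)]
      have : 0 ≤ C * (A * 2) := by positivity
      simpa using this
    · obtain ⟨hN, hst, hseg⟩ := hβt t ht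
      have h2 : φ (β t) ∈ Metric.closedBall (φ p) (A * (2 * r)) :=
        (convex_closedBall _ _).segment_subset
          (mem_closedBall_iff_norm.2 (hdist' a haU r hap))
          (mem_closedBall_iff_norm.2 (hdist' b hbU r hbp)) hseg
      rw [mem_closedBall_iff_norm] at h2
      have h3 := (hN.1 hst).2.trans (mul_le_mul_of_nonneg_left h2 hC.le)
      rw [eweight, ENNReal.ofReal_le_iff_le_toReal (by finiteness), ENNReal.coe_toReal,
        NNReal.coe_mul, Real.coe_toNNReal _ (by positivity)]
      have : (0 : ℝ) ≤ 8 * r := by positivity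
      linarith

/-- By connectedness, any two points are joined by a Lipschitz curve: the relation is locally
satisfied, through segments in charts. -/
lemma lipCurves_nonempty [CompactSpace M] [ConnectedSpace M]
    (hf : ContMDiff (𝓡∂ d) 𝓘(ℝ, ℝ) ∞ f) (x y : M) : (lipCurves x y).Nonempty := by
  obtain ⟨G, hG⟩ := exists_eweight_le hf
  have htri := wdist_triangle (hasSpeeds d M) (lowerSemicontinuous_eweight hf)
  have hloc : ∀ p : M, ∃ U ∈ 𝓝 p, ∀ a ∈ U, ∀ b ∈ U, wdist (eweight d f) a b ≠ ⊤ := by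
    intro p
    obtain ⟨U, s, hU⟩ := exists_isChartBall (I := 𝓡∂ d) p (r := 2) (by norm_num) univ_mem
    refine ⟨U, hU.isOpen.mem_nhds hU.mem, fun a ha b hb => ?_⟩
    have hβ := hU.lipschitzOnWith_segment (hU.mapsTo ha) (hU.mapsTo hb)
    have h1 := (wdist_le_wlen (eweight d f) hβ zero_le_one).trans
      (wlen_le_of_le (hasSpeeds d M) hβ zero_le_one fun t _ => hG _)
    rw [AffineMap.lineMap_apply_zero, AffineMap.lineMap_apply_one, hU.symm_apply ha,
      hU.symm_apply hb] at h1
    exact ne_top_of_le_ne_top (by finiteness) h1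
  have hstep : ∀ p : M, ∃ U ∈ 𝓝 p, ∀ a ∈ U, ∀ b ∈ U, wdist (eweight d f) x a ≠ ⊤ →
      wdist (eweight d f) x b ≠ ⊤ := by
    intro p
    obtain ⟨U, hU, h⟩ := hloc p
    exact ⟨U, hU, fun a ha b hb hxa =>
      ne_top_of_le_ne_top (ENNReal.add_ne_top.2 ⟨hxa, h a ha b hb⟩) (htri x a b)⟩
  have hclopen : IsClopen {z | wdist (eweight d f) x z ≠ ⊤} := by
    refine ⟨isOpen_compl_iff.1 (isOpen_iff_mem_nhds.2 fun p hp => ?_),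
      isOpen_iff_mem_nhds.2 fun p hp => ?_⟩
    · obtain ⟨U, hU, h⟩ := hstep p
      exact mem_of_superset hU fun z hz hxz => hp (h z hz p (mem_of_mem_nhds hU) hxz)
    · obtain ⟨U, hU, h⟩ := hstep p
      exact mem_of_superset hU fun z hz => h p (mem_of_mem_nhds hU) z hz hp
  have hy : wdist (eweight d f) x y ≠ ⊤ := by
    have hxx : wdist (eweight d f) x x ≠ ⊤ := by
      obtain ⟨U, hU, h⟩ := hloc x
      exact h x (mem_of_mem_nhds hU) x (mem_of_mem_nhds hU)
    have : y ∈ {z | wdist (eweight d f) x z ≠ ⊤} := by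
      rw [hclopen.eq_univ ⟨x, hxx⟩]
      exact mem_univ y
    exact this
  by_contra hne
  rw [not_nonempty_iff_eq_empty] at hne
  exact hy (by simp [wdist, hne])

/-- Near a boundary point `p`, moving along the boundary is cheaper than moving inside: the weight
on the boundary is close to `|∇_T f(p)|`, which is smaller than `|∇f(p)|` as `∂_n f(p) ≠ 0`. -/
lemma exists_wdist_le_boundary (hf : ContMDiff (𝓡∂ d) 𝓘(ℝ, ℝ) ∞ f) (h3 : H3 d f) {p : M}
    (hp : p ∈ (𝓡∂ d).boundary M) : ∃ U, IsOpen U ∧ p ∈ U ∧ ∃ m₁ m₂ : ℝ≥0, m₁ < m₂ ∧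
      (∀ a ∈ (𝓡∂ d).boundary M ∩ U, ∀ b ∈ (𝓡∂ d).boundary M ∩ U,
        wdist (eweight d f) a b ≤ m₁ * edist a b) ∧
      ∀ x ∈ U, x ∉ (𝓡∂ d).boundary M → m₂ ≤ eweight d f x := by
  obtain ⟨m₂, hm₂, hm₂'⟩ := exists_between (weight_lt_norm_grad h3 hp)
  obtain ⟨m, hm, hm'⟩ := exists_between hm₂
  have hm0 : 0 ≤ m := (weight_nonneg f p).trans hm.le
  lift m to ℝ≥0 using hm0
  lift m₂ to ℝ≥0 using m.coe_nonneg.trans hm'.le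
  obtain ⟨r, hr, hrm⟩ : ∃ r : ℝ≥0, 1 < r ∧ m * (r * r) < m₂ := by
    have ht : Tendsto (fun r : ℝ≥0 => m * (r * r)) (𝓝[>] 1) (𝓝 (m * (1 * 1))) :=
      (by fun_prop : Continuous fun r : ℝ≥0 => m * (r * r)).continuousAt.tendsto.mono_left
        nhdsWithin_le_nhds
    rw [mul_one, mul_one] at ht
    obtain ⟨r, h2, h3⟩ := ((ht.eventually (gt_mem_nhds (by exact_mod_cast hm'))).and
      self_mem_nhdsWithin).exists
    exact ⟨r, h3, h2⟩
  obtain ⟨U, s, hU⟩ := exists_isChartBall (I := 𝓡∂ d) p hr (inter_mem (eventually_weight_lt hf hm)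
    (eventually_lt_weight_of_notMem_boundary hf m₂.coe_nonneg hm₂'))
  refine ⟨U, hU.isOpen, hU.mem, m * (r * r), m₂, hrm, ?_, fun x hx hxb => ?_⟩
  · rintro a ⟨ha, haU⟩ b ⟨hb, hbU⟩
    obtain ⟨β, K, hβ, hK, hβ0, hβ1, hβt⟩ := exists_segment hU haU hbU (fun _ => ha) fun _ => hb
    have h4 := wdist_le_wlen (eweight d f) hβ zero_le_one
    rw [hβ0, hβ1] at h4
    refine h4.trans
      ((wlen_le_of_le (hasSpeeds d M) hβ zero_le_one (C := m) fun t ht => ?_).trans ?_)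
    · obtain ⟨hN, hst, -⟩ := hβt t ht
      rw [eweight, ENNReal.ofReal_le_iff_le_toReal (by finiteness), ENNReal.coe_toReal]
      exact (hN.1 hst).le
    · rw [sub_zero, ENNReal.ofReal_one, mul_one, ENNReal.coe_mul, ENNReal.coe_mul, mul_assoc,
        mul_assoc]
      exact mul_le_mul' le_rfl hK
  · have h4 := (hU.subset hx).2 hxb
    rw [eweight, ← ENNReal.ofReal_coe_nnreal]
    exact ENNReal.ofReal_le_ofReal h4.le

end Minimizer

end Agmon

theorem mainTheorem9 {d : ℕ} [NeZero d] {M : Type*} [EMetricSpace M] [CompactSpace M]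
    [ConnectedSpace M] [ChartedSpace (EuclideanHalfSpace d) M] [IsManifold (𝓡∂ d) ∞ M]
    [RiemannianBundle (fun x : M => TangentSpace (𝓡∂ d) x)]
    [IsContMDiffRiemannianBundle (𝓡∂ d) ∞ (EuclideanSpace ℝ (Fin d))
      (fun x : M => TangentSpace (𝓡∂ d) x)]
    [IsRiemannianManifold (𝓡∂ d) M]
    (f : M → ℝ) (hf : ContMDiff (𝓡∂ d) 𝓘(ℝ, ℝ) ∞ f)
    (h1 : Agmon.H1 d f) (h3 : Agmon.H3 d f) (x y : M) :
    ∃ (N : ℕ) (I : Fin (N + 1) → Agmon.IntervalKind) (γ : Fin (N + 1) → ℝ → M),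
      (∀ j, Agmon.IsLipschitzCurve (γ j) (I j).toSet) ∧
      (∀ j, (frontier (Agmon.boundaryTimes d (γ j) (I j).toSet)).Finite) ∧
      Agmon.agmonDist d f x y ≠ ⊤ ∧
      Agmon.agmonDist d f x y = ∑ j, Agmon.length d f (γ j) (I j).toSet ∧
      (∀ j, I j = .unit → γ j ∈ Agmon.curvesA d (γ j 0) (γ j 1)) ∧
      (∀ j, I j = .forward →
        Agmon.IsPiecewiseSmooth d (γ j) (Ici 0) ∧ Agmon.IsEikonalRay d f (γ j)) ∧
      (∀ j, I j = .backward →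
        Agmon.IsPiecewiseSmooth d (γ j) (Iic 0) ∧ Agmon.IsEikonalRay d f (fun t => γ j (-t))) ∧
      ∃ z : Fin (N + 2) → M, z 0 = x ∧ z (Fin.last (N + 1)) = y ∧
        ∀ j : Fin (N + 1), Tendsto (γ j) (I j).atStart (𝓝 (z j.castSucc)) ∧
          Tendsto (γ j) (I j).atEnd (𝓝 (z j.succ)) := by
  have hR : IsContinuousRiemannianBundle (EuclideanSpace ℝ (Fin d))
      (fun x : M => TangentSpace (𝓡∂ d) x) := by
    obtain ⟨g, hg, hgi⟩ := IsContMDiffRiemannianBundle.exists_contMDiff (IB := 𝓡∂ d) (n := ∞)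
      (F := EuclideanSpace ℝ (Fin d)) (E := fun x : M => TangentSpace (𝓡∂ d) x)
    exact ⟨g, hg.continuous, hgi⟩
  have hX := Agmon.hasSpeeds d M
  have hg := Agmon.lowerSemicontinuous_eweight hf
  obtain ⟨G, hG⟩ := Agmon.exists_eweight_le hf
  obtain ⟨γ, ⟨⟨K, hγ⟩, h0, h1'⟩, hmin, hfin⟩ := WeightedLength.exists_minimizer hX hg hG
    (Agmon.tameAt hf h1) (Agmon.lipCurves_nonempty hf x y)
  have hfront : (frontier (Agmon.boundaryTimes d γ (Icc 0 1))).Finite :=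
    WeightedLength.finite_frontier_of_minimizer hX hg (Agmon.isClosed_boundary M)
      (fun p hp => Agmon.exists_wdist_le_boundary hf h3 hp) hγ (by rw [h0, h1', hmin]) hfin
  have hlen : Agmon.agmonDist d f x y = Agmon.length d f γ (Icc 0 1) := by
    rw [Agmon.agmonDist_eq_wdist hf, ← hmin, ← Agmon.length_eq_wlen hf hγ, Agmon.length,
      Agmon.length, restrict_Ioo_eq_restrict_Icc]
  -- a single minimizing curve suffices: no half-line is needed
  refine ⟨0, fun _ => .unit, fun _ => γ, fun _ => ⟨K, hγ⟩, fun _ => hfront, ?_, ?_,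
    fun _ _ => ⟨⟨K, hγ⟩, rfl, rfl, hfront⟩, by simp, by simp, ![x, y], rfl, rfl, fun j => ?_⟩
  · rw [Agmon.agmonDist_eq_wdist hf, ← hmin]
    exact hfin
  · rw [Fin.sum_univ_one]
    exact hlen
  · obtain rfl : j = 0 := Fin.fin_one_eq_zero j
    have hl := hγ.continuousOn 0 (left_mem_Icc.2 zero_le_one)
    have hr := hγ.continuousOn 1 (right_mem_Icc.2 zero_le_one)
    rw [ContinuousWithinAt, h0] at hl
    rw [ContinuousWithinAt, h1'] at hr
    refine ⟨hl.mono_left ?_, hr.mono_left ?_⟩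
    · exact nhdsWithin_le_of_mem (mem_of_superset (Ioc_mem_nhdsGT zero_lt_one) Ioc_subset_Icc_self)
    · exact nhdsWithin_le_of_mem (mem_of_superset (Ico_mem_nhdsLT zero_lt_one) Ico_subset_Icc_self)
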